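/- **Setting.** All objects below form sequences indexed by the sample size $n\to\infty$; the index is mostly omitted. Let $p=p_n\ge 2$. One observes $(X,Y)$ with $Y=X\beta+\epsilon$, where $X$ is an $n\times p$ matrix with independent rows distributed as $\mathcal N(0,\Sigma_0)$, $\epsilon\sim\mathcal N(0,I_n)$, and $X$ and $\epsilon$ are independent; $\mathbb E_\beta$ and $\mathrm{var}_\beta$ refer to this law of $(X,Y)$. The covariance matrix $\Sigma_0$ is positive definite with $\Lambda_{\min}(\Sigma_0)\ge L$ and $\max_{i,j}|(\Sigma_0)_{ij}|\le M$ for all $n$, for fixed constants $L,M>0$; write $\Theta_0=\Sigma_0^{-1}$. Let $\|\beta\|_0$ be the number of non-zero entries of $\beta$. For a sequence $d_n$ and a fixed constant $C>0$ put $$\mathcal B(d_n)=\{\beta\in\mathbb R^p:\|\beta\|_0\le d_n,\ \|\beta\|_2\le C\},\qquad B(\beta,r)=\{\tilde\beta\in\mathcal B(d_n):\|\tilde\beta-\beta\|_2\le r\}.$$ An estimator $T=T_n(X,Y)$ is *strongly asymptotically unbiased* for $\xi^T\beta$ at $\beta_0$, in a neighbourhood of size $c>0$, with rate $m_n>0$,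 where $n=o(m_n)$, if $\mathrm{var}_{\beta_0}(T_n)=\mathcal O(1/n)$ and, for every sequence $\beta=\beta_n\in B(\beta_0,c/\sqrt{m_n})$, $\sqrt{m_n}\,(\mathbb E_\beta T_n-\xi^T\beta)\to0$ (the moments involved being finite for all large $n$). For tuning parameters $\lambda,\lambda_1,\dots,\lambda_p>0$ and $\|v\|_n^2=\|v\|_2^2/n$, let $$\hat\beta\in\arg\min_{\beta\in\mathbb R^p}\ \|Y-X\beta\|_n^2+2\lambda\|\beta\|_1,\qquad \hat\gamma_j\in\arg\min_{\gamma\in\mathbb R^{p-1}}\ \|X_j-X_{-j}\gamma\|_n^2+2\lambda_j\|\gamma\|_1,$$ be measurable choices of minimizers, where $X_j$ is the $j$-th column of $X$ and $X_{-j}$ consists of the other columns, and let $\hat\tau_j^2=\|X_j-X_{-j}\hat\gamma_j\|_n^2+\lambda_j\|\hat\gamma_j\|_1$. Let $\hat\Theta$ be the $p\times p$ matrix whose $j$-th column has $j$-th entry $1/\hat\tau_j^2$ and remaining entries $-\hat\gamma_j/\hat\tau_j^2$. Put $$\hat b=\hat\beta+\hat\Theta^TX^T(Y-X\hat\beta)/n,\qquad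 \hat b_\xi=\xi^T\hat b .$$ **Theorem.** There is a constant $\kappa_0>0$, depending only on $L$ and $M$, such that the following holds. Suppose that $d_n=o(\sqrt n/\log p)$, that $\beta_0\in\mathcal B(d_n)$, that every column of $\Theta_0$ has at most $d_n$ non-zero entries, that $\|\xi\|_1=\mathcal O(1)$, and that for some constant $\kappa_1$ all of $\lambda,\lambda_1,\dots,\lambda_p$ lie between $\kappa_0\sqrt{\log p/n}$ and $\kappa_1\sqrt{\log p/n}$, for every $n\ge 1$. Then: 1. There is a rate $m_n$ with $n=o(m_n)$ such that $\hat b_\xi$ is strongly asymptotically unbiased for $\xi^T\beta$ at $\beta_0$ with rate $m_n$, in a neighbourhood of size $c$, for every $c>0$. 2. $\displaystyle \mathrm{var}_{\beta_0}(\hat b_\xi)=\frac{\xi^T\Theta_0\xi+o(1)}{n}.$ 3. Let $c>0$ and let $T$ be any strongly asymptotically unbiased estimator of $\xi^T\beta$ at $\beta_0$ in a neighbourhood of size $c$ with some rate $m_n$. If, for all large $n$, $$\beta_0+\frac{\Theta_0\xi}{(\xi^T\Theta_0\xi\; m_n)^{1/2}}\in B(\beta_0,c/\sqrt{m_n}),$$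 where the fraction is read as $0$ when $\xi=0$, then $$\mathrm{var}_{\beta_0}(T)\ge\frac{\xi^T\Theta_0\xi+o(1)}{n}.$$ Thus $\hat b_\xi$ attains the lower bound in 3, that is, it is asymptotically efficient. -/

import Mathlib

open MeasureTheory ProbabilityTheory Filter Asymptotics Topology Matrix

noncomputable section

namespace HDLinear

/-- Coefficient vectors in `ℝᵖ`; the norm `‖·‖` is the Euclidean norm. -/
abbrev Coef (p : ℕ) := EuclideanSpace ℝ (Fin p)

/-- `n × p` design matrices, given by their rows. -/
abbrev Design (n p : ℕ) := Fin n → EuclideanSpace ℝ (Fin p)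

/-- Observations `(X, Y)`. -/
abbrev Data (n p : ℕ) := Design n p × (Fin n → ℝ)

/-- The vector `X β`. -/
def fit {n p : ℕ} (X : Design n p) (β : Coef p) : Fin n → ℝ :=
  fun i => ∑ j, X i j * β j

/-- The law `P_β` of `(X, X β + ε)` where the rows of `X` are i.i.d. `N(0, S)`,
`ε ~ N(0, I)`, and `X`, `ε` are independent. -/
def law {n p : ℕ} (S : Matrix (Fin p) (Fin p) ℝ) (β : Coef p) : Measure (Data n p) :=
  ((Measure.pi fun _ : Fin n => multivariateGaussian (0 : Coef p) S).prod
    (Measure.pi fun _ : Fin n => gaussianReal 0 1)).map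
      (fun z => (z.1, fun i => fit z.1 β i + z.2 i))

/-- `‖v‖₀`, the number of non-zero entries. -/
def sparsity {p : ℕ} (v : Fin p → ℝ) : ℕ := {j | v j ≠ 0}.ncard

/-- The parameter set `𝓑(d)`: sparsity at most `d` and Euclidean norm at most `C`. -/
def paramSet (p : ℕ) (d C : ℝ) : Set (Coef p) :=
  {β | (sparsity (fun j => β j) : ℝ) ≤ d ∧ ‖β‖ ≤ C}

/-- The neighbourhood `B(β, r)` of `β` inside the parameter set. -/
def nbhd {p : ℕ} (d C : ℝ) (β : Coef p) (r : ℝ) : Set (Coef p) :=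
  {β' | β' ∈ paramSet p d C ∧ ‖β' - β‖ ≤ r}

/-- `‖v‖ₙ² = ‖v‖₂² / n`. -/
def empSq {n : ℕ} (v : Fin n → ℝ) : ℝ := (∑ i, v i ^ 2) / n

/-- `b` is a Lasso solution `argmin_b ‖Y - X b‖ₙ² + 2 lam ‖b‖₁`. -/
def IsLasso {n p : ℕ} (lam : ℝ) (D : Data n p) (b : Coef p) : Prop :=
  IsMinOn (fun b : Coef p => empSq (fun i => D.2 i - fit D.1 b i) + 2 * lam * ∑ j, |b j|)
    Set.univ b

/-- The residual `X_j - X_{-j} γ`; the entries of `γ` are indexed by the columns other than `j`. -/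
def nodeResid {n p : ℕ} (X : Design n p) (j : Fin p) (γ : {k : Fin p // k ≠ j} → ℝ) :
    Fin n → ℝ :=
  fun i => X i j - ∑ k : {k : Fin p // k ≠ j}, X i k * γ k

/-- `γ` solves the nodewise regression
`argmin_γ ‖X_j - X_{-j} γ‖ₙ² + 2 lam ‖γ‖₁`. -/
def IsNodewise {n p : ℕ} (lam : ℝ) (X : Design n p) (j : Fin p)
    (γ : {k : Fin p // k ≠ j} → ℝ) : Prop :=
  IsMinOn (fun γ : {k : Fin p // k ≠ j} → ℝ => empSq (nodeResid X j γ) + 2 * lam * ∑ k, |γ k|)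
    Set.univ γ

/-- `τ̂_j² = ‖X_j - X_{-j} γ‖ₙ² + lam ‖γ‖₁`. -/
def tauSq {n p : ℕ} (lam : ℝ) (X : Design n p) (j : Fin p)
    (γ : {k : Fin p // k ≠ j} → ℝ) : ℝ :=
  empSq (nodeResid X j γ) + lam * ∑ k, |γ k|

/-- The nodewise Lasso matrix `Θ̂`: its `j`-th column has entry `1 / τ̂_j²` in position `j` and
`-γ̂_{j,k} / τ̂_j²` in the positions `k ≠ j`. -/
def thetaHat {n p : ℕ} (lam : Fin p → ℝ) (X : Design n p)
    (γ : ∀ j : Fin p, {k : Fin p // k ≠ j} → ℝ) : Matrix (Fin p) (Fin p) ℝ :=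
  Matrix.of fun k j =>
    (if h : k = j then 1 else -γ j ⟨k, h⟩) / tauSq (lam j) X j (γ j)

/-- The de-sparsified Lasso `b̂ = β̂ + Θ̂ᵀ Xᵀ (Y - X β̂) / n`. -/
def desparsified {n p : ℕ} (Θ : Matrix (Fin p) (Fin p) ℝ) (D : Data n p) (b : Coef p) :
    Fin p → ℝ :=
  fun k => b k + (Θᵀ *ᵥ fun l => ∑ i, D.1 i l * (D.2 i - fit D.1 b i)) k / n

/-- `T` is a strongly asymptotically unbiased estimator of `g` at `β₀`, in a neighbourhood of size
`c`, with rate `m` (where `n = o(m n)`). All parameters are sequences indexed by the sample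
size `n`. The moments occurring in the definition are required to exist for all large `n`. -/
structure StronglyAsympUnbiased {p : ℕ → ℕ} (S : ∀ n, Matrix (Fin (p n)) (Fin (p n)) ℝ)
    (d : ℕ → ℝ) (C : ℝ) (g : ∀ n, Coef (p n) → ℝ) (β₀ : ∀ n, Coef (p n)) (c : ℝ) (m : ℕ → ℝ)
    (T : ∀ n, Data n (p n) → ℝ) : Prop where
  measurable : ∀ n, Measurable (T n)
  rate_pos : ∀ n, 0 < m n
  rate : (fun n : ℕ => (n : ℝ)) =o[atTop] m
  memLp : ∀ᶠ n in atTop, MemLp (T n) 2 (law (S n) (β₀ n))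
  variance : (fun n => variance (T n) (law (S n) (β₀ n))) =O[atTop] fun n : ℕ => 1 / (n : ℝ)
  unbiased : ∀ β : ∀ n, Coef (p n), (∀ n, β n ∈ nbhd (d n) C (β₀ n) (c / √(m n))) →
    (∀ᶠ n in atTop, Integrable (T n) (law (S n) (β n))) ∧
    Tendsto (fun n => √(m n) * ((∫ D, T n D ∂(law (S n) (β n))) - g n (β n))) atTop (𝓝 0)

end HDLinear

end

/-!
The joint law of the design `X` and the noise `ε` does not involve `β`, so everything is done on one
probability space, with the observations a function of `(X, ε)`. The de-sparsified Lasso satisfies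
`b̂_ξ - ξᵀβ = ξᵀ Θ₀ Xᵀ ε / n + R`, where the first term has mean zero and variance exactly
`ξᵀ Θ₀ ξ / n`. If `n E R² → 0` uniformly over the parameter set, then the first two parts of the
theorem follow: the bias is at most `(E R²)^(1/2)`, which is `o(1 / √m)` for some rate `m` of larger
order than `n` (`unbiasedRate`), and the variance changes by `o(1 / n)`
(`desparsified_mean_variance`).

The remainder `R` is a sum, with weights `ξ_j`, of a bias term and a noise term (`remainder_eq`).
The bias term is at most the tuning parameter of the nodewise Lasso times the `ℓ₁`-error of the
Lasso, by the Karush-Kuhn-Tucker conditions (`abs_bias_le`); this is `o(1 / √n)`, of order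
`d log p / n` when `p` is large. The noise term is, given the design, Gaussian with variance
`‖X(Θ̂_j - Θ_j)‖ₙ² / n`, and consistency of the nodewise Lasso in prediction makes it negligible
(`thetaCol_error`). These bounds hold on the event that the sample covariance matrix and the
empirical correlations of the noise with the columns of the design are entrywise close to their
expectations. Two regimes are distinguished so that this event fails with probability at most
`10 / n ^ 8`: when `p ≤ n ^ (1 / 4)`, a fixed power of `n` is available as the level of
concentration and the sample covariance matrix is well conditioned, while for larger `p` the penalty
dominates the noise except on an event whose probability is a high negative power of `p`.

The mean square of `R` also requires moments off this event. There the estimators are controlled by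
bounds valid for every realization, in terms of `‖ε‖ₙ²` and of `1 / τ̂_j²`. The fourth moment of the
latter is at most a multiple of `n ^ 4`: either the residual of the nodewise Lasso is comparable to
the column `X_j` itself, whose norm has finite negative moments, or its penalty is large
(`one_div_tauSq_le`, `lintegral_one_div_tauSq_pow_le`). The polynomial growth is beaten by the
probability of the exceptional event. The outcome is `exists_remainder_rate`.

The lower bound is the Hammersley–Chapman–Robbins inequality (`sq_integral_sub_le`) in the direction
`h = Θ₀ ξ / (ξᵀ Θ₀ ξ m)^(1/2)`, for which `hᵀ Σ₀ h = 1 / m`. Asymptotic unbiasedness fixes the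
change of the mean of the estimator to `((ξᵀ Θ₀ ξ)^(1/2) + o(1)) / √m`, and the `χ²`-divergence
between the two laws is at most `exp (n (1 / m + 2 / m²)) - 1`, which is `(1 + o(1)) n / m` because
`n = o(m)` (`exists_variance_lower_bound`).
-/

open scoped ENNReal NNReal

noncomputable section

namespace HDLinear

/-! ### Gaussian integrals -/

theorem one_le_one_sub_mul_exp {x : ℝ} (h : |x| ≤ 1 / 2) :
    1 ≤ (1 - x) * Real.exp (x + x ^ 2) := by
  obtain ⟨h1, h2⟩ := abs_le.1 h
  rcases le_total 0 x with hx | hx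
  · have h3 : 1 + (x + x ^ 2) + (x + x ^ 2) ^ 2 / 2 ≤ Real.exp (x + x ^ 2) :=
      Real.quadratic_le_exp_of_nonneg (by positivity)
    have h4 : 0 ≤ x ^ 2 * (1 - x - x ^ 2 - x ^ 3) := by
      have h5 : x ^ 2 ≤ 1 / 4 := by nlinarith
      have h6 : x ^ 3 ≤ 1 / 8 := by nlinarith [pow_nonneg hx 2]
      exact mul_nonneg (sq_nonneg x) (by linarith)
    calc (1 : ℝ) ≤ (1 - x) * (1 + (x + x ^ 2) + (x + x ^ 2) ^ 2 / 2) := by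
          nlinarith [h4]
      _ ≤ _ := mul_le_mul_of_nonneg_left h3 (by linarith)
  · have h3 : (x + x ^ 2) + 1 ≤ Real.exp (x + x ^ 2) := Real.add_one_le_exp _
    calc (1 : ℝ) ≤ (1 - x) * ((x + x ^ 2) + 1) := by
          nlinarith [mul_nonneg (sq_nonneg x) (neg_nonneg.2 hx)]
      _ ≤ _ := mul_le_mul_of_nonneg_left h3 (by linarith)

theorem one_div_sqrt_one_sub_le {x : ℝ} (h : |x| ≤ 1 / 4) :
    1 / √(1 - 2 * x) ≤ Real.exp (x + 2 * x ^ 2) := by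
  have h1 := one_le_one_sub_mul_exp (x := 2 * x) (by rw [abs_mul, abs_two]; linarith)
  have h2 : 0 < 1 - 2 * x := by linarith [(abs_le.1 h).2]
  have h3 : Real.exp (2 * x + (2 * x) ^ 2) = Real.exp (x + 2 * x ^ 2) ^ 2 := by
    rw [← Real.exp_nat_mul]; congr 1; push_cast; ring
  rw [div_le_iff₀ (Real.sqrt_pos.2 h2)]
  rw [h3] at h1
  have h4 : 1 ≤ (Real.exp (x + 2 * x ^ 2) * √(1 - 2 * x)) ^ 2 := by
    rw [mul_pow, Real.sq_sqrt h2.le]; linarith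
  by_contra! h5
  have : (Real.exp (x + 2 * x ^ 2) * √(1 - 2 * x)) ^ 2 < 1 := by
    have : 0 ≤ Real.exp (x + 2 * x ^ 2) * √(1 - 2 * x) := by positivity
    nlinarith
  linarith

theorem lintegral_gaussianReal {v : ℝ≥0} (hv : v ≠ 0) {f : ℝ → ℝ≥0∞} (hf : Measurable f) :
    ∫⁻ z, f z ∂gaussianReal 0 v
      = ∫⁻ z, ENNReal.ofReal ((√(2 * Real.pi * v))⁻¹ * Real.exp (-z ^ 2 / (2 * v))) * f z := by
  rw [gaussianReal_of_var_ne_zero _ hv,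
    lintegral_withDensity_eq_lintegral_mul _ (measurable_gaussianPDF 0 v) hf]
  simp [gaussianPDF, gaussianPDFReal]

/-- The Laplace transform of a squared Gaussian variable is at most quadratic on the exponential
scale near the origin. -/
theorem lintegral_exp_mul_sq_gaussianReal_le (v : ℝ≥0) {t : ℝ} (h : |t * v| ≤ 1 / 4) :
    ∫⁻ z, ENNReal.ofReal (Real.exp (t * z ^ 2)) ∂gaussianReal 0 v
      ≤ ENNReal.ofReal (Real.exp (t * v + 2 * (t * v) ^ 2)) := by
  by_cases hv : v = 0
  · simp [hv, gaussianReal_zero_var]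
  have hv0 : (0 : ℝ) < v := by positivity
  have hb : 0 < 1 / (2 * (v : ℝ)) - t := by
    have := (abs_le.1 h).2
    rw [sub_pos, lt_div_iff₀ (by positivity)]; nlinarith
  rw [lintegral_gaussianReal hv (by fun_prop)]
  have h1 : ∀ z : ℝ, ENNReal.ofReal ((√(2 * Real.pi * v))⁻¹ * Real.exp (-z ^ 2 / (2 * v))) *
      ENNReal.ofReal (Real.exp (t * z ^ 2)) =
      ENNReal.ofReal ((√(2 * Real.pi * v))⁻¹ * Real.exp (-(1 / (2 * (v : ℝ)) - t) * z ^ 2)) := by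
    intro z
    rw [← ENNReal.ofReal_mul (by positivity), mul_assoc, ← Real.exp_add]
    congr 3
    field_simp; ring
  simp_rw [h1]
  rw [← ofReal_integral_eq_lintegral_ofReal ((integrable_exp_neg_mul_sq hb).const_mul _)
    (ae_of_all _ fun z => by positivity), integral_const_mul, integral_gaussian]
  apply ENNReal.ofReal_le_ofReal
  refine le_trans (le_of_eq ?_) (one_div_sqrt_one_sub_le h)
  have h2 : 0 < 1 - 2 * (t * v) := by linarith [(abs_le.1 h).2]
  rw [← Real.sqrt_inv, ← Real.sqrt_mul (by positivity), one_div (√_), ← Real.sqrt_inv]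
  congr 1
  have h3 : 1 / (2 * (v : ℝ)) - t = (1 - 2 * (t * v)) / (2 * v) := by field_simp
  rw [h3]
  field_simp

theorem lintegral_exp_mul_gaussianReal (v : ℝ≥0) (t : ℝ) :
    ∫⁻ z, ENNReal.ofReal (Real.exp (t * z)) ∂gaussianReal 0 v
      = ENNReal.ofReal (Real.exp (v * t ^ 2 / 2)) := by
  rw [← ofReal_integral_eq_lintegral_ofReal (integrable_exp_mul_gaussianReal t)
    (ae_of_all _ fun z => by positivity)]
  congr 1
  have := congrFun (mgf_id_gaussianReal (μ := 0) (v := v)) t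
  simpa [mgf] using this

theorem lintegral_rpow_neg_half_Ioo :
    ∫⁻ z in Set.Ioo (0 : ℝ) 1, ENNReal.ofReal (z ^ (-(1 / 2) : ℝ)) = 2 := by
  have hi : IntegrableOn (fun z : ℝ => z ^ (-(1 / 2) : ℝ)) (Set.Ioo 0 1) :=
    (intervalIntegral.integrableOn_Ioo_rpow_iff (s := -(1 / 2)) one_pos).2 (by norm_num)
  rw [← ofReal_integral_eq_lintegral_ofReal hi]
  · rw [← integral_Ioc_eq_integral_Ioo, ← intervalIntegral.integral_of_le zero_le_one,
      integral_rpow (Or.inl (by norm_num))]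
    norm_num
  · filter_upwards [ae_restrict_mem measurableSet_Ioo] with z hz
    exact Real.rpow_nonneg hz.1.le _

/-- Gaussian variables with variance bounded below have a bounded moment of order `-1/2`. -/
theorem lintegral_abs_rpow_neg_half_gaussianReal_le {v : ℝ≥0} {L : ℝ} (hL : 0 < L) (hv : L ≤ v) :
    ∫⁻ z, ENNReal.ofReal (|z| ^ (-(1 / 2) : ℝ)) ∂gaussianReal 0 v
      ≤ ENNReal.ofReal (1 + 4 / √L) := by
  have hv0 : v ≠ 0 := by rintro rfl; simp at hv; linarith
  have hpos : (0 : ℝ) < v := by positivity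
  have hsq : √L ≤ √(2 * Real.pi * v) := by
    apply Real.sqrt_le_sqrt
    nlinarith [Real.pi_gt_three]
  have hsL : 0 < √L := Real.sqrt_pos.2 hL
  set g : ℝ → ℝ≥0∞ := fun z => ENNReal.ofReal (|z| ^ (-(1 / 2) : ℝ)) with hg
  have hgm : Measurable g := by
    simp only [hg]; exact (measurable_norm.pow_const _).ennreal_ofReal
  -- the density is bounded near the origin, and the integrand is bounded away from it
  have hpt : ∀ z : ℝ,
      ENNReal.ofReal ((√(2 * Real.pi * v))⁻¹ * Real.exp (-z ^ 2 / (2 * v))) * g z ≤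
      ENNReal.ofReal ((√(2 * Real.pi * v))⁻¹ * Real.exp (-z ^ 2 / (2 * v))) * 1 +
      ENNReal.ofReal (1 / √L) * ((Set.Ioo (-1 : ℝ) 1).indicator g z) := by
    intro z
    by_cases hz : z ∈ Set.Ioo (-1 : ℝ) 1
    · rw [Set.indicator_of_mem hz]
      refine le_trans ?_ le_add_self
      gcongr
      rw [one_div]
      calc (√(2 * Real.pi * v))⁻¹ * Real.exp (-z ^ 2 / (2 * v))
          ≤ (√(2 * Real.pi * v))⁻¹ * 1 := by
            gcongr
            rw [Real.exp_le_one_iff]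
            apply div_nonpos_of_nonpos_of_nonneg <;> nlinarith [sq_nonneg z]
        _ ≤ (√L)⁻¹ := by rw [mul_one]; gcongr
    · refine le_trans ?_ le_self_add
      gcongr
      simp only [hg]
      rw [← ENNReal.ofReal_one]
      apply ENNReal.ofReal_le_ofReal
      apply Real.rpow_le_one_of_one_le_of_nonpos _ (by norm_num)
      by_contra! h
      exact hz (abs_lt.1 h)
  rw [lintegral_gaussianReal hv0 hgm]
  refine (lintegral_mono hpt).trans ?_
  rw [lintegral_add_left (by fun_prop)]
  rw [← lintegral_gaussianReal hv0 (f := fun _ => 1) measurable_const]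
  rw [lintegral_const_mul _ (hgm.indicator measurableSet_Ioo),
    lintegral_indicator measurableSet_Ioo]
  have hsplit : ∫⁻ z in Set.Ioo (-1 : ℝ) 1, g z ≤ 4 := by
    have h1 : ∫⁻ z in Set.Ioo (0 : ℝ) 1, g z = 2 := by
      rw [← lintegral_rpow_neg_half_Ioo]
      apply setLIntegral_congr_fun measurableSet_Ioo
      intro z hz
      simp only [hg, abs_of_pos hz.1]
    have h2 : ∫⁻ z in Set.Ioo (-1 : ℝ) 0, g z = 2 := by
      rw [← h1]
      have := (Measure.measurePreserving_neg (volume : Measure ℝ)).setLIntegral_comp_preimage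
        (s := Set.Ioo (0:ℝ) 1) measurableSet_Ioo hgm
      rw [← this]
      have e : Neg.neg ⁻¹' Set.Ioo (0:ℝ) 1 = Set.Ioo (-1) 0 := by simp
      rw [e]
      simp [hg]
    have h3 : Set.Ioo (-1 : ℝ) 1 ⊆ (Set.Ioo (-1 : ℝ) 0 ∪ Set.Ioo (0:ℝ) 1) ∪ {0} := by
      intro z hz
      rcases lt_trichotomy z 0 with h | h | h
      · exact Or.inl (Or.inl ⟨hz.1, h⟩)
      · exact Or.inr h
      · exact Or.inl (Or.inr ⟨h, hz.2⟩)
    calc ∫⁻ z in Set.Ioo (-1 : ℝ) 1, g z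
        ≤ ∫⁻ z in (Set.Ioo (-1 : ℝ) 0 ∪ Set.Ioo (0:ℝ) 1) ∪ {0}, g z := lintegral_mono_set h3
      _ ≤ (∫⁻ z in (Set.Ioo (-1 : ℝ) 0 ∪ Set.Ioo (0:ℝ) 1), g z) + ∫⁻ z in {0}, g z :=
          lintegral_union_le g _ _
      _ ≤ (2 + 2) + 0 := by
          refine add_le_add ((lintegral_union_le g _ _).trans (by rw [h1, h2])) ?_
          simp
      _ = 4 := by norm_num
  calc ∫⁻ _, 1 ∂gaussianReal 0 v + ENNReal.ofReal (1 / √L) * ∫⁻ z in Set.Ioo (-1 : ℝ) 1, g z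
      ≤ 1 + ENNReal.ofReal (1 / √L) * 4 := by
        gcongr
        simp
    _ = ENNReal.ofReal (1 + 4 / √L) := by
        rw [ENNReal.ofReal_add (by norm_num) (by positivity)]
        rw [show (4 : ℝ) / √L = 1 / √L * 4 by ring, ENNReal.ofReal_mul (by positivity)]
        simp

/-! ### Independent copies of a functional with Gaussian law -/

theorem lintegral_pi_prod {ι α : Type*} [Fintype ι] [MeasurableSpace α] (μ : Measure α)
    [IsProbabilityMeasure μ] {f : ι → α → ℝ≥0∞} (hf : ∀ i, Measurable (f i)) :
    ∫⁻ x, ∏ i, f i (x i) ∂Measure.pi (fun _ : ι => μ) = ∏ i, ∫⁻ a, f i a ∂μ := by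
  have h := iIndepFun_pi (μ := fun _ : ι => μ) (X := f) (fun i => (hf i).aemeasurable)
  refine (lintegral_prod_eq_prod_lintegral_of_indepFun Finset.univ
    (fun i (x : ι → α) => f i (x i)) h
    (fun i => (hf i).comp (measurable_pi_apply i))).trans ?_
  refine Finset.prod_congr rfl fun i _ => ?_
  exact (measurePreserving_eval (fun _ : ι => μ) i).lintegral_comp (hf i)

section GaussianFunctional

variable {α : Type*} [MeasurableSpace α] {μ : Measure α} [IsProbabilityMeasure μ]
  {φ : α → ℝ} {v : ℝ≥0} {n : ℕ}

theorem lintegral_pi_prod_comp (hφ : Measurable φ) (hlaw : μ.map φ = gaussianReal 0 v)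
    {g : Fin n → ℝ → ℝ≥0∞} (hg : ∀ i, Measurable (g i)) :
    ∫⁻ x, ∏ i, g i (φ (x i)) ∂Measure.pi (fun _ : Fin n => μ)
      = ∏ i, ∫⁻ z, g i z ∂gaussianReal 0 v := by
  rw [lintegral_pi_prod μ (f := fun i a => g i (φ a)) (fun i => (hg i).comp hφ)]
  refine Finset.prod_congr rfl fun i _ => ?_
  rw [← hlaw, lintegral_map (hg i) hφ]

theorem lintegral_exp_sum_sq_le (hφ : Measurable φ) (hlaw : μ.map φ = gaussianReal 0 v)
    {t : ℝ} (h : |t * v| ≤ 1 / 4) :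
    ∫⁻ x, ENNReal.ofReal (Real.exp (t * ∑ i, φ (x i) ^ 2)) ∂Measure.pi (fun _ : Fin n => μ)
      ≤ ENNReal.ofReal (Real.exp (n * (t * v + 2 * (t * v) ^ 2))) := by
  have h1 : ∀ x : Fin n → α, ENNReal.ofReal (Real.exp (t * ∑ i, φ (x i) ^ 2)) =
      ∏ i, ENNReal.ofReal (Real.exp (t * φ (x i) ^ 2)) := by
    intro x
    rw [Finset.mul_sum, Real.exp_sum, ENNReal.ofReal_prod_of_nonneg (fun i _ => by positivity)]
  simp_rw [h1]
  rw [lintegral_pi_prod_comp hφ hlaw (g := fun _ z => ENNReal.ofReal (Real.exp (t * z ^ 2)))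
    (fun i => by fun_prop), Finset.prod_const, Finset.card_univ, Fintype.card_fin, Real.exp_nat_mul,
    ENNReal.ofReal_pow (by positivity)]
  gcongr
  exact lintegral_exp_mul_sq_gaussianReal_le v h

/-- Bernstein inequality for the empirical second moment of a Gaussian functional. -/
theorem measure_abs_sum_sq_sub_gt_le (hφ : Measurable φ) (hlaw : μ.map φ = gaussianReal 0 v)
    {B u : ℝ} (hB : 0 < B) (hv : v ≤ B) (hu : 0 < u) (huB : u ≤ B) :
    Measure.pi (fun _ : Fin n => μ) {x | n * u < |∑ i, φ (x i) ^ 2 - n * v|}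
      ≤ ENNReal.ofReal (2 * Real.exp (-(n * u ^ 2 / (8 * B ^ 2)))) := by
  set P := Measure.pi (fun _ : Fin n => μ)
  have key : ∀ s : ℝ, (s = 1 ∨ s = -1) →
      P {x | n * u < s * (∑ i, φ (x i) ^ 2 - n * v)}
        ≤ ENNReal.ofReal (Real.exp (-(n * u ^ 2 / (8 * B ^ 2)))) := by
    intro s hs
    have hs2 : s ^ 2 = 1 := by rcases hs with h | h <;> simp [h]
    have hsa : |s| = 1 := by rcases hs with h | h <;> simp [h]
    set θ : ℝ := u / (4 * B ^ 2) with hθ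
    have hθ0 : 0 < θ := by positivity
    have hv0 : (0 : ℝ) ≤ v := v.2
    have hθB : θ * B ≤ 1 / 4 := by
      rw [hθ]; rw [div_mul_eq_mul_div, div_le_div_iff₀ (by positivity) (by norm_num)]
      nlinarith
    have hθv : |s * θ * v| ≤ 1 / 4 := by
      rw [abs_mul, abs_mul, hsa, one_mul, abs_of_pos hθ0, abs_of_nonneg hv0]
      nlinarith
    have hsub : {x : Fin n → α | n * u < s * (∑ i, φ (x i) ^ 2 - n * v)} ⊆
        {x | ENNReal.ofReal (Real.exp (θ * (n * u) + s * θ * (n * v))) ≤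
          ENNReal.ofReal (Real.exp ((s * θ) * ∑ i, φ (x i) ^ 2))} := by
      intro x hx
      simp only [Set.mem_ofPred_eq] at hx ⊢
      apply ENNReal.ofReal_le_ofReal
      apply Real.exp_le_exp.2
      nlinarith
    refine (measure_mono hsub).trans ?_
    have hm : AEMeasurable
        (fun x : Fin n → α => ENNReal.ofReal (Real.exp ((s * θ) * ∑ i, φ (x i) ^ 2))) P :=
      Measurable.aemeasurable (by fun_prop)
    refine (meas_ge_le_lintegral_div hm (by simp [Real.exp_pos]) (by simp)).trans ?_
    rw [ENNReal.div_le_iff (by simp [Real.exp_pos]) (by simp)]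
    refine (lintegral_exp_sum_sq_le hφ hlaw hθv).trans ?_
    rw [← ENNReal.ofReal_mul (by positivity), ← Real.exp_add]
    apply ENNReal.ofReal_le_ofReal
    apply Real.exp_le_exp.2
    have h1 : (s * θ * v) ^ 2 ≤ θ ^ 2 * B ^ 2 := by
      rw [mul_pow, mul_pow, hs2, one_mul]
      have : (v : ℝ) ^ 2 ≤ B ^ 2 := by gcongr
      nlinarith [sq_nonneg θ]
    have h2 : -(n * u ^ 2 / (8 * B ^ 2)) = n * (2 * (θ ^ 2 * B ^ 2)) - θ * (n * u) := by
      rw [hθ]; field_simp; ring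
    rw [h2]
    have h3 : (0 : ℝ) ≤ n := Nat.cast_nonneg n
    nlinarith [mul_le_mul_of_nonneg_left h1 h3]
  have hsub : {x : Fin n → α | n * u < |∑ i, φ (x i) ^ 2 - n * v|} ⊆
      {x | n * u < 1 * (∑ i, φ (x i) ^ 2 - n * v)} ∪
      {x | n * u < (-1) * (∑ i, φ (x i) ^ 2 - n * v)} := by
    intro x hx
    simp only [Set.mem_ofPred_eq, lt_abs] at hx
    rcases hx with h | h
    · left; simpa using h
    · right; simp only [Set.mem_ofPred_eq]; linarith
  refine (measure_mono hsub).trans ((measure_union_le _ _).trans ?_)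
  rw [two_mul, ENNReal.ofReal_add (by positivity) (by positivity)]
  exact add_le_add (key 1 (Or.inl rfl)) (key (-1) (Or.inr rfl))

/-- Turns exponential moments into polynomial ones. -/
theorem pow_le_factorial_mul_exp {x : ℝ} (hx : 0 ≤ x) (q : ℕ) :
    x ^ q ≤ q.factorial * Real.exp x := by
  have := Real.pow_div_factorial_le_exp x hx q
  rwa [div_le_iff₀ (by positivity), mul_comm] at this

/-- All moments of an empirical second moment are bounded uniformly in the sample size. -/
theorem lintegral_mean_sq_pow_le (hφ : Measurable φ) (hlaw : μ.map φ = gaussianReal 0 v)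
    {B : ℝ} (hB : 0 < B) (hv : v ≤ B) (hn : 1 ≤ n) (q : ℕ) :
    ∫⁻ x, ENNReal.ofReal (((∑ i, φ (x i) ^ 2) / n) ^ q) ∂Measure.pi (fun _ : Fin n => μ)
      ≤ ENNReal.ofReal (q.factorial * (4 * B) ^ q * Real.exp 1) := by
  have hn0 : (1 : ℝ) ≤ n := by exact_mod_cast hn
  have hv0 : (0 : ℝ) ≤ v := v.2
  have hpt : ∀ x : Fin n → α, ENNReal.ofReal (((∑ i, φ (x i) ^ 2) / n) ^ q) ≤
      ENNReal.ofReal (q.factorial * (4 * B) ^ q) *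
        ENNReal.ofReal (Real.exp (1 / (4 * B * n) * ∑ i, φ (x i) ^ 2)) := by
    intro x
    rw [← ENNReal.ofReal_mul (by positivity)]
    apply ENNReal.ofReal_le_ofReal
    have h1 : 0 ≤ ∑ i, φ (x i) ^ 2 := Finset.sum_nonneg fun i _ => sq_nonneg _
    have h2 := pow_le_factorial_mul_exp (x := 1 / (4 * B * n) * ∑ i, φ (x i) ^ 2)
      (by positivity) q
    calc ((∑ i, φ (x i) ^ 2) / n) ^ q
        = (4 * B) ^ q * (1 / (4 * B * n) * ∑ i, φ (x i) ^ 2) ^ q := by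
          rw [← mul_pow]; congr 1; field_simp
      _ ≤ (4 * B) ^ q * (q.factorial * Real.exp (1 / (4 * B * n) * ∑ i, φ (x i) ^ 2)) := by
          gcongr
      _ = _ := by ring
  refine (lintegral_mono hpt).trans ?_
  rw [lintegral_const_mul _ (by fun_prop),
    ENNReal.ofReal_mul (p := q.factorial * (4 * B) ^ q) (by positivity)]
  refine mul_le_mul_right (α := ℝ≥0∞) ?_ _
  have h4 : 1 / (4 * B * n) * (v : ℝ) ≤ 1 / (4 * n) := by
    rw [div_mul_eq_mul_div, div_le_div_iff₀ (by positivity) (by positivity)]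
    nlinarith
  have h40 : 0 ≤ 1 / (4 * B * n) * (v : ℝ) := by positivity
  have h5 : 1 / (4 * (n : ℝ)) ≤ 1 / 4 := by
    apply one_div_le_one_div_of_le <;> linarith
  refine (lintegral_exp_sum_sq_le hφ hlaw (by rw [abs_of_nonneg h40]; linarith)).trans ?_
  apply ENNReal.ofReal_le_ofReal
  apply Real.exp_le_exp.2
  set w := 1 / (4 * B * n) * (v : ℝ)
  have h6 : (n : ℝ) * w ≤ 1 / 4 := by
    calc (n : ℝ) * w ≤ n * (1 / (4 * n)) := by gcongr
      _ = 1 / 4 := by field_simp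
  nlinarith

/-- By the inequality between arithmetic and geometric means for the first `16` coordinates, the
exponent `-4` on the sum becomes an exponent `-1/2` on each coordinate. The latter is integrable for
a Gaussian coordinate, while `|z| ^ (-8)` is not. -/
theorem inv_pow_four_le_prod (a : Fin n → ℝ) (hn : 16 ≤ n) (hne : ∀ i, a i ≠ 0) :
    1 / (∑ i, a i ^ 2) ^ 4 ≤ ∏ i : Fin n, (if (i : ℕ) < 16 then |a i| ^ (-(1 / 2) : ℝ) else 1) := by
  set s : Finset (Fin n) := Finset.univ.filter fun i => (i : ℕ) < 16 with hs
  have hcard : s.card = 16 := by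
    rw [hs, Fin.card_filter_val_lt]; omega
  have h0 : ∀ i, 0 < a i ^ 2 := fun i => by have := hne i; positivity
  have h1 := Real.geom_mean_le_arith_mean_weighted s (fun _ => (1 / 16 : ℝ)) (fun i => a i ^ 2)
    (fun _ _ => by norm_num) (by rw [Finset.sum_const, hcard]; norm_num) (fun i _ => (h0 i).le)
  have h2 : ∑ i ∈ s, 1 / 16 * a i ^ 2 ≤ ∑ i, a i ^ 2 := by
    refine le_trans ?_ (Finset.sum_le_univ_sum_of_nonneg (s := s) fun i => (h0 i).le)
    refine Finset.sum_le_sum fun i _ => ?_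
    linarith [h0 i]
  have h3 : 0 < ∏ i ∈ s, (a i ^ 2) ^ (1 / 16 : ℝ) :=
    Finset.prod_pos fun i _ => Real.rpow_pos_of_pos (h0 i) _
  have h4 : (∏ i ∈ s, (a i ^ 2) ^ (1 / 16 : ℝ)) ^ 4 ≤ (∑ i, a i ^ 2) ^ 4 := by
    have := h1.trans h2
    gcongr
  calc 1 / (∑ i, a i ^ 2) ^ 4 ≤ 1 / (∏ i ∈ s, (a i ^ 2) ^ (1 / 16 : ℝ)) ^ 4 :=
        one_div_le_one_div_of_le (by positivity) h4
    _ = ∏ i ∈ s, |a i| ^ (-(1 / 2) : ℝ) := by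
        rw [one_div, ← Finset.prod_pow, ← Finset.prod_inv_distrib]
        refine Finset.prod_congr rfl fun i _ => ?_
        rw [← sq_abs, ← Real.rpow_natCast (_ ^ (1 / 16 : ℝ)) 4, ← Real.rpow_natCast |a i| 2,
          ← Real.rpow_mul (abs_nonneg _), ← Real.rpow_mul (abs_nonneg _),
          ← Real.rpow_neg (abs_nonneg _)]
        norm_num
    _ = _ := by rw [hs, Finset.prod_filter]

/-- The negative fourth moment of an empirical second moment grows at most polynomially. -/
theorem lintegral_inv_mean_sq_pow_le (hφ : Measurable φ) (hlaw : μ.map φ = gaussianReal 0 v)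
    {L : ℝ} (hL : 0 < L) (hv : L ≤ v) (hn : 16 ≤ n) :
    ∫⁻ x, ENNReal.ofReal (1 / ((∑ i, φ (x i) ^ 2) / n) ^ 4) ∂Measure.pi (fun _ : Fin n => μ)
      ≤ ENNReal.ofReal (n ^ 4 * (1 + 4 / √L) ^ 16) := by
  have hv0 : v ≠ 0 := by rintro rfl; simp at hv; linarith
  set P := Measure.pi (fun _ : Fin n => μ)
  have hn0 : (0 : ℝ) < n := by exact_mod_cast (by omega : 0 < n)
  have hne : ∀ᵐ x ∂P, ∀ i, φ (x i) ≠ 0 := by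
    rw [ae_all_iff]
    intro i
    have hnull : μ (φ ⁻¹' {0}) = 0 := by
      rw [← Measure.map_apply hφ (measurableSet_singleton 0), hlaw]
      have := nullSingletonClass_gaussianReal (μ := 0) hv0
      exact measure_singleton 0
    have : P ((fun x => x i) ⁻¹' (φ ⁻¹' {0})) = 0 := by
      rw [(measurePreserving_eval (fun _ : Fin n => μ) i).measure_preimage
        (hφ (measurableSet_singleton 0)).nullMeasurableSet, hnull]
    rw [ae_iff]
    convert this using 2
    ext x; simp
  set g : Fin n → ℝ → ℝ≥0∞ := fun i z =>
    if (i : ℕ) < 16 then ENNReal.ofReal (|z| ^ (-(1 / 2) : ℝ)) else 1 with hg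
  have hgm : ∀ i, Measurable (g i) := by
    intro i
    simp only [hg]
    split_ifs
    · exact (measurable_norm.pow_const _).ennreal_ofReal
    · exact measurable_const
  have hpt : ∀ᵐ x ∂P, ENNReal.ofReal (1 / ((∑ i, φ (x i) ^ 2) / n) ^ 4) ≤
      ENNReal.ofReal (n ^ 4) * ∏ i, g i (φ (x i)) := by
    filter_upwards [hne] with x hx
    have h1 := inv_pow_four_le_prod (fun i => φ (x i)) hn hx
    have h2 : ∏ i, g i (φ (x i)) = ENNReal.ofReal
        (∏ i : Fin n, (if (i : ℕ) < 16 then |φ (x i)| ^ (-(1 / 2) : ℝ) else 1)) := by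
      rw [ENNReal.ofReal_prod_of_nonneg]
      · refine Finset.prod_congr rfl fun i _ => ?_
        simp only [hg]; split_ifs <;> simp
      · intro i _; split_ifs <;> positivity
    rw [h2, ← ENNReal.ofReal_mul (by positivity)]
    apply ENNReal.ofReal_le_ofReal
    calc 1 / ((∑ i, φ (x i) ^ 2) / n) ^ 4 = n ^ 4 * (1 / (∑ i, φ (x i) ^ 2) ^ 4) := by
          rw [div_pow]; field_simp
      _ ≤ _ := by gcongr
  refine (lintegral_mono_ae hpt).trans ?_
  have hpm : Measurable fun x : Fin n → α => ∏ i, g i (φ (x i)) :=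
    Finset.measurable_prod _ fun i _ => (hgm i).comp (hφ.comp (measurable_pi_apply i))
  rw [lintegral_const_mul _ hpm, lintegral_pi_prod_comp hφ hlaw hgm,
    ENNReal.ofReal_mul (by positivity)]
  gcongr
  set K : ℝ≥0∞ := ENNReal.ofReal (1 + 4 / √L) with hK
  calc ∏ i, ∫⁻ z, g i z ∂gaussianReal 0 v
      ≤ ∏ i : Fin n, (if (i : ℕ) < 16 then K else 1) := by
        refine Finset.prod_le_prod' fun i _ => ?_
        simp only [hg]
        split_ifs
        · exact lintegral_abs_rpow_neg_half_gaussianReal_le hL hv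
        · simp
    _ = K ^ 16 := by
        rw [← Finset.prod_filter, Finset.prod_const, Fin.card_filter_val_lt]
        congr 1; omega
    _ = _ := by rw [hK, ENNReal.ofReal_pow (by positivity)]

end GaussianFunctional

/-! ### The covariance matrix and its inverse -/

section Covariance

variable {p : ℕ} {S : Matrix (Fin p) (Fin p) ℝ} {L M : ℝ}

theorem eigenvalue_mul_sum_sq_le (hS : S.PosDef) (hL : ∀ i, L ≤ hS.isHermitian.eigenvalues i)
    (v : Fin p → ℝ) : L * ∑ k, v k ^ 2 ≤ v ⬝ᵥ S *ᵥ v := by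
  set U := hS.isHermitian.eigenvectorBasis
  set x : EuclideanSpace ℝ (Fin p) := WithLp.toLp 2 v
  have h1 : ∑ i, U.repr x i • U i = x := U.sum_repr x
  have h2 : S *ᵥ v = ∑ i, (U.repr x i * hS.isHermitian.eigenvalues i) • (U i).ofLp := by
    have : v = ∑ i, U.repr x i • (U i).ofLp := by
      have := congrArg WithLp.ofLp h1
      simpa using this.symm
    conv_lhs => rw [this]
    rw [Matrix.mulVec_sum]
    refine Finset.sum_congr rfl fun i _ => ?_
    rw [Matrix.mulVec_smul, hS.isHermitian.mulVec_eigenvectorBasis, smul_smul]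
  have h3 : ∀ i, v ⬝ᵥ (U i).ofLp = U.repr x i := by
    intro i
    rw [U.repr_apply_apply, EuclideanSpace.inner_eq_star_dotProduct]
    simp [x]
  have h4 : v ⬝ᵥ S *ᵥ v = ∑ i, hS.isHermitian.eigenvalues i * (U.repr x i) ^ 2 := by
    rw [h2, dotProduct_sum]
    refine Finset.sum_congr rfl fun i _ => ?_
    rw [dotProduct_smul, h3, smul_eq_mul]; ring
  have h5 : ∑ k, v k ^ 2 = ∑ i, (U.repr x i) ^ 2 := by
    have h6 : ‖U.repr x‖ ^ 2 = ‖x‖ ^ 2 := by rw [U.repr.norm_map]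
    rw [EuclideanSpace.real_norm_sq_eq, EuclideanSpace.real_norm_sq_eq] at h6
    exact h6.symm
  rw [h4, h5, Finset.mul_sum]
  exact Finset.sum_le_sum fun i _ => mul_le_mul_of_nonneg_right (hL i) (sq_nonneg _)

theorem mul_inv_eq_one (hS : S.PosDef) : S * S⁻¹ = 1 :=
  Matrix.mul_nonsing_inv _ (hS.isUnit.map Matrix.detMonoidHom)

theorem mulVec_inv_mulVec (hS : S.PosDef) (ξ : Fin p → ℝ) : S *ᵥ (S⁻¹ *ᵥ ξ) = ξ := by
  rw [Matrix.mulVec_mulVec, mul_inv_eq_one hS, Matrix.one_mulVec]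

theorem inv_mulVec_quadratic (hS : S.PosDef) (ξ : Fin p → ℝ) :
    (S⁻¹ *ᵥ ξ) ⬝ᵥ S *ᵥ (S⁻¹ *ᵥ ξ) = ξ ⬝ᵥ S⁻¹ *ᵥ ξ := by
  rw [mulVec_inv_mulVec hS, dotProduct_comm]

theorem inv_quadratic_nonneg (hS : S.PosDef) (ξ : Fin p → ℝ) : 0 ≤ ξ ⬝ᵥ S⁻¹ *ᵥ ξ := by
  simpa using hS.inv.posSemidef.dotProduct_mulVec_nonneg ξ

theorem inv_quadratic_le (hS : S.PosDef) (hL0 : 0 < L)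
    (hL : ∀ i, L ≤ hS.isHermitian.eigenvalues i) (ξ : Fin p → ℝ) :
    ξ ⬝ᵥ S⁻¹ *ᵥ ξ ≤ (∑ k, ξ k ^ 2) / L := by
  have h1 := eigenvalue_mul_sum_sq_le hS hL (S⁻¹ *ᵥ ξ)
  rw [inv_mulVec_quadratic hS] at h1
  set w := S⁻¹ *ᵥ ξ
  have h2 : 2 * (ξ ⬝ᵥ w) ≤ (∑ k, ξ k ^ 2) / L + L * ∑ k, w k ^ 2 := by
    rw [dotProduct, Finset.mul_sum, Finset.sum_div, Finset.mul_sum, ← Finset.sum_add_distrib]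
    refine Finset.sum_le_sum fun k _ => ?_
    have : 0 ≤ (ξ k - L * w k) ^ 2 / L := by positivity
    have e : (ξ k - L * w k) ^ 2 / L = ξ k ^ 2 / L + L * w k ^ 2 - 2 * (ξ k * w k) := by
      field_simp; ring
    linarith
  linarith

theorem sum_sq_le_sum_abs_sq {ι : Type*} (s : Finset ι) (ξ : ι → ℝ) :
    ∑ k ∈ s, ξ k ^ 2 ≤ (∑ k ∈ s, |ξ k|) ^ 2 := by
  simp_rw [← sq_abs (ξ _)]
  exact Finset.sum_sq_le_sq_sum_of_nonneg fun _ _ => abs_nonneg _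

/-- The columns of the precision matrix. -/
def precCol (S : Matrix (Fin p) (Fin p) ℝ) (j : Fin p) : Fin p → ℝ := fun k => S⁻¹ k j

theorem precCol_eq (j : Fin p) : precCol S j = S⁻¹ *ᵥ Pi.single j 1 := by
  ext k; simp [precCol]

theorem mulVec_precCol (hS : S.PosDef) (j : Fin p) : S *ᵥ precCol S j = Pi.single j 1 := by
  rw [precCol_eq, mulVec_inv_mulVec hS]

theorem precCol_quadratic (hS : S.PosDef) (j : Fin p) :
    precCol S j ⬝ᵥ S *ᵥ precCol S j = S⁻¹ j j := by
  rw [mulVec_precCol hS]; simp [precCol]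

theorem precision_diag_pos (hS : S.PosDef) (j : Fin p) : 0 < S⁻¹ j j := hS.inv.diag_pos

theorem precision_diag_le (hS : S.PosDef) (hL0 : 0 < L)
    (hL : ∀ i, L ≤ hS.isHermitian.eigenvalues i) (j : Fin p) : S⁻¹ j j ≤ 1 / L := by
  have h := inv_quadratic_le hS hL0 hL (Pi.single j 1)
  have e : ∑ k, (Pi.single j (1 : ℝ) : Fin p → ℝ) k ^ 2 = 1 := by
    rw [Finset.sum_eq_single j] <;> simp +contextual
  rw [e] at h
  simpa using h

theorem sum_sq_precCol_le (hS : S.PosDef) (hL0 : 0 < L)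
    (hL : ∀ i, L ≤ hS.isHermitian.eigenvalues i) (j : Fin p) :
    ∑ k, precCol S j k ^ 2 ≤ 1 / L ^ 2 := by
  have h := eigenvalue_mul_sum_sq_le hS hL (precCol S j)
  rw [precCol_quadratic hS] at h
  have h2 := h.trans (precision_diag_le hS hL0 hL j)
  rw [le_div_iff₀ hL0] at h2
  rw [le_div_iff₀ (by positivity)]
  nlinarith

/-- The residual variance of a coordinate regressed on the others is at most its variance. -/
theorem one_le_diag_mul_precision_diag (hS : S.PosDef) (j : Fin p) : 1 ≤ S j j * S⁻¹ j j := by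
  have hpos := precision_diag_pos hS j
  set s := 1 / S⁻¹ j j with hs
  have h := hS.posSemidef.dotProduct_mulVec_nonneg (Pi.single j 1 - s • precCol S j)
  have e : (Pi.single j 1 - s • precCol S j) ⬝ᵥ S *ᵥ (Pi.single j 1 - s • precCol S j)
      = S j j - 2 * s + s ^ 2 * S⁻¹ j j := by
    rw [Matrix.mulVec_sub, Matrix.mulVec_smul, mulVec_precCol hS, sub_dotProduct, dotProduct_sub,
      dotProduct_sub, smul_dotProduct, smul_dotProduct, dotProduct_smul, dotProduct_smul]
    have h1 : precCol S j ⬝ᵥ S *ᵥ Pi.single j 1 = 1 := by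
      rw [Matrix.dotProduct_mulVec, ← Matrix.mulVec_transpose]
      have : Sᵀ = S := by simpa using hS.isHermitian.eq
      rw [this, mulVec_precCol hS]; simp
    rw [h1]
    simp [precCol]; ring
  simp only [star_trivial] at h
  rw [e] at h
  have e2 : s ^ 2 * S⁻¹ j j = s := by rw [hs]; field_simp
  rw [e2] at h
  have : s ≤ S j j := by linarith
  calc 1 = s * S⁻¹ j j := by rw [hs]; field_simp
    _ ≤ _ := by gcongr

end Covariance

/-! ### Empirical inner products -/

section Empirical

variable {n p : ℕ}

/-- The empirical inner product `⟨a, b⟩ₙ = aᵀ b / n`. -/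
def empInner (a b : Fin n → ℝ) : ℝ := (∑ i, a i * b i) / n

/-- The vector `X v`, for a vector `v` that does not carry the Euclidean norm. -/
def lin (X : Design n p) (v : Fin p → ℝ) : Fin n → ℝ := fun i => ∑ k, X i k * v k

/-- The `k`-th column of the design. -/
def col (X : Design n p) (k : Fin p) : Fin n → ℝ := fun i => X i k

theorem empInner_self (a : Fin n → ℝ) : empInner a a = empSq a := by
  simp [empInner, empSq, pow_two]

theorem empInner_comm (a b : Fin n → ℝ) : empInner a b = empInner b a := by
  simp [empInner, mul_comm]

theorem empInner_add_right (a b c : Fin n → ℝ) :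
    empInner a (b + c) = empInner a b + empInner a c := by
  simp [empInner, mul_add, Finset.sum_add_distrib, add_div]

theorem empInner_smul_right (a b : Fin n → ℝ) (s : ℝ) :
    empInner a (s • b) = s * empInner a b := by
  simp only [empInner, Pi.smul_apply, smul_eq_mul]
  rw [← mul_div_assoc, Finset.mul_sum]
  congr 1
  exact Finset.sum_congr rfl fun i _ => by ring

theorem empInner_sub_right (a b c : Fin n → ℝ) :
    empInner a (b - c) = empInner a b - empInner a c := by
  simp [empInner, mul_sub, Finset.sum_sub_distrib, sub_div]

theorem empInner_add_left (a b c : Fin n → ℝ) :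
    empInner (a + b) c = empInner a c + empInner b c := by
  rw [empInner_comm, empInner_add_right, empInner_comm c, empInner_comm c]

theorem empInner_sub_left (a b c : Fin n → ℝ) :
    empInner (a - b) c = empInner a c - empInner b c := by
  rw [empInner_comm, empInner_sub_right, empInner_comm c, empInner_comm c]

theorem empInner_smul_left (a b : Fin n → ℝ) (s : ℝ) :
    empInner (s • a) b = s * empInner a b := by
  rw [empInner_comm, empInner_smul_right, empInner_comm b]

theorem empSq_nonneg (a : Fin n → ℝ) : 0 ≤ empSq a :=
  div_nonneg (Finset.sum_nonneg fun _ _ => sq_nonneg _) (Nat.cast_nonneg _)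

theorem empSq_add (a b : Fin n → ℝ) :
    empSq (a + b) = empSq a + 2 * empInner a b + empSq b := by
  rw [← empInner_self, empInner_add_right, empInner_add_left, empInner_add_left, empInner_self,
    empInner_self, empInner_comm b a]; ring

theorem empSq_sub (a b : Fin n → ℝ) :
    empSq (a - b) = empSq a - 2 * empInner a b + empSq b := by
  rw [← empInner_self, empInner_sub_right, empInner_sub_left, empInner_sub_left, empInner_self,
    empInner_self, empInner_comm b a]; ring

theorem empSq_smul (s : ℝ) (a : Fin n → ℝ) : empSq (s • a) = s ^ 2 * empSq a := by
  rw [← empInner_self, empInner_smul_right, empInner_smul_left, empInner_self]; ring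

theorem empSq_add_le (a b : Fin n → ℝ) : empSq (a + b) ≤ 2 * empSq a + 2 * empSq b := by
  have := empSq_nonneg (a - b)
  rw [empSq_sub] at this
  rw [empSq_add]; linarith

theorem empSq_sub_le (a b : Fin n → ℝ) : empSq (a - b) ≤ 2 * empSq a + 2 * empSq b := by
  have := empSq_nonneg (a + b)
  rw [empSq_add] at this
  rw [empSq_sub]; linarith

theorem empInner_sq_le (a b : Fin n → ℝ) : empInner a b ^ 2 ≤ empSq a * empSq b := by
  rw [empInner, empSq, empSq, div_pow, div_mul_div_comm, ← pow_two]
  gcongr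
  exact Finset.sum_mul_sq_le_sq_mul_sq _ _ _

theorem abs_empInner_le (a b : Fin n → ℝ) : |empInner a b| ≤ √(empSq a) * √(empSq b) := by
  rw [← Real.sqrt_mul (empSq_nonneg _)]
  exact Real.abs_le_sqrt (empInner_sq_le a b)

theorem lin_add (X : Design n p) (v w : Fin p → ℝ) : lin X (v + w) = lin X v + lin X w := by
  ext i; simp [lin, mul_add, Finset.sum_add_distrib]

theorem lin_sub (X : Design n p) (v w : Fin p → ℝ) : lin X (v - w) = lin X v - lin X w := by
  ext i; simp [lin, mul_sub, Finset.sum_sub_distrib]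

theorem lin_smul (X : Design n p) (s : ℝ) (v : Fin p → ℝ) : lin X (s • v) = s • lin X v := by
  ext i
  simp only [lin, Pi.smul_apply, smul_eq_mul, Finset.mul_sum]
  exact Finset.sum_congr rfl fun k _ => by ring

theorem lin_single (X : Design n p) (k : Fin p) : lin X (Pi.single k 1) = col X k := by
  ext i; simp [lin, col, Pi.single_apply]

theorem fit_eq_lin (X : Design n p) (β : Coef p) : fit X β = lin X β.ofLp := rfl

theorem empInner_lin (X : Design n p) (a : Fin n → ℝ) (v : Fin p → ℝ) :
    empInner a (lin X v) = ∑ k, v k * empInner a (col X k) := by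
  simp only [empInner, lin, col, Finset.mul_sum, ← mul_div_assoc]
  rw [Finset.sum_comm, Finset.sum_div]
  refine Finset.sum_congr rfl fun k _ => ?_
  congr 1
  exact Finset.sum_congr rfl fun i _ => by ring

theorem abs_empInner_lin_le (X : Design n p) (a : Fin n → ℝ) (v : Fin p → ℝ) {T : ℝ}
    (hT : ∀ k, v k ≠ 0 → |empInner a (col X k)| ≤ T) :
    |empInner a (lin X v)| ≤ T * ∑ k, |v k| := by
  rw [empInner_lin, Finset.mul_sum]
  refine (Finset.abs_sum_le_sum_abs _ _).trans (Finset.sum_le_sum fun k _ => ?_)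
  rw [abs_mul, mul_comm]
  by_cases h : v k = 0
  · simp [h]
  · exact mul_le_mul_of_nonneg_right (hT k h) (abs_nonneg _)

/-- If the sample covariance is entrywise close to `S`, then the corresponding quadratic forms
differ by at most a multiple of the squared `ℓ₁`-norm. -/
theorem quadratic_le_empSq_lin (X : Design n p) (S : Matrix (Fin p) (Fin p) ℝ) {t : ℝ}
    (h : ∀ j k, |empInner (col X j) (col X k) - S j k| ≤ t) (v : Fin p → ℝ) :
    v ⬝ᵥ S *ᵥ v - t * (∑ k, |v k|) ^ 2 ≤ empSq (lin X v) := by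
  have h1 : empSq (lin X v) = ∑ j, ∑ k, v j * v k * empInner (col X j) (col X k) := by
    rw [← empInner_self, empInner_lin]
    refine Finset.sum_congr rfl fun j _ => ?_
    rw [empInner_comm, empInner_lin, Finset.mul_sum]
    exact Finset.sum_congr rfl fun k _ => by ring
  have h2 : v ⬝ᵥ S *ᵥ v = ∑ j, ∑ k, v j * v k * S j k := by
    simp only [dotProduct, mulVec, Finset.mul_sum]
    exact Finset.sum_congr rfl fun j _ => Finset.sum_congr rfl fun k _ => by ring
  have h3 : t * (∑ k, |v k|) ^ 2 = ∑ j, ∑ k, |v j| * |v k| * t := by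
    rw [pow_two, Finset.sum_mul_sum, Finset.mul_sum]
    refine Finset.sum_congr rfl fun j _ => ?_
    rw [Finset.mul_sum]
    exact Finset.sum_congr rfl fun k _ => by ring
  rw [h1, h2, h3, ← Finset.sum_sub_distrib]
  refine Finset.sum_le_sum fun j _ => ?_
  rw [← Finset.sum_sub_distrib]
  refine Finset.sum_le_sum fun k _ => ?_
  have h4 : |v j * v k * (empInner (col X j) (col X k) - S j k)| ≤ |v j| * |v k| * t := by
    rw [abs_mul, abs_mul]
    exact mul_le_mul_of_nonneg_left (h j k) (by positivity)
  have := (abs_le.1 h4).1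
  linarith

end Empirical

/-! ### Deterministic analysis of the Lasso -/

section Lasso

variable {n p : ℕ}

/-- First-order condition for a minimum at `0` of a quadratic function plus `2 lam |s|`. -/
theorem abs_le_of_quadratic_nonneg {A c lam : ℝ}
    (h : ∀ s : ℝ, 0 ≤ s ^ 2 * A + 2 * s * c + 2 * lam * |s|) : |c| ≤ lam := by
  by_contra! hc
  have hA : 0 ≤ |A| := abs_nonneg A
  set g := |c| - lam with hg
  have hg0 : 0 < g := by linarith
  have key : ∀ σ : ℝ, (σ = 1 ∨ σ = -1) → σ * c = -|c| → False := by
    intro σ hσ hσc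
    have hs := h (σ * (g / (|A| + 1)))
    have hσ2 : σ ^ 2 = 1 := by rcases hσ with h | h <;> simp [h]
    have hσa : |σ| = 1 := by rcases hσ with h | h <;> simp [h]
    have hq : 0 < g / (|A| + 1) := by positivity
    rw [mul_pow, hσ2, abs_mul, hσa, abs_of_pos hq] at hs
    set q := g / (|A| + 1) with hqd
    have hqA : q * (|A| + 1) = g := by rw [hqd]; field_simp
    have h1 : 2 * (σ * q) * c = -2 * q * |c| := by
      calc 2 * (σ * q) * c = 2 * q * (σ * c) := by ring
        _ = _ := by rw [hσc]; ring
    rw [h1] at hs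
    have h2 : q * (q * A - 2 * g) < 0 := by
      apply mul_neg_of_pos_of_neg hq
      nlinarith [le_abs_self A]
    nlinarith
  rcases le_total 0 c with h0 | h0
  · exact key (-1) (Or.inr rfl) (by rw [abs_of_nonneg h0]; ring)
  · exact key 1 (Or.inl rfl) (by rw [abs_of_nonpos h0]; ring)

/-- First-order condition for a minimum at `0` of a quadratic function on `[-1, 1]`. -/
theorem eq_zero_of_quadratic_nonneg {A c : ℝ}
    (h : ∀ s : ℝ, |s| ≤ 1 → 0 ≤ s ^ 2 * A + 2 * s * c) : c = 0 := by
  by_contra hc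
  have hA : 0 ≤ |A| := abs_nonneg A
  have hc0 : 0 < |c| := abs_pos.2 hc
  have hden : 0 < |A| + |c| := by positivity
  have h1 : |(-c / (|A| + |c|))| ≤ 1 := by
    rw [abs_div, abs_neg, abs_of_pos hden, div_le_one hden]; linarith
  have h2 := h _ h1
  have h3 : (-c / (|A| + |c|)) ^ 2 * A + 2 * (-c / (|A| + |c|)) * c
      = (c ^ 2 / (|A| + |c|) ^ 2) * (A - 2 * (|A| + |c|)) := by
    field_simp; ring
  rw [h3] at h2
  have h4 : 0 < c ^ 2 / (|A| + |c|) ^ 2 := by positivity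
  have h5 : A - 2 * (|A| + |c|) < 0 := by linarith [le_abs_self A]
  nlinarith [mul_neg_of_pos_of_neg h4 h5]

/-- Under a restricted lower bound on the quadratic form, an upper bound by the `ℓ₁`-norm controls
the `ℓ₁`-norm. Here `a`, `b2` and `q` stand for `‖δ‖₁`, `‖δ‖₂²` and `‖Xδ‖ₙ²`. -/
theorem l1_le_of_restricted {L t K μ a b2 q : ℝ} (hL : 0 < L) (hK : 0 ≤ K) (hμ : 0 ≤ μ)
    (ha : 0 ≤ a) (ht : 0 ≤ t) (hlow : L * b2 - t * a ^ 2 ≤ q) (hup : q ≤ μ * a)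
    (hcone : a ^ 2 ≤ K * b2) (htK : t * K ≤ L / 2) (hb : 0 ≤ b2) : a ≤ 2 * K * μ / L := by
  have h1 : L / 2 * b2 ≤ μ * a := by
    have : t * a ^ 2 ≤ t * (K * b2) := by gcongr
    nlinarith
  have h2 : a * a ≤ (2 * K * μ / L) * a := by
    have : L * (a * a) ≤ L * (2 * K * μ / L * a) := by
      have e : L * (2 * K * μ / L * a) = 2 * K * (μ * a) := by field_simp
      rw [e]
      nlinarith
    exact le_of_mul_le_mul_left this hL
  rcases ha.eq_or_lt with h | h
  · rw [← h]; positivity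
  · exact le_of_mul_le_mul_right h2 h

/-- Comparison of penalized least squares fits with residuals `η` and `η - e` and penalties `P`
and `P'`. -/
theorem empSq_le_of_penalized_le {η e : Fin n → ℝ} {lam P P' : ℝ}
    (h : empSq (η - e) + 2 * lam * P' ≤ empSq η + 2 * lam * P) :
    empSq e + 2 * lam * P' ≤ 2 * empInner η e + 2 * lam * P := by
  rw [empSq_sub] at h; linarith

/-- The Lasso objective compared at the solution and at the target. -/
theorem lasso_objective_le {X : Design n p} {ε : Fin n → ℝ} {β b : Coef p} {lam : ℝ}
    (h : IsLasso lam (X, fun i => fit X β i + ε i) b) :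
    empSq (ε - lin X (b.ofLp - β.ofLp)) + 2 * lam * ∑ k, |b k|
      ≤ empSq ε + 2 * lam * ∑ k, |β k| := by
  have h1 := isMinOn_iff.1 h β (Set.mem_univ _)
  simp only at h1
  have e1 : (fun i => fit X β i + ε i - fit X b i) = ε - lin X (b.ofLp - β.ofLp) := by
    rw [lin_sub]; ext i; simp [fit_eq_lin]; ring
  have e2 : (fun i => fit X β i + ε i - fit X β i) = ε := by ext i; ring
  rwa [e1, e2] at h1

theorem sum_abs_sub_le {ι : Type*} (s : Finset ι) (b β : ι → ℝ) :
    ∑ k ∈ s, |b k - β k| ≤ ∑ k ∈ s, |b k| + ∑ k ∈ s, |β k| := by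
  rw [← Finset.sum_add_distrib]
  exact Finset.sum_le_sum fun k _ => abs_sub _ _

/-- A bound for the `ℓ₁`-error of the Lasso that holds for every design and every noise; it serves
off the event of concentration. -/
theorem lasso_l1_crude {X : Design n p} {ε : Fin n → ℝ} {β b : Coef p} {lam : ℝ} (hlam : 0 < lam)
    (h : IsLasso lam (X, fun i => fit X β i + ε i) b) :
    ∑ k, |b k - β k| ≤ empSq ε / (2 * lam) + 2 * ∑ k, |β k| := by
  have h1 := lasso_objective_le h
  have h2 := sum_abs_sub_le Finset.univ (fun k => b k) (fun k => β k)
  have h3 : ∑ k, |b k| ≤ empSq ε / (2 * lam) + ∑ k, |β k| := by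
    rw [← sub_le_iff_le_add, le_div_iff₀ (by positivity)]
    linarith [empSq_nonneg (ε - lin X (b.ofLp - β.ofLp))]
  linarith

/-- A bound for the prediction error of the Lasso that holds for every design and every noise. -/
theorem lasso_prediction_crude {X : Design n p} {ε : Fin n → ℝ} {β b : Coef p} {lam : ℝ}
    (hlam : 0 < lam) (h : IsLasso lam (X, fun i => fit X β i + ε i) b) :
    empSq (lin X (b.ofLp - β.ofLp)) ≤ 4 * empSq ε + 4 * lam * ∑ k, |β k| := by
  have h1 := empSq_le_of_penalized_le (lasso_objective_le h)
  set e := lin X (b.ofLp - β.ofLp)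
  have h2 := empSq_nonneg ((2 : ℝ) • ε - e)
  rw [empSq_sub, empSq_smul, empInner_smul_left] at h2
  have h3 : 0 ≤ lam * ∑ k, |b k| := by positivity
  linarith

/-- The cone condition: once the penalty dominates the noise, the error of the Lasso is
concentrated on the support of the target. -/
theorem lasso_cone {X : Design n p} {ε : Fin n → ℝ} {β b : Coef p} {lam T d : ℝ}
    (h : IsLasso lam (X, fun i => fit X β i + ε i) b) (hlam : 0 < lam) (hT : T ≤ lam / 2)
    (hε : ∀ k, |empInner ε (col X k)| ≤ T) (hd : (sparsity (fun k => β k) : ℝ) ≤ d) :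
    empSq (lin X (b.ofLp - β.ofLp)) ≤ 3 * lam * ∑ k, |b k - β k| ∧
    (∑ k, |b k - β k|) ^ 2 ≤ 16 * d * ∑ k, (b k - β k) ^ 2 := by
  classical
  have h1 := empSq_le_of_penalized_le (lasso_objective_le h)
  have h2 := abs_empInner_lin_le X ε (b.ofLp - β.ofLp) (fun k _ => hε k)
  simp only [Pi.sub_apply] at h2
  set s : Finset (Fin p) := Finset.univ.filter fun k => β k ≠ 0 with hs
  have hcard : (s.card : ℝ) ≤ d := by
    refine le_trans (le_of_eq ?_) hd
    rw [sparsity, hs]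
    congr 1
    rw [← Set.ncard_coe_finset]
    congr 1; ext k; simp
  set a := ∑ k, |b k - β k| with ha
  have ha0 : 0 ≤ a := by positivity
  have hsplit : ∀ f : Fin p → ℝ, ∑ k, f k = ∑ k ∈ s, f k + ∑ k ∈ sᶜ, f k := fun f =>
    (Finset.sum_add_sum_compl s f).symm
  set a1 := ∑ k ∈ s, |b k - β k|
  set a2 := ∑ k ∈ sᶜ, |b k - β k|
  have ha12 : a = a1 + a2 := hsplit _
  have ha1 : 0 ≤ a1 := by positivity
  have ha2 : 0 ≤ a2 := by positivity
  have hpen : ∑ k, |β k| - ∑ k, |b k| ≤ a1 - a2 := by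
    rw [hsplit (fun k => |β k|), hsplit (fun k => |b k|)]
    have h3 : ∑ k ∈ s, |β k| ≤ ∑ k ∈ s, |b k| + a1 := by
      rw [← Finset.sum_add_distrib]
      refine Finset.sum_le_sum fun k _ => ?_
      have := abs_sub_abs_le_abs_sub (β k) (b k)
      rw [abs_sub_comm] at this; linarith
    have h4 : ∑ k ∈ sᶜ, |β k| = 0 := by
      refine Finset.sum_eq_zero fun k hk => ?_
      simpa [hs] using hk
    have h5 : a2 = ∑ k ∈ sᶜ, |b k| := by
      refine Finset.sum_congr rfl fun k hk => ?_
      have : β k = 0 := by simpa [hs] using hk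
      rw [this, sub_zero]
    linarith
  have h6 : 2 * empInner ε (lin X (b.ofLp - β.ofLp)) ≤ lam * a := by
    have h7 := le_abs_self (empInner ε (lin X (b.ofLp - β.ofLp)))
    have : T * a ≤ lam / 2 * a := by gcongr
    linarith
  have h8 : empSq (lin X (b.ofLp - β.ofLp)) + lam * a2 ≤ 3 * lam * a1 := by
    have : 2 * lam * (∑ k, |β k| - ∑ k, |b k|) ≤ 2 * lam * (a1 - a2) := by gcongr
    rw [ha12] at h6
    linarith
  have h9 := empSq_nonneg (lin X (b.ofLp - β.ofLp))
  have hd0 : 0 ≤ d := (Nat.cast_nonneg _).trans hcard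
  constructor
  · rw [ha12]
    have : 0 ≤ lam * a2 := by positivity
    linarith
  · have h10 : a ≤ 4 * a1 := by
      have : lam * a2 ≤ lam * (3 * a1) := by linarith
      have := le_of_mul_le_mul_left this hlam
      linarith
    have h11 : a1 ^ 2 ≤ s.card * ∑ k ∈ s, (b k - β k) ^ 2 := by
      have := sq_sum_le_card_mul_sum_sq (s := s) (f := fun k => |b k - β k|)
      simpa [sq_abs] using this
    have h12 : ∑ k ∈ s, (b k - β k) ^ 2 ≤ ∑ k, (b k - β k) ^ 2 :=
      Finset.sum_le_univ_sum_of_nonneg fun k => sq_nonneg _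
    calc a ^ 2 ≤ (4 * a1) ^ 2 := by gcongr
      _ = 16 * a1 ^ 2 := by ring
      _ ≤ 16 * (s.card * ∑ k ∈ s, (b k - β k) ^ 2) := by gcongr
      _ ≤ 16 * (d * ∑ k, (b k - β k) ^ 2) := by gcongr
      _ = _ := by ring

theorem lasso_prediction_le {X : Design n p} {ε : Fin n → ℝ} {β b : Coef p} {lam T : ℝ}
    (h : IsLasso lam (X, fun i => fit X β i + ε i) b) (hlam : 0 < lam)
    (hε : ∀ k, |empInner ε (col X k)| ≤ T) :
    empSq (lin X (b.ofLp - β.ofLp)) ≤ 2 * (T + lam) * ∑ k, |b k - β k| := by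
  have h1 := empSq_le_of_penalized_le (lasso_objective_le h)
  have h2 := abs_empInner_lin_le X ε (b.ofLp - β.ofLp) (fun k _ => hε k)
  simp only [Pi.sub_apply] at h2
  have h3 := le_abs_self (empInner ε (lin X (b.ofLp - β.ofLp)))
  have h4 : ∑ k, |β k| ≤ ∑ k, |b k| + ∑ k, |b k - β k| := by
    rw [← Finset.sum_add_distrib]
    refine Finset.sum_le_sum fun k _ => ?_
    have := abs_sub_abs_le_abs_sub (β k) (b k)
    rw [abs_sub_comm] at this; linarith
  have h5 : lam * ∑ k, |β k| ≤ lam * (∑ k, |b k| + ∑ k, |b k - β k|) := by gcongr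
  linarith

theorem sum_abs_sq_le (v : Fin p → ℝ) : (∑ k, |v k|) ^ 2 ≤ p * ∑ k, v k ^ 2 := by
  have := sq_sum_le_card_mul_sum_sq (s := Finset.univ) (f := fun k => |v k|)
  simpa [sq_abs] using this

theorem sum_abs_sq_le_sparsity (v : Fin p → ℝ) :
    (∑ k, |v k|) ^ 2 ≤ sparsity v * ∑ k, v k ^ 2 := by
  classical
  set s : Finset (Fin p) := Finset.univ.filter fun k => v k ≠ 0 with hs
  have hcard : sparsity v = s.card := by
    rw [sparsity, hs, ← Set.ncard_coe_finset]
    congr 1; ext k; simp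
  have h1 : ∑ k ∈ s, |v k| = ∑ k, |v k| :=
    Finset.sum_subset (Finset.subset_univ s) fun k _ hk => by simpa [hs] using hk
  have h2 := sq_sum_le_card_mul_sum_sq (s := s) (f := fun k => |v k|)
  rw [h1, ← hcard] at h2
  refine h2.trans ?_
  simp only [sq_abs]
  gcongr
  exact Finset.subset_univ s

/-! ### The nodewise regressions -/

/-- The contrast `(1, -γ)`, with entry `1` in position `j`, so that `X_j - X_{-j} γ` is the image
of this vector under `X`. -/
def nodeVec (j : Fin p) (γ : {k : Fin p // k ≠ j} → ℝ) : Fin p → ℝ :=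
  fun k => if h : k = j then 1 else -γ ⟨k, h⟩

theorem nodeVec_self (j : Fin p) (γ : {k : Fin p // k ≠ j} → ℝ) : nodeVec j γ j = 1 := by
  simp [nodeVec]

theorem nodeVec_coe (j : Fin p) (γ : {k : Fin p // k ≠ j} → ℝ) (k : {k : Fin p // k ≠ j}) :
    nodeVec j γ k = -γ k := by
  simp [nodeVec, k.2]

theorem nodeVec_neg {j : Fin p} {w : Fin p → ℝ} (hw : w j = 1) :
    nodeVec j (fun k => -w k) = w := by
  ext k
  by_cases h : k = j
  · subst h; simp [nodeVec, hw]
  · simp [nodeVec, h]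

theorem nodeResid_eq (X : Design n p) (j : Fin p) (γ : {k : Fin p // k ≠ j} → ℝ) :
    nodeResid X j γ = lin X (nodeVec j γ) := by
  ext i
  simp only [nodeResid, lin]
  rw [Fintype.sum_eq_add_sum_subtype_ne _ j, nodeVec_self, mul_one, sub_eq_add_neg,
    ← Finset.sum_neg_distrib]
  congr 1
  exact Finset.sum_congr rfl fun k _ => by rw [nodeVec_coe]; ring

theorem sum_abs_nodeVec (j : Fin p) (γ : {k : Fin p // k ≠ j} → ℝ) :
    ∑ k, |nodeVec j γ k| = 1 + ∑ k, |γ k| := by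
  rw [Fintype.sum_eq_add_sum_subtype_ne _ j, nodeVec_self, abs_one]
  congr 1
  exact Finset.sum_congr rfl fun k _ => by rw [nodeVec_coe, abs_neg]

theorem nodewise_objective_le {X : Design n p} {j : Fin p} {γ : {k : Fin p // k ≠ j} → ℝ}
    {lam : ℝ} (h : IsNodewise lam X j γ) {w : Fin p → ℝ} (hw : w j = 1) :
    empSq (lin X (nodeVec j γ)) + 2 * lam * ∑ k, |nodeVec j γ k|
      ≤ empSq (lin X w) + 2 * lam * ∑ k, |w k| := by
  have h1 := isMinOn_iff.1 h (fun k => -w k) (Set.mem_univ _)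
  simp only [nodeResid_eq] at h1
  rw [nodeVec_neg hw] at h1
  have h2 : ∑ k, |w k| = 1 + ∑ k : {k : Fin p // k ≠ j}, |(-w k)| := by
    rw [← sum_abs_nodeVec, nodeVec_neg hw]
  rw [sum_abs_nodeVec, h2]
  linarith

theorem tauSq_eq (X : Design n p) (j : Fin p) (γ : {k : Fin p // k ≠ j} → ℝ) (lam : ℝ) :
    tauSq lam X j γ = empSq (lin X (nodeVec j γ)) + lam * (∑ k, |nodeVec j γ k| - 1) := by
  rw [tauSq, nodeResid_eq, sum_abs_nodeVec]; ring

theorem sum_abs_update_le (w : Fin p → ℝ) (k : Fin p) (s : ℝ) :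
    ∑ l, |(w + s • Pi.single k 1 : Fin p → ℝ) l| ≤ ∑ l, |w l| + |s| := by
  have e : |s| = ∑ l, |(s • Pi.single k (1 : ℝ) : Fin p → ℝ) l| := by
    rw [Finset.sum_eq_single k]
    · simp
    · intro l _ hl; simp [hl]
    · simp
  rw [e, ← Finset.sum_add_distrib]
  exact Finset.sum_le_sum fun l _ => abs_add_le _ _

/-- The Karush-Kuhn-Tucker conditions of the nodewise regression, off the diagonal. -/
theorem nodewise_kkt_ne {X : Design n p} {j : Fin p} {γ : {k : Fin p // k ≠ j} → ℝ}
    {lam : ℝ} (hlam : 0 ≤ lam) (h : IsNodewise lam X j γ) {k : Fin p} (hk : k ≠ j) :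
    |empInner (lin X (nodeVec j γ)) (col X k)| ≤ lam := by
  apply abs_le_of_quadratic_nonneg (A := empSq (col X k))
  intro s
  have h1 := nodewise_objective_le h (w := nodeVec j γ + s • Pi.single k 1)
    (by simp [nodeVec_self, hk.symm])
  rw [lin_add, lin_smul, lin_single, empSq_add, empSq_smul, empInner_smul_right] at h1
  have h2 := mul_le_mul_of_nonneg_left (sum_abs_update_le (nodeVec j γ) k s)
    (by positivity : 0 ≤ 2 * lam)
  linarith

/-- The Karush-Kuhn-Tucker conditions of the nodewise regression, on the diagonal. -/
theorem nodewise_kkt_self {X : Design n p} {j : Fin p} {γ : {k : Fin p // k ≠ j} → ℝ}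
    {lam : ℝ} (h : IsNodewise lam X j γ) :
    empInner (lin X (nodeVec j γ)) (col X j) = tauSq lam X j γ := by
  set w := nodeVec j γ with hw
  set G := ∑ k, |γ k| with hG
  have hzero : empInner (lin X w) (lin X (w - Pi.single j 1)) + lam * G = 0 := by
    apply eq_zero_of_quadratic_nonneg (A := empSq (lin X (w - Pi.single j 1)))
    intro s hs
    have hs1 : 0 ≤ 1 + s := by linarith [(abs_le.1 hs).1]
    have e : w + s • (w - Pi.single j 1) = nodeVec j ((1 + s) • γ) := by
      ext k
      by_cases hk : k = j
      · subst hk; simp [hw, nodeVec]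
      · simp [hw, nodeVec, hk]; ring
    have h1 := nodewise_objective_le h (w := w + s • (w - Pi.single j 1))
      (by rw [e, nodeVec_self])
    have e2 : ∑ k, |(w + s • (w - Pi.single j 1) : Fin p → ℝ) k| = 1 + (1 + s) * G := by
      rw [e, sum_abs_nodeVec, hG, Finset.mul_sum]
      congr 1
      exact Finset.sum_congr rfl fun k _ => by
        rw [Pi.smul_apply, smul_eq_mul, abs_mul, abs_of_nonneg hs1]
    rw [e2, sum_abs_nodeVec, lin_add, lin_smul, empSq_add, empSq_smul, empInner_smul_right] at h1
    linarith
  rw [lin_sub, lin_single, empInner_sub_right, empInner_self] at hzero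
  rw [tauSq, nodeResid_eq]
  linarith

/-- The Karush-Kuhn-Tucker conditions say that the normalized contrast nearly inverts the sample
covariance matrix. -/
theorem nodewise_inverse_error {X : Design n p} {j : Fin p} {γ : {k : Fin p // k ≠ j} → ℝ}
    {lam : ℝ} (hlam : 0 ≤ lam) (h : IsNodewise lam X j γ) (δ : Fin p → ℝ) :
    |tauSq lam X j γ * δ j - empInner (lin X (nodeVec j γ)) (lin X δ)| ≤ lam * ∑ k, |δ k| := by
  have e : tauSq lam X j γ * δ j - empInner (lin X (nodeVec j γ)) (lin X δ)
      = -empInner (lin X (nodeVec j γ)) (lin X (δ - δ j • Pi.single j 1)) := by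
    rw [lin_sub, lin_smul, lin_single, empInner_sub_right, empInner_smul_right,
      nodewise_kkt_self h]; ring
  rw [e, abs_neg]
  refine (abs_empInner_lin_le X _ _ (T := lam) fun k hk => nodewise_kkt_ne hlam h ?_).trans ?_
  · rintro rfl; simp at hk
  · refine mul_le_mul_of_nonneg_left (Finset.sum_le_sum fun k _ => ?_) hlam
    by_cases hk : k = j
    · subst hk; simp
    · simp [hk]

theorem tauSq_nonneg (X : Design n p) (j : Fin p) (γ : {k : Fin p // k ≠ j} → ℝ) {lam : ℝ}
    (hlam : 0 ≤ lam) : 0 ≤ tauSq lam X j γ := by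
  rw [tauSq]
  have := empSq_nonneg (nodeResid X j γ)
  positivity

theorem empSq_nodeVec_le_tauSq (X : Design n p) (j : Fin p) (γ : {k : Fin p // k ≠ j} → ℝ)
    {lam : ℝ} (hlam : 0 ≤ lam) : empSq (lin X (nodeVec j γ)) ≤ tauSq lam X j γ := by
  rw [tauSq, nodeResid_eq]
  have : 0 ≤ lam * ∑ k, |γ k| := by positivity
  linarith

theorem sqrt_empSq_lin_le (X : Design n p) (v : Fin p → ℝ) {Z : ℝ}
    (hZ : ∀ k, empSq (col X k) ≤ Z) : √(empSq (lin X v)) ≤ (∑ k, |v k|) * √Z := by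
  apply Real.sqrt_le_iff.2
  refine ⟨mul_nonneg (Finset.sum_nonneg fun _ _ => abs_nonneg _) (Real.sqrt_nonneg _), ?_⟩
  have h1 := abs_empInner_lin_le X (lin X v) v (T := √(empSq (lin X v)) * √Z) fun k _ =>
    (abs_empInner_le _ _).trans (by gcongr; exact hZ k)
  rw [empInner_self, abs_of_nonneg (empSq_nonneg _)] at h1
  set q := √(empSq (lin X v)) with hq
  have hq2 : empSq (lin X v) = q ^ 2 := (Real.sq_sqrt (empSq_nonneg _)).symm
  rw [hq2] at h1 ⊢
  have hq0 : 0 ≤ q := Real.sqrt_nonneg _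
  rcases hq0.eq_or_lt with h | h
  · rw [← h, zero_pow two_ne_zero]; positivity
  · have : q ≤ √Z * ∑ k, |v k| := by
      refine le_of_mul_le_mul_left (a := q) ?_ h
      linarith
    rw [mul_comm (∑ k, |v k|)]
    gcongr

/-- A lower bound on the nodewise residual variance that holds for every design. -/
theorem one_div_tauSq_le {X : Design n p} {j : Fin p} {γ : {k : Fin p // k ≠ j} → ℝ}
    {lam Z : ℝ} (hlam : 0 < lam) (hX : 0 < empSq (col X j)) (hZ : ∀ k, empSq (col X k) ≤ Z) :
    1 / tauSq lam X j γ ≤ 5 / empSq (col X j) + Z / lam ^ 2 := by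
  set y := empSq (col X j) with hy
  have hZ0 : 0 < Z := hX.trans_le (hZ j)
  set a := ∑ k, |γ k| with ha
  have ha0 : 0 ≤ a := by positivity
  set r := empSq (nodeResid X j γ) with hr
  have hr0 : 0 ≤ r := empSq_nonneg _
  have htau : tauSq lam X j γ = r + lam * a := rfl
  have hcol : y ≤ 2 * r + 2 * (a ^ 2 * Z) := by
    have e : col X j = nodeResid X j γ + lin X (Pi.single j 1 - nodeVec j γ) := by
      rw [lin_sub, lin_single, nodeResid_eq]; abel
    have h1 := empSq_add_le (nodeResid X j γ) (lin X (Pi.single j 1 - nodeVec j γ))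
    rw [← e] at h1
    have h2 := sqrt_empSq_lin_le X (Pi.single j 1 - nodeVec j γ) hZ
    have h3 : ∑ k, |(Pi.single j 1 - nodeVec j γ : Fin p → ℝ) k| = a := by
      rw [Fintype.sum_eq_add_sum_subtype_ne _ j]
      simp only [Pi.sub_apply, nodeVec_self, Pi.single_eq_same, sub_self, abs_zero, zero_add,
        nodeVec_coe]
      refine Finset.sum_congr rfl fun k _ => ?_
      rw [Pi.single_eq_of_ne k.2]; simp
    rw [h3] at h2
    have h4 : empSq (lin X (Pi.single j 1 - nodeVec j γ)) ≤ a ^ 2 * Z := by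
      have := (Real.sqrt_le_iff.1 h2).2
      rwa [mul_pow, Real.sq_sqrt hZ0.le] at this
    linarith
  rw [htau]
  have hlama : 0 ≤ lam * a := by positivity
  have hZl : 0 ≤ Z / lam ^ 2 := by positivity
  rcases le_total (y / 4) r with h | h
  · calc 1 / (r + lam * a) ≤ 1 / (y / 4) := one_div_le_one_div_of_le (by positivity) (by linarith)
      _ = 4 / y := by field_simp
      _ ≤ 5 / y := by gcongr; norm_num
      _ ≤ _ := by linarith
  · -- here the penalty is large: `a² ≥ y / (4 Z)`
    have h5 : y ≤ 4 * (a ^ 2 * Z) := by linarith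
    have ha1 : 0 < a := by
      rcases ha0.eq_or_lt with h' | h'
      · rw [← h'] at h5; simp at h5; linarith
      · exact h'
    have h6 : 1 / (r + lam * a) ≤ 1 / (lam * a) :=
      one_div_le_one_div_of_le (by positivity) (by linarith)
    have h7 : 1 / (lam * a) ≤ 1 / (4 * a ^ 2 * Z) + Z / lam ^ 2 := by
      have h8 : 0 ≤ (1 / (2 * a * √Z) - √Z / lam) ^ 2 := sq_nonneg _
      have hs : √Z ^ 2 = Z := Real.sq_sqrt hZ0.le
      have hsp : 0 < √Z := Real.sqrt_pos.2 hZ0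
      have e : (1 / (2 * a * √Z) - √Z / lam) ^ 2
          = 1 / (4 * a ^ 2 * √Z ^ 2) + √Z ^ 2 / lam ^ 2 - 1 / (lam * a) := by
        field_simp; ring
      rw [e, hs] at h8
      linarith
    have h9 : 1 / (4 * a ^ 2 * Z) ≤ 5 / y := by
      rw [div_le_div_iff₀ (by positivity) hX]
      nlinarith [mul_pos (pow_pos ha1 2) hZ0]
    linarith

end Lasso

/-! ### Consequences of entrywise concentration -/

section GoodEvent

variable {n p : ℕ} {S : Matrix (Fin p) (Fin p) ℝ} {L B t : ℝ} {X : Design n p}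

/-- The design is `t`-regular: the sample covariance matrix is entrywise `t`-close to `S`, and
`S⁻¹` is entrywise a `t`-approximate inverse of the sample covariance matrix. -/
def DesignRegular (S : Matrix (Fin p) (Fin p) ℝ) (t : ℝ) (X : Design n p) : Prop :=
  (∀ j k, |empInner (col X j) (col X k) - S j k| ≤ t) ∧
  ∀ j k, |empInner (lin X (precCol S j)) (col X k) - (Pi.single j 1 : Fin p → ℝ) k| ≤ t

/-- All empirical correlations between the noise and the columns of the design are at most `t`. -/
def NoiseRegular (t : ℝ) (X : Design n p) (ε : Fin n → ℝ) : Prop :=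
  ∀ k, |empInner ε (col X k)| ≤ t

/-- The population version of the nodewise contrast: `X` applied to it is the residual of the
regression of the `j`-th coordinate on the others. -/
def popVec (S : Matrix (Fin p) (Fin p) ℝ) (j : Fin p) : Fin p → ℝ := (1 / S⁻¹ j j) • precCol S j

/-- A column of the nodewise Lasso estimator of the precision matrix. -/
def thetaCol (lam : ℝ) (X : Design n p) (j : Fin p) (γ : {k : Fin p // k ≠ j} → ℝ) : Fin p → ℝ :=
  (1 / tauSq lam X j γ) • nodeVec j γ

theorem popVec_self (hS : S.PosDef) (j : Fin p) : popVec S j j = 1 := by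
  have := precision_diag_pos hS j
  simp only [popVec, Pi.smul_apply, precCol, smul_eq_mul]
  field_simp

/-- Standing bounds on the covariance matrix: eigenvalues at least `L`, and diagonal entries and
`1`, `1 / L` at most `B`. -/
structure CovBounds (S : Matrix (Fin p) (Fin p) ℝ) (L B : ℝ) : Prop where
  posDef : S.PosDef
  pos : 0 < L
  eigenvalues : ∀ i, L ≤ posDef.isHermitian.eigenvalues i
  diag_le : ∀ j, S j j ≤ B
  one_le : 1 ≤ B
  inv_le : 1 / L ≤ B

namespace CovBounds

theorem quadratic_ge (hC : CovBounds S L B) (v : Fin p → ℝ) : L * ∑ k, v k ^ 2 ≤ v ⬝ᵥ S *ᵥ v :=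
  eigenvalue_mul_sum_sq_le hC.posDef hC.eigenvalues v

theorem resid_var_le (hC : CovBounds S L B) (j : Fin p) : 1 / S⁻¹ j j ≤ B := by
  have h := one_le_diag_mul_precision_diag hC.posDef j
  have hp := precision_diag_pos hC.posDef j
  rw [div_le_iff₀ hp]
  exact h.trans (by gcongr; exact hC.diag_le j)

theorem le_resid_var (hC : CovBounds S L B) (j : Fin p) : L ≤ 1 / S⁻¹ j j := by
  have h := precision_diag_le hC.posDef hC.pos hC.eigenvalues j
  have hp := precision_diag_pos hC.posDef j
  rw [le_div_iff₀ hC.pos] at h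
  rw [le_div_iff₀ hp]; linarith

theorem resid_var_pos (hC : CovBounds S L B)
    (j : Fin p) : 0 < 1 / S⁻¹ j j := hC.pos.trans_le (hC.le_resid_var j)

theorem sum_abs_popVec_le (hC : CovBounds S L B)
    {d : ℝ} (j : Fin p) (hd : (sparsity (precCol S j) : ℝ) ≤ d) :
    ∑ k, |popVec S j k| ≤ B ^ 2 * √d := by
  have h1 : (∑ k, |precCol S j k|) ^ 2 ≤ d * (1 / L ^ 2) :=
    (sum_abs_sq_le_sparsity _).trans (by
      have := sum_sq_precCol_le hC.posDef hC.pos hC.eigenvalues j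
      gcongr
      exact (Nat.cast_nonneg _).trans hd)
  have h2 : ∑ k, |precCol S j k| ≤ √d * B := by
    have h3 : ∑ k, |precCol S j k| ≤ √(d * (1 / L ^ 2)) := Real.le_sqrt_of_sq_le h1
    have hL := hC.pos
    rw [Real.sqrt_mul' _ (by positivity), ← _root_.one_div_pow, Real.sqrt_sq (by positivity)] at h3
    exact h3.trans (by gcongr; exact hC.inv_le)
  have h4 : ∑ k, |popVec S j k| = 1 / S⁻¹ j j * ∑ k, |precCol S j k| := by
    rw [Finset.mul_sum]
    refine Finset.sum_congr rfl fun k _ => ?_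
    rw [popVec, Pi.smul_apply, smul_eq_mul, abs_mul, abs_of_pos (hC.resid_var_pos j)]
  rw [h4]
  calc 1 / S⁻¹ j j * ∑ k, |precCol S j k| ≤ B * (√d * B) := by
        gcongr
        · linarith [hC.one_le]
        · exact hC.resid_var_le j
    _ = B ^ 2 * √d := by ring

theorem l1_le_of_regular (hC : CovBounds S L B)
    (hX : DesignRegular S t X) (ht : 0 ≤ t) {δ : Fin p → ℝ} {K μ : ℝ}
    (hK : 0 ≤ K) (hμ : 0 ≤ μ) (hup : empSq (lin X δ) ≤ μ * ∑ k, |δ k|)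
    (hcone : (∑ k, |δ k|) ^ 2 ≤ K * ∑ k, δ k ^ 2) (htK : t * K ≤ L / 2) :
    ∑ k, |δ k| ≤ 2 * K * μ / L := by
  refine l1_le_of_restricted hC.pos hK hμ (by positivity) ht ?_ hup hcone htK (by positivity)
  have := quadratic_le_empSq_lin X S hX.1 δ
  linarith [hC.quadratic_ge δ]

/-- The `ℓ₁`-error of the Lasso when the penalty dominates the noise. -/
theorem lasso_l1_le_of_dominated (hC : CovBounds S L B) (hX : DesignRegular S t X) {ε : Fin n → ℝ}
    (hε : NoiseRegular t X ε) (ht : 0 ≤ t) {β b : Coef p} {lam d : ℝ}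
    (h : IsLasso lam (X, fun i => fit X β i + ε i) b) (hlam : 0 < lam) (htl : t ≤ lam / 2)
    (hd : (sparsity (fun k => β k) : ℝ) ≤ d) (htd : 16 * d * t ≤ L / 2) :
    ∑ k, |b k - β k| ≤ 96 * d * lam / L := by
  obtain ⟨h1, h2⟩ := lasso_cone h hlam htl hε hd
  have hd0 : 0 ≤ d := (Nat.cast_nonneg _).trans hd
  refine (hC.l1_le_of_regular hX ht (δ := b.ofLp - β.ofLp) (K := 16 * d) (μ := 3 * lam)
    (by positivity) (by positivity) h1 h2 (by linarith)).trans (le_of_eq ?_)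
  ring

/-- The `ℓ₁`-error of the Lasso in low dimension. -/
theorem lasso_l1_le_of_lowdim (hC : CovBounds S L B) (hX : DesignRegular S t X) {ε : Fin n → ℝ}
    (hε : NoiseRegular t X ε) (ht : 0 ≤ t) {β b : Coef p} {lam : ℝ}
    (h : IsLasso lam (X, fun i => fit X β i + ε i) b) (hlam : 0 < lam) (htp : p * t ≤ L / 2) :
    ∑ k, |b k - β k| ≤ 4 * p * (t + lam) / L := by
  refine (hC.l1_le_of_regular hX ht (δ := b.ofLp - β.ofLp) (K := p) (μ := 2 * (t + lam))
    (by positivity) (by positivity) (lasso_prediction_le h hlam hε) (sum_abs_sq_le _)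
    (by linarith)).trans (le_of_eq ?_)
  ring

theorem abs_empInner_popVec_le (hC : CovBounds S L B) (hX : DesignRegular S t X)
    (j k : Fin p) :
    |empInner (lin X (popVec S j)) (col X k) - 1 / S⁻¹ j j * (Pi.single j 1 : Fin p → ℝ) k|
      ≤ B * t := by
  rw [popVec, lin_smul, empInner_smul_left, ← mul_sub, abs_mul, abs_of_pos (hC.resid_var_pos j)]
  gcongr
  · linarith [hC.one_le]
  · exact hC.resid_var_le j
  · exact hX.2 j k

/-- The nodewise Lasso objective compared at the solution and at its population version, whose
residual is nearly uncorrelated with the other columns. -/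
theorem nodewise_basic (hC : CovBounds S L B) (hX : DesignRegular S t X) {j : Fin p}
    {γ : {k : Fin p // k ≠ j} → ℝ} {lam : ℝ} (h : IsNodewise lam X j γ) :
    empSq (lin X (popVec S j - nodeVec j γ)) + 2 * lam * ∑ k, |nodeVec j γ k|
      ≤ 2 * (B * t * ∑ k, |(popVec S j - nodeVec j γ) k|) + 2 * lam * ∑ k, |popVec S j k| := by
  have h1 := nodewise_objective_le h (popVec_self hC.posDef j)
  have e : lin X (nodeVec j γ) = lin X (popVec S j) - lin X (popVec S j - nodeVec j γ) := by
    rw [lin_sub]; abel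
  rw [e] at h1
  have h2 := empSq_le_of_penalized_le h1
  have h3 := abs_empInner_lin_le X (lin X (popVec S j)) (popVec S j - nodeVec j γ) (T := B * t) (by
    intro k hk
    have hkj : k ≠ j := by
      rintro rfl
      simp [popVec_self hC.posDef, nodeVec_self] at hk
    have := hC.abs_empInner_popVec_le hX j k
    simpa [hkj] using this)
  linarith [le_abs_self (empInner (lin X (popVec S j)) (lin X (popVec S j - nodeVec j γ)))]

/-- The slow rate for the prediction error of the nodewise Lasso. -/
theorem nodewise_prediction_le_of_dominated (hC : CovBounds S L B)
    (hX : DesignRegular S t X) (ht : 0 ≤ t) {j : Fin p}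
    {γ : {k : Fin p // k ≠ j} → ℝ} {lam d : ℝ} (h : IsNodewise lam X j γ) (htl : B * t ≤ lam)
    (hd : (sparsity (precCol S j) : ℝ) ≤ d) :
    empSq (lin X (popVec S j - nodeVec j γ)) ≤ 4 * lam * (B ^ 2 * √d) := by
  have h1 := hC.nodewise_basic hX h
  have h2 := sum_abs_sub_le Finset.univ (popVec S j) (nodeVec j γ)
  have h3 := hC.sum_abs_popVec_le j hd
  have hB := hC.one_le
  have hlam : 0 ≤ lam := le_trans (by positivity) htl
  have h4 : B * t * ∑ k, |(popVec S j - nodeVec j γ) k|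
      ≤ lam * (∑ k, |popVec S j k| + ∑ k, |nodeVec j γ k|) := by
    gcongr
    exact h2
  have h5 : lam * ∑ k, |popVec S j k| ≤ lam * (B ^ 2 * √d) := by gcongr
  linarith

/-- In low dimension the form `‖X v‖ₙ²` is bounded below by a multiple of `‖v‖₂²`, so no sparsity
and no lower bound on the penalty are needed. -/
theorem nodewise_prediction_le_of_lowdim (hC : CovBounds S L B)
    (hX : DesignRegular S t X) (ht : 0 ≤ t) {j : Fin p}
    {γ : {k : Fin p // k ≠ j} → ℝ} {lam : ℝ} (h : IsNodewise lam X j γ) (hlam : 0 ≤ lam)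
    (htp : p * t ≤ L / 2) :
    empSq (lin X (popVec S j - nodeVec j γ)) ≤ 8 * p * (B * t + lam) ^ 2 / L := by
  have h1 := hC.nodewise_basic hX h
  have hB := hC.one_le
  have h2 : ∑ k, |popVec S j k| ≤ ∑ k, |nodeVec j γ k| + ∑ k, |(popVec S j - nodeVec j γ) k| := by
    rw [← Finset.sum_add_distrib]
    refine Finset.sum_le_sum fun k _ => ?_
    have := abs_sub_abs_le_abs_sub (popVec S j k) (nodeVec j γ k)
    simp only [Pi.sub_apply]; linarith
  have h3 : lam * ∑ k, |popVec S j k|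
      ≤ lam * (∑ k, |nodeVec j γ k| + ∑ k, |(popVec S j - nodeVec j γ) k|) := by gcongr
  have h4 : empSq (lin X (popVec S j - nodeVec j γ))
      ≤ 2 * (B * t + lam) * ∑ k, |(popVec S j - nodeVec j γ) k| := by linarith
  have h5 := hC.l1_le_of_regular hX ht (K := p) (μ := 2 * (B * t + lam)) (by positivity)
    (by positivity) h4 (sum_abs_sq_le _) (by linarith)
  calc _ ≤ _ := h4
    _ ≤ 2 * (B * t + lam) * (2 * p * (2 * (B * t + lam)) / L) := by gcongr
    _ = _ := by ring

/-- The residual variance estimate `τ̂²` is close to its population version `1 / Θ_jj`, because the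
Karush-Kuhn-Tucker conditions make it a linear function of the contrast. -/
theorem abs_tauSq_sub_le (hC : CovBounds S L B)
    (hX : DesignRegular S t X) (ht : 0 ≤ t) (htB : t ≤ B) {j : Fin p}
    {γ : {k : Fin p // k ≠ j} → ℝ} {lam E : ℝ} (h : IsNodewise lam X j γ)
    (hE : empSq (lin X (popVec S j - nodeVec j γ)) ≤ E) :
    |tauSq lam X j γ - 1 / S⁻¹ j j| ≤ B * t + √(2 * B * E) := by
  have h1 := hC.abs_empInner_popVec_le hX j j
  rw [Pi.single_eq_same, mul_one] at h1
  have h2 : empSq (col X j) ≤ 2 * B := by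
    have := (abs_le.1 (hX.1 j j)).2
    rw [empInner_self] at this
    linarith [hC.diag_le j]
  have h3 : |empInner (lin X (popVec S j - nodeVec j γ)) (col X j)| ≤ √(2 * B * E) := by
    refine (abs_empInner_le _ _).trans ?_
    rw [mul_comm, Real.sqrt_mul (by linarith [hC.one_le])]
    gcongr
  have e : tauSq lam X j γ - 1 / S⁻¹ j j = (empInner (lin X (popVec S j)) (col X j) - 1 / S⁻¹ j j)
      - empInner (lin X (popVec S j - nodeVec j γ)) (col X j) := by
    rw [← nodewise_kkt_self h, lin_sub, empInner_sub_left]; ring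
  rw [e]
  exact (abs_sub _ _).trans (add_le_add h1 h3)

/-- Error of a column of the nodewise Lasso estimator, measured in the empirical norm. -/
theorem thetaCol_error (hC : CovBounds S L B)
    (hX : DesignRegular S t X) (ht : 0 ≤ t) (htB : t ≤ B) {j : Fin p}
    {γ : {k : Fin p // k ≠ j} → ℝ} {lam E : ℝ} (hlam : 0 ≤ lam) (h : IsNodewise lam X j γ)
    (hE : empSq (lin X (popVec S j - nodeVec j γ)) ≤ E)
    (hsmall : B * t + √(2 * B * E) ≤ L / 2) :
    L / 2 ≤ tauSq lam X j γ ∧ empSq (lin X (thetaCol lam X j γ - precCol S j))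
      ≤ 2 * E / L ^ 2 + 4 * (B * t + √(2 * B * E)) ^ 2 / L ^ 3 := by
  have hL := hC.pos
  have h1 := hC.abs_tauSq_sub_le hX ht htB h hE
  set η := B * t + √(2 * B * E) with hη
  set τ := tauSq lam X j γ with hτ
  have hσL := hC.le_resid_var j
  have hσ0 := hC.resid_var_pos j
  have hp := precision_diag_pos hC.posDef j
  set σ := 1 / S⁻¹ j j with hσ
  have hτL : L / 2 ≤ τ := by linarith [(abs_le.1 h1).1]
  have hτ0 : 0 < τ := by linarith
  refine ⟨hτL, ?_⟩
  have e : thetaCol lam X j γ - precCol S j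
      = (1 / τ - 1 / σ) • nodeVec j γ - (1 / σ) • (popVec S j - nodeVec j γ) := by
    ext k
    simp only [thetaCol, popVec, Pi.sub_apply, Pi.smul_apply, smul_eq_mul, ← hτ, ← hσ]
    field_simp
    ring
  rw [e, lin_sub, lin_smul, lin_smul]
  refine (empSq_sub_le _ _).trans ?_
  rw [empSq_smul, empSq_smul]
  have hE0 : 0 ≤ E := (empSq_nonneg _).trans hE
  have h2 : (1 / σ) ^ 2 * empSq (lin X (popVec S j - nodeVec j γ)) ≤ (1 / L) ^ 2 * E := by
    gcongr
    exact empSq_nonneg _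
  have h3 : (1 / τ - 1 / σ) ^ 2 * empSq (lin X (nodeVec j γ)) ≤ 2 * η ^ 2 / L ^ 3 := by
    calc (1 / τ - 1 / σ) ^ 2 * empSq (lin X (nodeVec j γ)) ≤ (1 / τ - 1 / σ) ^ 2 * τ := by
          gcongr; exact empSq_nodeVec_le_tauSq X j γ hlam
      _ = |τ - σ| ^ 2 / (τ * σ ^ 2) := by rw [sq_abs]; field_simp; ring
      _ ≤ η ^ 2 / (L / 2 * L ^ 2) := by gcongr
      _ = 2 * η ^ 2 / L ^ 3 := by field_simp
  calc 2 * ((1 / τ - 1 / σ) ^ 2 * empSq (lin X (nodeVec j γ))) +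
        2 * ((1 / σ) ^ 2 * empSq (lin X (popVec S j - nodeVec j γ)))
      ≤ 2 * (2 * η ^ 2 / L ^ 3) + 2 * ((1 / L) ^ 2 * E) := by gcongr
    _ = _ := by field_simp; ring

end CovBounds

/-- The bias term of the de-sparsified Lasso is controlled by the product of the tuning parameter
of the nodewise Lasso and the `ℓ₁`-error of the Lasso. -/
theorem abs_bias_le {j : Fin p} {γ : {k : Fin p // k ≠ j} → ℝ} {lam : ℝ} (hlam : 0 ≤ lam)
    (h : IsNodewise lam X j γ) (hL : 0 < L) (hτ : L / 2 ≤ tauSq lam X j γ) (δ : Fin p → ℝ) :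
    |δ j - empInner (lin X (thetaCol lam X j γ)) (lin X δ)| ≤ 2 / L * lam * ∑ k, |δ k| := by
  have h1 := nodewise_inverse_error hlam h δ
  have hτ0 : 0 < tauSq lam X j γ := by linarith
  rw [thetaCol, lin_smul, empInner_smul_left]
  set τ := tauSq lam X j γ
  have e : δ j - 1 / τ * empInner (lin X (nodeVec j γ)) (lin X δ)
      = 1 / τ * (τ * δ j - empInner (lin X (nodeVec j γ)) (lin X δ)) := by field_simp
  rw [e, abs_mul, abs_of_pos (by positivity), mul_assoc]
  have h2 : 1 / τ ≤ 2 / L := by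
    calc 1 / τ ≤ 1 / (L / 2) := one_div_le_one_div_of_le (by positivity) hτ
      _ = 2 / L := by field_simp
  exact mul_le_mul h2 h1 (abs_nonneg _) (by positivity)

theorem empSq_thetaCol_le {j : Fin p} {γ : {k : Fin p // k ≠ j} → ℝ} {lam : ℝ} (hlam : 0 ≤ lam) :
    empSq (lin X (thetaCol lam X j γ)) ≤ 1 / tauSq lam X j γ := by
  rw [thetaCol, lin_smul, empSq_smul]
  have h1 := empSq_nodeVec_le_tauSq X j γ hlam
  rcases (tauSq_nonneg X j γ hlam).eq_or_lt with h | h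
  · rw [← h]; simp
  · calc _ ≤ (1 / tauSq lam X j γ) ^ 2 * tauSq lam X j γ := by gcongr
      _ = _ := by field_simp

/-- A bound for the bias term that holds for every design. -/
theorem bias_sq_le_crude {j : Fin p} {γ : {k : Fin p // k ≠ j} → ℝ} {lam : ℝ} (hlam : 0 ≤ lam)
    (δ : Fin p → ℝ) :
    (δ j - empInner (lin X (thetaCol lam X j γ)) (lin X δ)) ^ 2
      ≤ 2 * (∑ k, |δ k|) ^ 2 + 2 * (1 / tauSq lam X j γ * empSq (lin X δ)) := by
  have h1 := empInner_sq_le (lin X (thetaCol lam X j γ)) (lin X δ)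
  have h2 : empSq (lin X (thetaCol lam X j γ)) * empSq (lin X δ)
      ≤ 1 / tauSq lam X j γ * empSq (lin X δ) :=
    mul_le_mul_of_nonneg_right (empSq_thetaCol_le hlam) (empSq_nonneg _)
  have h3 : δ j ^ 2 ≤ (∑ k, |δ k|) ^ 2 := by
    rw [← sq_abs]
    gcongr
    exact Finset.single_le_sum (f := fun k => |δ k|) (fun k _ => abs_nonneg _) (Finset.mem_univ j)
  nlinarith [sq_nonneg (δ j + empInner (lin X (thetaCol lam X j γ)) (lin X δ))]

end GoodEvent

/-! ### The law of the design and of the noise -/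

section Law

variable {n p : ℕ} {S : Matrix (Fin p) (Fin p) ℝ} {L B t : ℝ}

/-- The law of the design: independent rows distributed as `N(0, S)`. -/
abbrev designLaw (n : ℕ) (S : Matrix (Fin p) (Fin p) ℝ) : Measure (Design n p) :=
  Measure.pi fun _ : Fin n => multivariateGaussian (0 : Coef p) S

/-- The law of the noise: the standard Gaussian measure. -/
abbrev noiseLaw (n : ℕ) : Measure (Fin n → ℝ) := Measure.pi fun _ : Fin n => gaussianReal 0 1

/-- The joint law of the design and the noise, which does not involve the regression vector. -/
abbrev baseLaw (n : ℕ) (S : Matrix (Fin p) (Fin p) ℝ) : Measure (Design n p × (Fin n → ℝ)) :=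
  (designLaw n S).prod (noiseLaw n)

/-- The observations as a function of the design and the noise. -/
def observe (β : Coef p) (z : Design n p × (Fin n → ℝ)) : Data n p :=
  (z.1, fun i => fit z.1 β i + z.2 i)

theorem law_eq_map (β : Coef p) : law (n := n) S β = (baseLaw n S).map (observe β) := rfl

@[fun_prop]
theorem measurable_rowFunctional (v : Fin p → ℝ) :
    Measurable fun x : Coef p => ∑ k, x k * v k := by fun_prop

@[fun_prop]
theorem measurable_lin (v : Fin p → ℝ) : Measurable fun X : Design n p => lin X v := by
  unfold lin; fun_prop

@[fun_prop]
theorem measurable_col (k : Fin p) : Measurable fun X : Design n p => col X k := by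
  unfold col; fun_prop

@[fun_prop]
theorem measurable_empSq : Measurable fun a : Fin n → ℝ => empSq a := by
  unfold empSq; fun_prop

@[fun_prop]
theorem Measurable.empInner {α : Type*} [MeasurableSpace α] {f g : α → Fin n → ℝ}
    (hf : Measurable f) (hg : Measurable g) : Measurable fun a => empInner (f a) (g a) := by
  unfold HDLinear.empInner; fun_prop

theorem measurable_observe (β : Coef p) : Measurable (observe (n := n) β) := by
  unfold observe
  simp only [fit_eq_lin]
  refine measurable_fst.prodMk ?_
  fun_prop

theorem map_rowFunctional (hS : S.PosSemidef) (v : Fin p → ℝ) :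
    (multivariateGaussian (0 : Coef p) S).map (fun x => ∑ k, x k * v k)
      = gaussianReal 0 (v ⬝ᵥ S *ᵥ v).toNNReal := by
  have h := IsGaussian.map_eq_gaussianReal (μ := multivariateGaussian (0 : Coef p) S)
    (innerSL ℝ (WithLp.toLp 2 v : Coef p))
  have e : ⇑(innerSL ℝ (WithLp.toLp 2 v : Coef p)) = fun x : Coef p => ∑ k, x k * v k := by
    ext x; simp [PiLp.inner_apply]
  rw [ContinuousLinearMap.integral_comp_id_comm IsGaussian.integrable_id] at h
  have hvar : Var[⇑(innerSL ℝ (WithLp.toLp 2 v : Coef p)); multivariateGaussian (0 : Coef p) S]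
      = v ⬝ᵥ S *ᵥ v := by
    have h1 := covarianceBilin_self (μ := multivariateGaussian (0 : Coef p) S)
      IsGaussian.memLp_two_id (WithLp.toLp 2 v)
    rw [covarianceBilin_multivariateGaussian hS] at h1
    exact h1.symm
  rw [hvar, e] at h
  simpa using h

theorem empSq_lin_eq (X : Design n p) (v : Fin p → ℝ) :
    empSq (lin X v) = (∑ i, (∑ k, X i k * v k) ^ 2) / n := rfl

/-- The Laplace transform of the noise. -/
theorem lintegral_exp_noise (c : Fin n → ℝ) :
    ∫⁻ e, ENNReal.ofReal (Real.exp (∑ i, c i * e i)) ∂noiseLaw n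
      = ENNReal.ofReal (Real.exp ((∑ i, c i ^ 2) / 2)) := by
  have h1 : ∀ e : Fin n → ℝ, ENNReal.ofReal (Real.exp (∑ i, c i * e i)) =
      ∏ i, ENNReal.ofReal (Real.exp (c i * e i)) := by
    intro e
    rw [Real.exp_sum, ENNReal.ofReal_prod_of_nonneg (fun i _ => by positivity)]
  simp_rw [h1]
  rw [lintegral_pi_prod _ (f := fun i z => ENNReal.ofReal (Real.exp (c i * z)))
    (fun i => by fun_prop)]
  simp_rw [lintegral_exp_mul_gaussianReal]
  rw [← ENNReal.ofReal_prod_of_nonneg (fun i _ => by positivity), ← Real.exp_sum, Finset.sum_div]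
  simp

theorem memLp_noise_lin (c : Fin n → ℝ) :
    MemLp (fun e : Fin n → ℝ => ∑ i, c i * e i) 2 (noiseLaw n) := by
  refine memLp_finsetSum _ fun i _ => MemLp.const_mul ?_ (c i)
  exact (memLp_id_gaussianReal 2).comp_measurePreserving
    (measurePreserving_eval (fun _ : Fin n => gaussianReal 0 1) i)

theorem integral_noise_lin (c : Fin n → ℝ) : ∫ e, ∑ i, c i * e i ∂noiseLaw n = 0 := by
  rw [integral_finsetSum]
  · refine Finset.sum_eq_zero fun i _ => ?_
    rw [integral_const_mul, integral_eval]; simp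
  · intro i _
    refine Integrable.const_mul ?_ _
    exact ((memLp_id_gaussianReal 2).comp_measurePreserving
      (measurePreserving_eval (fun _ : Fin n => gaussianReal 0 1) i)).integrable (by norm_num)

theorem integral_noise_lin_sq (c : Fin n → ℝ) :
    ∫ e, (∑ i, c i * e i) ^ 2 ∂noiseLaw n = ∑ i, c i ^ 2 := by
  have h1 := variance_of_integral_eq_zero (memLp_noise_lin c).aestronglyMeasurable.aemeasurable
    (integral_noise_lin c)
  rw [← h1]
  have h2 := variance_sum_pi (μ := fun _ : Fin n => gaussianReal 0 1) (X := fun i z => c i * z)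
    (fun i => (memLp_id_gaussianReal 2).const_mul (c i))
  have e : (∑ i, fun ω : Fin n → ℝ => c i * ω i) = fun e => ∑ i, c i * e i := by
    ext e; simp
  rw [e] at h2
  rw [h2]
  refine Finset.sum_congr rfl fun i _ => ?_
  rw [variance_const_mul, variance_fun_id_gaussianReal]; simp

theorem lintegral_noise_lin_sq (c : Fin n → ℝ) :
    ∫⁻ e, ENNReal.ofReal ((∑ i, c i * e i) ^ 2) ∂noiseLaw n = ENNReal.ofReal (∑ i, c i ^ 2) := by
  rw [← integral_noise_lin_sq, ofReal_integral_eq_lintegral_ofReal (memLp_noise_lin c).integrable_sq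
    (ae_of_all _ fun e => sq_nonneg _)]

/-- The second moment, over design and noise, of a linear functional of the noise whose
coefficients depend on the design. -/
theorem lintegral_empInner_noise_sq {a : Design n p → Fin n → ℝ} (ha : Measurable a) :
    ∫⁻ z, ENNReal.ofReal (empInner (a z.1) z.2 ^ 2) ∂baseLaw n S
      = ENNReal.ofReal (1 / n) * ∫⁻ X, ENNReal.ofReal (empSq (a X)) ∂designLaw n S := by
  rw [lintegral_prod _ (by fun_prop), ← lintegral_const_mul _ (by fun_prop)]
  refine lintegral_congr fun X => ?_
  have h1 : ∀ e : Fin n → ℝ, ENNReal.ofReal (empInner (a X) e ^ 2)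
      = ENNReal.ofReal (1 / n ^ 2) * ENNReal.ofReal ((∑ i, a X i * e i) ^ 2) := by
    intro e
    rw [← ENNReal.ofReal_mul (by positivity), empInner, div_pow]
    congr 1; ring
  simp only [h1]
  rw [lintegral_const_mul _ (by fun_prop), lintegral_noise_lin_sq,
    ← ENNReal.ofReal_mul (by positivity), ← ENNReal.ofReal_mul (by positivity), empSq]
  congr 1; ring

theorem gaussianReal_eq_withDensity (a : ℝ) :
    gaussianReal a 1 = (gaussianReal 0 1).withDensity
      fun z => ENNReal.ofReal (Real.exp (a * z - a ^ 2 / 2)) := by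
  rw [gaussianReal_of_var_ne_zero _ one_ne_zero, gaussianReal_of_var_ne_zero _ one_ne_zero,
    ← withDensity_mul _ (measurable_gaussianPDF 0 1) (by fun_prop)]
  congr 1
  ext z
  rw [Pi.mul_apply, gaussianPDF, gaussianPDF, ← ENNReal.ofReal_mul (gaussianPDFReal_nonneg _ _ _),
    gaussianPDFReal, gaussianPDFReal, mul_assoc (_⁻¹), ← Real.exp_add]
  congr 3
  simp; ring

/-- The Cameron-Martin formula for the noise. -/
theorem noiseLaw_map_add (a : Fin n → ℝ) :
    (noiseLaw n).map (fun e i => a i + e i) = (noiseLaw n).withDensity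
      fun e => ENNReal.ofReal (Real.exp (∑ i, a i * e i - (∑ i, a i ^ 2) / 2)) := by
  have h1 : (noiseLaw n).map (fun e i => a i + e i)
      = Measure.pi fun i => (gaussianReal 0 1).map (fun z => a i + z) :=
    Measure.pi_map_pi (f := fun i z => a i + z) (fun i => Measurable.aemeasurable (by fun_prop))
  rw [h1]
  apply Measure.pi_eq
  intro s hs
  rw [withDensity_apply _ (MeasurableSet.univ_pi hs),
    ← lintegral_indicator (MeasurableSet.univ_pi hs)]
  have h2 : ∀ e : Fin n → ℝ, (Set.univ.pi s).indicator
      (fun e => ENNReal.ofReal (Real.exp (∑ i, a i * e i - (∑ i, a i ^ 2) / 2))) e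
      = ∏ i, (s i).indicator
          (fun z => ENNReal.ofReal (Real.exp (a i * z - a i ^ 2 / 2))) (e i) := by
    intro e
    by_cases he : e ∈ Set.univ.pi s
    · rw [Set.indicator_of_mem he, Finset.sum_div, ← Finset.sum_sub_distrib, Real.exp_sum,
        ENNReal.ofReal_prod_of_nonneg (fun i _ => by positivity)]
      refine Finset.prod_congr rfl fun i _ => ?_
      rw [Set.indicator_of_mem (he i trivial)]
    · rw [Set.indicator_of_notMem he]
      simp only [Set.mem_univ_pi, not_forall] at he
      obtain ⟨i, hi⟩ := he
      exact (Finset.prod_eq_zero (Finset.mem_univ i) (Set.indicator_of_notMem hi _)).symm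
  simp_rw [h2]
  rw [lintegral_pi_prod _ (f := fun i => (s i).indicator
    (fun z => ENNReal.ofReal (Real.exp (a i * z - a i ^ 2 / 2))))
    (fun i => Measurable.indicator (by fun_prop) (hs i))]
  refine Finset.prod_congr rfl fun i _ => ?_
  rw [lintegral_indicator (hs i), ← withDensity_apply _ (hs i), ← gaussianReal_eq_withDensity,
    gaussianReal_map_const_add, zero_add]

/-! ### Concentration of the sample covariance -/

/-- Polarization reduces empirical covariances to empirical second moments of Gaussian functionals.
-/
theorem empInner_lin_polarization (hS : S.PosDef) (X : Design n p) (v w : Fin p → ℝ) :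
    4 * (empInner (lin X v) (lin X w) - v ⬝ᵥ S *ᵥ w)
      = (empSq (lin X (v + w)) - (v + w) ⬝ᵥ S *ᵥ (v + w))
        - (empSq (lin X (v - w)) - (v - w) ⬝ᵥ S *ᵥ (v - w)) := by
  have hsymm : w ⬝ᵥ S *ᵥ v = v ⬝ᵥ S *ᵥ w := by
    rw [Matrix.dotProduct_mulVec, ← Matrix.mulVec_transpose]
    have : Sᵀ = S := by simpa using hS.isHermitian.eq
    rw [this, dotProduct_comm]
  rw [lin_add, lin_sub, empSq_add, empSq_sub]
  simp only [Matrix.mulVec_add, Matrix.mulVec_sub, add_dotProduct, sub_dotProduct, dotProduct_add,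
    dotProduct_sub, hsymm]
  ring

theorem designLaw_deviation_le (hS : S.PosDef) (hn : 0 < n) (hB : 0 < B) (ht : 0 < t)
    (htB : t ≤ B) {v : Fin p → ℝ} (hv : v ⬝ᵥ S *ᵥ v ≤ B) :
    designLaw n S {X | t < |empSq (lin X v) - v ⬝ᵥ S *ᵥ v|}
      ≤ ENNReal.ofReal (2 * Real.exp (-(n * t ^ 2 / (8 * B ^ 2)))) := by
  have hv0 : 0 ≤ v ⬝ᵥ S *ᵥ v := by simpa using hS.posSemidef.dotProduct_mulVec_nonneg v
  have hn0 : (0 : ℝ) < n := by exact_mod_cast hn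
  refine (measure_mono ?_).trans (measure_abs_sum_sq_sub_gt_le (n := n)
    (measurable_rowFunctional v) (map_rowFunctional hS.posSemidef v) hB
    (by rwa [Real.coe_toNNReal _ hv0]) ht htB)
  intro X hX
  simp only [Set.mem_ofPred_eq] at hX ⊢
  rw [Real.coe_toNNReal _ hv0]
  have e : ∑ i, (∑ k, X i k * v k) ^ 2 - n * (v ⬝ᵥ S *ᵥ v)
      = n * (empSq (lin X v) - v ⬝ᵥ S *ᵥ v) := by
    rw [empSq_lin_eq]; field_simp
  rw [e, abs_mul, abs_of_pos hn0]
  gcongr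

theorem designLaw_cross_deviation_le (hS : S.PosDef) (hn : 0 < n) (hB : 0 < B) (ht : 0 < t)
    (htB : t ≤ B) {v w : Fin p → ℝ} (hv : v ⬝ᵥ S *ᵥ v ≤ B) (hw : w ⬝ᵥ S *ᵥ w ≤ B) :
    designLaw n S {X | t < |empInner (lin X v) (lin X w) - v ⬝ᵥ S *ᵥ w|}
      ≤ ENNReal.ofReal (4 * Real.exp (-(n * t ^ 2 / (32 * B ^ 2)))) := by
  have hpar : (v + w) ⬝ᵥ S *ᵥ (v + w) + (v - w) ⬝ᵥ S *ᵥ (v - w)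
      = 2 * (v ⬝ᵥ S *ᵥ v) + 2 * (w ⬝ᵥ S *ᵥ w) := by
    simp only [Matrix.mulVec_add, Matrix.mulVec_sub, add_dotProduct, sub_dotProduct,
      dotProduct_add, dotProduct_sub]
    ring
  have h1 : 0 ≤ (v + w) ⬝ᵥ S *ᵥ (v + w) := by
    simpa using hS.posSemidef.dotProduct_mulVec_nonneg (v + w)
  have h2 : 0 ≤ (v - w) ⬝ᵥ S *ᵥ (v - w) := by
    simpa using hS.posSemidef.dotProduct_mulVec_nonneg (v - w)
  have h3 := designLaw_deviation_le (n := n) hS hn (B := 4 * B) (t := 2 * t) (by positivity)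
    (by positivity) (by linarith) (v := v + w) (by linarith)
  have h4 := designLaw_deviation_le (n := n) hS hn (B := 4 * B) (t := 2 * t) (by positivity)
    (by positivity) (by linarith) (v := v - w) (by linarith)
  have e : n * (2 * t) ^ 2 / (8 * (4 * B) ^ 2) = n * t ^ 2 / (32 * B ^ 2) := by
    field_simp; ring
  rw [e] at h3 h4
  have hsub : {X : Design n p | t < |empInner (lin X v) (lin X w) - v ⬝ᵥ S *ᵥ w|} ⊆
      {X | 2 * t < |empSq (lin X (v + w)) - (v + w) ⬝ᵥ S *ᵥ (v + w)|} ∪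
      {X | 2 * t < |empSq (lin X (v - w)) - (v - w) ⬝ᵥ S *ᵥ (v - w)|} := by
    intro X hX
    by_contra hcon
    simp only [Set.mem_union, Set.mem_ofPred_eq, not_or, not_lt] at hcon hX
    have h5 := empInner_lin_polarization hS X v w
    have h6 := abs_sub (empSq (lin X (v + w)) - (v + w) ⬝ᵥ S *ᵥ (v + w))
      (empSq (lin X (v - w)) - (v - w) ⬝ᵥ S *ᵥ (v - w))
    rw [← h5, abs_mul, abs_of_pos (by norm_num : (0 : ℝ) < 4)] at h6
    linarith [hcon.1, hcon.2]
  refine (measure_mono hsub).trans ((measure_union_le _ _).trans ((add_le_add h3 h4).trans ?_))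
  rw [← ENNReal.ofReal_add (by positivity) (by positivity)]
  apply ENNReal.ofReal_le_ofReal
  linarith

theorem single_quadratic (j k : Fin p) :
    (Pi.single j 1 : Fin p → ℝ) ⬝ᵥ S *ᵥ Pi.single k 1 = S j k := by simp

theorem designLaw_not_regular_le (hC : CovBounds S L B) (hn : 0 < n) (ht : 0 < t) (htB : t ≤ B) :
    designLaw n S {X | ¬DesignRegular S t X}
      ≤ ENNReal.ofReal (8 * p ^ 2 * Real.exp (-(n * t ^ 2 / (32 * B ^ 2)))) := by
  have hS := hC.posDef
  have hB : 0 < B := by linarith [hC.one_le]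
  set q := ENNReal.ofReal (4 * Real.exp (-(n * t ^ 2 / (32 * B ^ 2)))) with hq
  have hsub : {X : Design n p | ¬DesignRegular S t X} ⊆
      (⋃ j, ⋃ k, {X | t < |empInner (lin X (Pi.single j 1)) (lin X (Pi.single k 1))
        - (Pi.single j 1 : Fin p → ℝ) ⬝ᵥ S *ᵥ Pi.single k 1|}) ∪
      (⋃ j, ⋃ k, {X | t < |empInner (lin X (precCol S j)) (lin X (Pi.single k 1))
        - precCol S j ⬝ᵥ S *ᵥ Pi.single k 1|}) := by
    intro X hX
    by_contra hcon
    simp only [Set.mem_union, Set.mem_iUnion, Set.mem_ofPred_eq, not_or, not_exists, not_lt,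
      lin_single, single_quadratic] at hcon
    refine hX ⟨hcon.1, fun j k => ?_⟩
    have e : precCol S j ⬝ᵥ S *ᵥ Pi.single k 1 = (Pi.single j 1 : Fin p → ℝ) k := by
      rw [Matrix.dotProduct_mulVec, ← Matrix.mulVec_transpose]
      have : Sᵀ = S := by simpa using hS.isHermitian.eq
      rw [this, mulVec_precCol hS]; simp
    rw [← e]
    exact hcon.2 j k
  have hdiag : ∀ k, (Pi.single k 1 : Fin p → ℝ) ⬝ᵥ S *ᵥ Pi.single k 1 ≤ B := fun k => by
    rw [single_quadratic]; exact hC.diag_le k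
  have hprec : ∀ j, precCol S j ⬝ᵥ S *ᵥ precCol S j ≤ B := fun j => by
    rw [precCol_quadratic hS]
    exact (precision_diag_le hS hC.pos hC.eigenvalues j).trans hC.inv_le
  have hunion : ∀ A : Fin p → Fin p → Set (Design n p), (∀ j k, designLaw n S (A j k) ≤ q) →
      designLaw n S (⋃ j, ⋃ k, A j k) ≤ p * (p * q) := by
    intro A hA
    refine (measure_iUnion_fintype_le _ _).trans ?_
    calc ∑ j, designLaw n S (⋃ k, A j k) ≤ ∑ _j : Fin p, p * q := by
          refine Finset.sum_le_sum fun j _ => (measure_iUnion_fintype_le _ _).trans ?_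
          calc ∑ k, designLaw n S (A j k) ≤ ∑ _k : Fin p, q :=
                Finset.sum_le_sum fun k _ => hA j k
            _ = p * q := by simp
      _ = p * (p * q) := by simp
  refine (measure_mono hsub).trans ((measure_union_le _ _).trans ?_)
  refine (add_le_add
    (hunion _ fun j k => designLaw_cross_deviation_le hS hn hB ht htB (hdiag j) (hdiag k))
    (hunion _ fun j k =>
      designLaw_cross_deviation_le hS hn hB ht htB (hprec j) (hdiag k))).trans ?_
  rw [hq, ← ENNReal.ofReal_natCast, ← ENNReal.ofReal_mul (by positivity),
    ← ENNReal.ofReal_mul (by positivity), ← ENNReal.ofReal_add (by positivity) (by positivity)]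
  apply ENNReal.ofReal_le_ofReal
  apply le_of_eq; ring

/-- One-sided deviations of `⟨ε, X_k⟩ₙ`; the sign `s = ± 1` selects the side. The exponential moment
is computed conditionally on the design first, which leaves an exponential of `‖X_k‖ₙ²`. -/
theorem baseLaw_noise_deviation_le (hC : CovBounds S L B) (hn : 0 < n) (ht : 0 < t)
    (ht1 : t ≤ 1) (k : Fin p) {s : ℝ} (hs : s ^ 2 = 1) :
    baseLaw n S {z | t < s * empInner z.2 (col z.1 k)}
      ≤ ENNReal.ofReal (Real.exp (-(n * t ^ 2 / (32 * B ^ 2)))) := by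
  have hB1 := hC.one_le
  have hB : 0 < B := by linarith
  have hn0 : (0 : ℝ) < n := by exact_mod_cast hn
  set θ : ℝ := t / (2 * B) with hθ
  have hθ0 : 0 < θ := by positivity
  have hsub : {z : Design n p × (Fin n → ℝ) | t < s * empInner z.2 (col z.1 k)} ⊆
      {z | ENNReal.ofReal (Real.exp (θ * (n * t))) ≤
        ENNReal.ofReal (Real.exp (∑ i, (s * θ * col z.1 k i) * z.2 i))} := by
    intro z hz
    simp only [Set.mem_ofPred_eq] at hz ⊢
    apply ENNReal.ofReal_le_ofReal
    apply Real.exp_le_exp.2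
    have e : ∑ i, (s * θ * col z.1 k i) * z.2 i = θ * (n * (s * empInner z.2 (col z.1 k))) := by
      have : n * (s * empInner z.2 (col z.1 k)) = s * ∑ i, z.2 i * col z.1 k i := by
        rw [empInner]; field_simp
      rw [this, Finset.mul_sum, Finset.mul_sum]
      exact Finset.sum_congr rfl fun i _ => by ring
    rw [e]
    gcongr
  refine (measure_mono hsub).trans ?_
  have hmeas : Measurable fun z : Design n p × (Fin n → ℝ) =>
      ENNReal.ofReal (Real.exp (∑ i, (s * θ * col z.1 k i) * z.2 i)) := by
    have : Measurable fun z : Design n p × (Fin n → ℝ) => col z.1 k := by fun_prop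
    fun_prop
  refine (meas_ge_le_lintegral_div hmeas.aemeasurable (by simp [Real.exp_pos]) (by simp)).trans ?_
  rw [ENNReal.div_le_iff (by simp [Real.exp_pos]) (by simp)]
  rw [lintegral_prod _ hmeas.aemeasurable]
  simp_rw [lintegral_exp_noise]
  set v := (Pi.single k 1 : Fin p → ℝ) ⬝ᵥ S *ᵥ Pi.single k 1 with hv
  have hvB : v ≤ B := by rw [hv, single_quadratic]; exact hC.diag_le k
  have hv0 : 0 ≤ v := by
    have := hC.posDef.posSemidef.dotProduct_mulVec_nonneg (Pi.single k 1)
    rwa [star_trivial] at this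
  have h1 : ∀ X : Design n p, ENNReal.ofReal (Real.exp ((∑ i, (s * θ * col X k i) ^ 2) / 2))
      = ENNReal.ofReal (Real.exp (θ ^ 2 / 2 *
        ∑ i, (∑ l, X i l * (Pi.single k 1 : Fin p → ℝ) l) ^ 2)) := by
    intro X
    congr 2
    rw [Finset.sum_div, Finset.mul_sum]
    refine Finset.sum_congr rfl fun i _ => ?_
    have : ∑ l, X i l * (Pi.single k 1 : Fin p → ℝ) l = col X k i :=
      congrFun (lin_single X k) i
    rw [this, mul_pow, mul_pow, hs]; ring
  simp_rw [h1]
  have hθv : θ ^ 2 / 2 * v ≤ t ^ 2 / (8 * B) := by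
    calc θ ^ 2 / 2 * v ≤ θ ^ 2 / 2 * B := by gcongr
      _ = t ^ 2 / (8 * B) := by rw [hθ]; field_simp; ring
  have ht2 : t ^ 2 / (8 * B) ≤ 1 / 8 := by
    apply div_le_div₀ <;> nlinarith
  have hθv0 : 0 ≤ θ ^ 2 / 2 * v := by positivity
  refine (lintegral_exp_sum_sq_le (measurable_rowFunctional _)
    (map_rowFunctional hC.posDef.posSemidef _) (t := θ ^ 2 / 2) ?_).trans ?_
  · rw [Real.coe_toNNReal _ hv0, abs_of_nonneg hθv0]; linarith
  rw [Real.coe_toNNReal _ hv0, ← ENNReal.ofReal_mul (by positivity), ← Real.exp_add]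
  apply ENNReal.ofReal_le_ofReal
  apply Real.exp_le_exp.2
  set x := θ ^ 2 / 2 * v
  have h2 : x + 2 * x ^ 2 ≤ t ^ 2 / (4 * B) := by
    have e : t ^ 2 / (4 * B) = 2 * (t ^ 2 / (8 * B)) := by field_simp; ring
    rw [e]; nlinarith
  have h3 : n * t ^ 2 / (32 * B ^ 2) ≤ n * (t ^ 2 / (4 * B)) := by
    have hBB : B ≤ B ^ 2 := by nlinarith
    rw [mul_div_assoc]
    gcongr
    linarith
  have h4 : θ * (n * t) = 2 * (n * (t ^ 2 / (4 * B))) := by rw [hθ]; field_simp; ring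
  have h5 : (n : ℝ) * (x + 2 * x ^ 2) ≤ n * (t ^ 2 / (4 * B)) := by gcongr
  linarith

theorem baseLaw_not_noiseRegular_le (hC : CovBounds S L B) (hn : 0 < n) (ht : 0 < t)
    (ht1 : t ≤ 1) :
    baseLaw n S {z | ¬NoiseRegular t z.1 z.2}
      ≤ ENNReal.ofReal (2 * p * Real.exp (-(n * t ^ 2 / (32 * B ^ 2)))) := by
  set q := ENNReal.ofReal (Real.exp (-(n * t ^ 2 / (32 * B ^ 2)))) with hq
  have hsub : {z : Design n p × (Fin n → ℝ) | ¬NoiseRegular t z.1 z.2} ⊆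
      ⋃ k, ({z | t < 1 * empInner z.2 (col z.1 k)} ∪
        {z | t < (-1) * empInner z.2 (col z.1 k)}) := by
    intro z hz
    simp only [NoiseRegular, Set.mem_ofPred_eq, not_forall, not_le, lt_abs] at hz
    obtain ⟨k, hk⟩ := hz
    simp only [Set.mem_iUnion, Set.mem_union, Set.mem_ofPred_eq]
    refine ⟨k, ?_⟩
    rcases hk with h | h
    · left; linarith
    · right; linarith
  refine (measure_mono hsub).trans ((measure_iUnion_fintype_le _ _).trans ?_)
  calc ∑ k, baseLaw n S ({z | t < 1 * empInner z.2 (col z.1 k)} ∪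
        {z | t < (-1) * empInner z.2 (col z.1 k)}) ≤ ∑ _k : Fin p, (q + q) := by
        refine Finset.sum_le_sum fun k _ => (measure_union_le _ _).trans (add_le_add ?_ ?_)
        · exact baseLaw_noise_deviation_le hC hn ht ht1 k (by norm_num)
        · exact baseLaw_noise_deviation_le hC hn ht ht1 k (by norm_num)
    _ = p * (q + q) := by simp [mul_add]
    _ = _ := by
        rw [hq, ← ENNReal.ofReal_natCast, ← ENNReal.ofReal_add (by positivity) (by positivity),
          ← ENNReal.ofReal_mul (by positivity)]
        congr 1; ring

end Law

/-! ### Moments off the event of entrywise concentration -/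

section Moments

/-- If `f ≤ a` on a set of large measure and `f ≤ Ψ` everywhere, then the integral of `f` is
controlled by the measure of the exceptional set and the second moment of `Ψ`. -/
theorem lintegral_le_of_le_on {Ω : Type*} [MeasurableSpace Ω] (μ : Measure Ω)
    [IsProbabilityMeasure μ] {f Ψ : Ω → ℝ} {G : Set Ω} {a s : ℝ} (hs : 0 < s)
    (hG : ∀ ω ∈ G, f ω ≤ a) (hΨ : ∀ ω, f ω ≤ Ψ ω) :
    ∫⁻ ω, ENNReal.ofReal (f ω) ∂μ ≤ ENNReal.ofReal a + ENNReal.ofReal s * μ Gᶜ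
      + ENNReal.ofReal (1 / s) * ∫⁻ ω, ENNReal.ofReal (Ψ ω ^ 2) ∂μ := by
  set T := toMeasurable μ Gᶜ with hT
  have hTm : MeasurableSet T := measurableSet_toMeasurable _ _
  have hpt : ∀ ω, ENNReal.ofReal (f ω) ≤ (ENNReal.ofReal a
      + T.indicator (fun _ => ENNReal.ofReal s) ω)
      + ENNReal.ofReal (1 / s) * ENNReal.ofReal (Ψ ω ^ 2) := by
    intro ω
    by_cases hω : ω ∈ G
    · refine (ENNReal.ofReal_le_ofReal (hG ω hω)).trans ?_
      rw [add_assoc]; exact le_self_add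
    · rw [Set.indicator_of_mem (subset_toMeasurable _ _ hω), add_assoc]
      refine le_trans ?_ le_add_self
      rw [← ENNReal.ofReal_mul (by positivity), ← ENNReal.ofReal_add (by positivity)
        (by positivity)]
      apply ENNReal.ofReal_le_ofReal
      refine (hΨ ω).trans ?_
      have h1 : 0 ≤ (Ψ ω - s) ^ 2 / s := by positivity
      have h2 : (Ψ ω - s) ^ 2 / s = s + 1 / s * Ψ ω ^ 2 - 2 * Ψ ω := by field_simp; ring
      have h3 : 0 ≤ 1 / s * Ψ ω ^ 2 := by positivity
      rcases le_total (Ψ ω) 0 with h | h <;> linarith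
  refine (lintegral_mono hpt).trans ?_
  have hm : Measurable fun ω => ENNReal.ofReal a + T.indicator (fun _ => ENNReal.ofReal s) ω :=
    (measurable_const.indicator hTm).const_add _
  rw [lintegral_add_left hm,
    lintegral_add_left measurable_const, lintegral_indicator_const hTm, hT,
    measure_toMeasurable, lintegral_const_mul' _ _ (by simp)]
  simp

variable {n p : ℕ} {S : Matrix (Fin p) (Fin p) ℝ} {L B t : ℝ}

/-- The nodewise objective compared at the solution and at `γ = 0`. -/
theorem tauSq_le_empSq_col {X : Design n p} {j : Fin p} {γ : {k : Fin p // k ≠ j} → ℝ} {lam : ℝ}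
    (hlam : 0 ≤ lam) (h : IsNodewise lam X j γ) : tauSq lam X j γ ≤ empSq (col X j) := by
  have h1 := nodewise_objective_le h (w := Pi.single j 1) (by simp)
  have e : ∑ k, |(Pi.single j 1 : Fin p → ℝ) k| = 1 := by
    rw [Finset.sum_eq_single j] <;> simp +contextual
  rw [lin_single, e, sum_abs_nodeVec] at h1
  rw [tauSq, nodeResid_eq]
  have : 0 ≤ lam * ∑ k, |γ k| := by positivity
  linarith

/-- The maximum over the columns in `one_div_tauSq_le` is replaced by an exponential sum, in which
each summand has exponentially small expectation, so that the sum over `p` columns is harmless. -/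
theorem one_div_tauSq_pow_le {X : Design n p} {j : Fin p} {γ : {k : Fin p // k ≠ j} → ℝ}
    {lam : ℝ} (hlam : 0 < lam) (h : IsNodewise lam X j γ) (hB : 0 < B) (hn : 8 ≤ n) :
    (1 / tauSq lam X j γ) ^ 4 ≤ 5000 * (1 / empSq (col X j) ^ 4)
      + 8 * (1 / lam ^ 2) ^ 4 * (24 * Real.exp 2 * B ^ 4) *
        (1 + ∑ k, Real.exp (1 / (8 * B) * (n * empSq (col X k)) - n / 4)) := by
  have hrhs : 0 ≤ 8 * (1 / lam ^ 2) ^ 4 * (24 * Real.exp 2 * B ^ 4) *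
        (1 + ∑ k, Real.exp (1 / (8 * B) * (n * empSq (col X k)) - n / 4)) := by positivity
  have hn8 : (8 : ℝ) ≤ n := by exact_mod_cast hn
  rcases (empSq_nonneg (col X j)).eq_or_lt with h0 | h0
  · have h1 := tauSq_le_empSq_col hlam.le h
    rw [← h0] at h1
    rw [le_antisymm h1 (tauSq_nonneg X j γ hlam.le), ← h0]
    simpa using hrhs
  obtain ⟨k, -, hk⟩ := Finset.exists_max_image Finset.univ (fun k => empSq (col X k))
    ⟨j, Finset.mem_univ j⟩
  have h1 := one_div_tauSq_le (γ := γ) hlam h0 fun l => hk l (Finset.mem_univ l)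
  set y := empSq (col X j)
  set Z := empSq (col X k)
  have hZ0 : 0 ≤ Z := empSq_nonneg _
  have hτ := tauSq_nonneg X j γ hlam.le
  have h2 : Z ^ 4 ≤ 24 * Real.exp 2 * B ^ 4 *
      (1 + ∑ k, Real.exp (1 / (8 * B) * (n * empSq (col X k)) - n / 4)) := by
    have h3 := pow_le_factorial_mul_exp (x := Z / B) (by positivity) 4
    have h4 : Real.exp (Z / B) ≤ Real.exp 2 *
        (1 + ∑ k, Real.exp (1 / (8 * B) * (n * empSq (col X k)) - n / 4)) := by
      have h5 : Real.exp (1 / (8 * B) * (n * Z) - n / 4)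
          ≤ ∑ k, Real.exp (1 / (8 * B) * (n * empSq (col X k)) - n / 4) :=
        Finset.single_le_sum (f := fun k => Real.exp (1 / (8 * B) * (n * empSq (col X k)) - n / 4))
          (fun _ _ => by positivity) (Finset.mem_univ k)
      have h6 : Real.exp (Z / B - 2) ≤ 1 + Real.exp (1 / (8 * B) * (n * Z) - n / 4) := by
        have e : 1 / (8 * B) * (n * Z) - n / 4 = n / 8 * (Z / B - 2) := by field_simp; ring
        rw [e]
        rcases le_total (Z / B) 2 with h | h
        · have : Real.exp (Z / B - 2) ≤ 1 := Real.exp_le_one_iff.2 (by linarith)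
          have := Real.exp_pos (n / 8 * (Z / B - 2))
          linarith
        · have : Real.exp (Z / B - 2) ≤ Real.exp (n / 8 * (Z / B - 2)) :=
            Real.exp_le_exp.2 (by nlinarith)
          linarith
      calc Real.exp (Z / B) = Real.exp 2 * Real.exp (Z / B - 2) := by
            rw [← Real.exp_add]; congr 1; ring
        _ ≤ _ := by gcongr; linarith
    calc Z ^ 4 = B ^ 4 * (Z / B) ^ 4 := by field_simp
      _ ≤ B ^ 4 * (24 * (Real.exp 2 *
          (1 + ∑ k, Real.exp (1 / (8 * B) * (n * empSq (col X k)) - n / 4)))) := by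
          gcongr
          rw [show ((Nat.factorial 4 : ℕ) : ℝ) = 24 by norm_num [Nat.factorial]] at h3
          refine h3.trans ?_
          gcongr
      _ = _ := by ring
  have h5 : (1 / tauSq lam X j γ) ^ 4 ≤ (5 / y + Z / lam ^ 2) ^ 4 := by gcongr
  have h6 : (5 / y + Z / lam ^ 2) ^ 4 ≤ 8 * ((5 / y) ^ 4 + (Z / lam ^ 2) ^ 4) := by
    have := add_pow_le (a := 5 / y) (b := Z / lam ^ 2) (by positivity) (by positivity) 4
    norm_num at this ⊢
    exact this
  calc (1 / tauSq lam X j γ) ^ 4 ≤ 8 * ((5 / y) ^ 4 + (Z / lam ^ 2) ^ 4) := h5.trans h6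
    _ = 5000 * (1 / y ^ 4) + 8 * (1 / lam ^ 2) ^ 4 * Z ^ 4 := by
        rw [div_pow, div_pow]; ring
    _ ≤ 5000 * (1 / y ^ 4) + 8 * (1 / lam ^ 2) ^ 4 * (24 * Real.exp 2 * B ^ 4 *
        (1 + ∑ k, Real.exp (1 / (8 * B) * (n * empSq (col X k)) - n / 4))) := by gcongr
    _ = _ := by ring

theorem empSq_col_eq (X : Design n p) (k : Fin p) :
    empSq (col X k) = (∑ i, (∑ l, X i l * (Pi.single k 1 : Fin p → ℝ) l) ^ 2) / n := by
  rw [← lin_single]; rfl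

/-- A constant in the bound for the fourth moment of `1 / τ̂²`. -/
def precMoment (L B : ℝ) : ℝ := 5000 * (1 + 4 / √L) ^ 16 + 6144 * Real.exp 2 * B ^ 4

theorem precMoment_nonneg (L B : ℝ) : 0 ≤ precMoment L B := by
  unfold precMoment; positivity

theorem CovBounds.le_diag (hC : CovBounds S L B) (j : Fin p) : L ≤ S j j := by
  have h := hC.quadratic_ge (Pi.single j 1)
  rw [single_quadratic, Finset.sum_eq_single j] at h
  · simpa using h
  · intro k _ hk; simp [hk]
  · simp

/-- The fourth moment of `1 / τ̂²` grows at most polynomially in the sample size. -/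
theorem lintegral_one_div_tauSq_pow_le (hC : CovBounds S L B) (hn : 16 ≤ n)
    (hp : p ≤ Real.exp (3 * n / 32)) {j : Fin p} {lam : ℝ} (hlam : 0 < lam)
    (hlam2 : 1 / lam ^ 2 ≤ 2 * n) {γ : Design n p → {k : Fin p // k ≠ j} → ℝ}
    (h : ∀ X, IsNodewise lam X j (γ X)) :
    ∫⁻ X, ENNReal.ofReal ((1 / tauSq lam X j (γ X)) ^ 4) ∂designLaw n S
      ≤ ENNReal.ofReal (precMoment L B * n ^ 4) := by
  have hB : 0 < B := by linarith [hC.one_le]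
  have hL := hC.pos
  set c : ℝ := 128 * n ^ 4 * (24 * Real.exp 2 * B ^ 4) with hc
  have hc0 : 0 ≤ c := by positivity
  have hpt : ∀ X : Design n p, ENNReal.ofReal ((1 / tauSq lam X j (γ X)) ^ 4) ≤
      ENNReal.ofReal 5000 * ENNReal.ofReal (1 / empSq (col X j) ^ 4) + ENNReal.ofReal c *
        (1 + ∑ k, ENNReal.ofReal (Real.exp (-(n / 4))) *
          ENNReal.ofReal (Real.exp (1 / (8 * B) * (n * empSq (col X k))))) := by
    intro X
    have h1 := one_div_tauSq_pow_le hlam (h X) hB (by omega)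
    have h2 : 8 * (1 / lam ^ 2) ^ 4 * (24 * Real.exp 2 * B ^ 4) ≤ c := by
      calc 8 * (1 / lam ^ 2) ^ 4 * (24 * Real.exp 2 * B ^ 4)
          ≤ 8 * (2 * n) ^ 4 * (24 * Real.exp 2 * B ^ 4) := by gcongr
        _ = c := by rw [hc]; ring
    have h3 : ∀ k, ENNReal.ofReal (Real.exp (-(n / 4))) *
          ENNReal.ofReal (Real.exp (1 / (8 * B) * (n * empSq (col X k))))
        = ENNReal.ofReal (Real.exp (1 / (8 * B) * (n * empSq (col X k)) - n / 4)) := by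
      intro k
      rw [← ENNReal.ofReal_mul (by positivity), ← Real.exp_add]
      congr 2; ring
    simp_rw [h3]
    rw [← ENNReal.ofReal_sum_of_nonneg (fun _ _ => by positivity), ← ENNReal.ofReal_one,
      ← ENNReal.ofReal_add (by positivity) (by positivity), ← ENNReal.ofReal_mul (by positivity),
      ← ENNReal.ofReal_mul hc0, ← ENNReal.ofReal_add (by positivity) (by positivity)]
    apply ENNReal.ofReal_le_ofReal
    refine h1.trans ?_
    gcongr
  refine (lintegral_mono hpt).trans ?_
  have hv : ∀ k, ((Pi.single k 1 : Fin p → ℝ) ⬝ᵥ S *ᵥ Pi.single k 1).toNNReal = (S k k).toNNReal :=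
    fun k => by rw [single_quadratic]
  have hSk : ∀ k, (((S k k).toNNReal : ℝ≥0) : ℝ) = S k k := fun k =>
    Real.coe_toNNReal _ (hL.le.trans (hC.le_diag k))
  rw [lintegral_add_left (by fun_prop), lintegral_const_mul _ (by fun_prop),
    lintegral_const_mul _ (by fun_prop), lintegral_add_left measurable_const,
    lintegral_finsetSum _ (fun k _ => by fun_prop)]
  have hone : ∫⁻ X, ENNReal.ofReal (1 / empSq (col X j) ^ 4) ∂designLaw n S
      ≤ ENNReal.ofReal (n ^ 4 * (1 + 4 / √L) ^ 16) := by
    simp_rw [empSq_col_eq]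
    refine lintegral_inv_mean_sq_pow_le (measurable_rowFunctional _)
      (map_rowFunctional hC.posDef.posSemidef _) hL ?_ hn
    rw [hv, hSk]; exact hC.le_diag j
  have hexp : ∀ k, ∫⁻ X, ENNReal.ofReal (Real.exp (-(n / 4))) *
      ENNReal.ofReal (Real.exp (1 / (8 * B) * (n * empSq (col X k)))) ∂designLaw n S
      ≤ ENNReal.ofReal (Real.exp (-(3 * n / 32))) := by
    intro k
    rw [lintegral_const_mul _ (by fun_prop)]
    have hn0 : (0 : ℝ) < n := by exact_mod_cast (by omega : 0 < n)
    have e : ∀ X : Design n p, (n : ℝ) * empSq (col X k)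
        = ∑ i, (∑ l, X i l * (Pi.single k 1 : Fin p → ℝ) l) ^ 2 := by
      intro X; rw [empSq_col_eq]; field_simp
    simp_rw [e]
    have hx : 1 / (8 * B) * S k k ≤ 1 / 8 := by
      calc 1 / (8 * B) * S k k ≤ 1 / (8 * B) * B := by gcongr; exact hC.diag_le k
        _ = 1 / 8 := by field_simp
    have hx0 : 0 ≤ 1 / (8 * B) * S k k := by
      have := hL.le.trans (hC.le_diag k); positivity
    calc _ ≤ ENNReal.ofReal (Real.exp (-(n / 4))) * ENNReal.ofReal (Real.exp
          (n * (1 / (8 * B) * S k k + 2 * (1 / (8 * B) * S k k) ^ 2))) := by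
          gcongr
          have := lintegral_exp_sum_sq_le (n := n) (t := 1 / (8 * B)) (measurable_rowFunctional _)
            (map_rowFunctional hC.posDef.posSemidef (Pi.single k 1))
            (by rw [hv, hSk, abs_of_nonneg hx0]; linarith)
          rwa [hv, hSk] at this
      _ ≤ _ := by
          rw [← ENNReal.ofReal_mul (by positivity), ← Real.exp_add]
          apply ENNReal.ofReal_le_ofReal
          apply Real.exp_le_exp.2
          have : 1 / (8 * B) * S k k + 2 * (1 / (8 * B) * S k k) ^ 2 ≤ 5 / 32 := by nlinarith
          nlinarith
  have hsum : ∑ k, ∫⁻ X, ENNReal.ofReal (Real.exp (-(n / 4))) *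
      ENNReal.ofReal (Real.exp (1 / (8 * B) * (n * empSq (col X k)))) ∂designLaw n S ≤ 1 := by
    refine (Finset.sum_le_sum fun k _ => hexp k).trans ?_
    rw [Finset.sum_const, Finset.card_univ, Fintype.card_fin, nsmul_eq_mul,
      ← ENNReal.ofReal_natCast, ← ENNReal.ofReal_mul (by positivity), ← ENNReal.ofReal_one]
    apply ENNReal.ofReal_le_ofReal
    calc (p : ℝ) * Real.exp (-(3 * n / 32)) ≤ Real.exp (3 * n / 32) * Real.exp (-(3 * n / 32)) := by
          gcongr
      _ = 1 := by rw [← Real.exp_add]; simp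
  calc _ ≤ ENNReal.ofReal 5000 * ENNReal.ofReal (n ^ 4 * (1 + 4 / √L) ^ 16)
        + ENNReal.ofReal c * (1 + 1) := by
        gcongr
        simp
    _ = _ := by
        rw [show (1 + 1 : ℝ≥0∞) = ENNReal.ofReal 2 by norm_num,
          ← ENNReal.ofReal_mul (by norm_num), ← ENNReal.ofReal_mul hc0,
          ← ENNReal.ofReal_add (by positivity) (by positivity), precMoment, hc]
        congr 1; ring

theorem lintegral_empSq_noise_pow_le (hn : 1 ≤ n) :
    ∫⁻ e, ENNReal.ofReal (empSq e ^ 4) ∂noiseLaw n ≤ ENNReal.ofReal 18432 := by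
  have h := lintegral_mean_sq_pow_le (n := n) (μ := gaussianReal 0 1) (φ := id) (v := 1)
    measurable_id Measure.map_id one_pos (by simp) hn 4
  refine h.trans (ENNReal.ofReal_le_ofReal ?_)
  have := Real.exp_one_lt_d9
  norm_num [Nat.factorial]
  linarith

theorem lintegral_empSq_precCol_sq_le (hC : CovBounds S L B) (hn : 1 ≤ n) (j : Fin p) :
    ∫⁻ X, ENNReal.ofReal (empSq (lin X (precCol S j)) ^ 2) ∂designLaw n S
      ≤ ENNReal.ofReal (96 * B ^ 2) := by
  have hB : 0 < B := by linarith [hC.one_le]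
  have hq : precCol S j ⬝ᵥ S *ᵥ precCol S j ≤ B := by
    rw [precCol_quadratic hC.posDef]
    exact (precision_diag_le hC.posDef hC.pos hC.eigenvalues j).trans hC.inv_le
  have h := lintegral_mean_sq_pow_le (n := n) (measurable_rowFunctional (precCol S j))
    (map_rowFunctional hC.posDef.posSemidef (precCol S j)) hB
    (by rw [Real.coe_toNNReal']; exact max_le hq hB.le) hn 2
  refine h.trans (ENNReal.ofReal_le_ofReal ?_)
  have := Real.exp_one_lt_d9
  norm_num [Nat.factorial, mul_pow]
  nlinarith [sq_nonneg B]

end Moments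

/-! ### The remainder of the de-sparsified Lasso -/

section Remainder

variable {n p : ℕ} {S : Matrix (Fin p) (Fin p) ℝ} {L B t : ℝ}

@[fun_prop]
theorem Measurable.nodeVec {α : Type*} [MeasurableSpace α] {j : Fin p}
    {γ : α → {k : Fin p // k ≠ j} → ℝ} (hγ : Measurable γ) :
    Measurable fun a => nodeVec j (γ a) := by
  refine measurable_pi_lambda _ fun k => ?_
  by_cases h : k = j
  · simp [HDLinear.nodeVec, h]
  · simp only [HDLinear.nodeVec, h, dite_false]
    fun_prop

@[fun_prop]
theorem Measurable.lin {α : Type*} [MeasurableSpace α] {X : α → Design n p} {v : α → Fin p → ℝ}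
    (hX : Measurable X) (hv : Measurable v) : Measurable fun a => lin (X a) (v a) := by
  unfold HDLinear.lin; fun_prop

@[fun_prop]
theorem Measurable.tauSq {α : Type*} [MeasurableSpace α] {X : α → Design n p} {j : Fin p}
    {γ : α → {k : Fin p // k ≠ j} → ℝ} {lam : ℝ} (hX : Measurable X) (hγ : Measurable γ) :
    Measurable fun a => tauSq lam (X a) j (γ a) := by
  simp only [tauSq_eq]; fun_prop

@[fun_prop]
theorem Measurable.thetaCol {α : Type*} [MeasurableSpace α] {X : α → Design n p} {j : Fin p}
    {γ : α → {k : Fin p // k ≠ j} → ℝ} {lam : ℝ} (hX : Measurable X) (hγ : Measurable γ) :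
    Measurable fun a => thetaCol lam (X a) j (γ a) := by
  refine measurable_pi_lambda _ fun k => ?_
  simp only [HDLinear.thetaCol, Pi.smul_apply, smul_eq_mul]
  have h1 : Measurable fun a => HDLinear.tauSq lam (X a) j (γ a) := by fun_prop
  have h2 : Measurable fun a => HDLinear.nodeVec j (γ a) k :=
    (measurable_pi_apply k).comp (Measurable.nodeVec hγ)
  exact (h1.const_div 1).mul h2

/-- Mean square error, in the empirical norm, of a column of the nodewise Lasso estimator. -/
theorem lintegral_thetaCol_error_le (hC : CovBounds S L B) (hn : 16 ≤ n)
    (hp : p ≤ Real.exp (3 * n / 32)) {j : Fin p} {lam : ℝ} (hlam : 0 < lam)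
    (hlam2 : 1 / lam ^ 2 ≤ 2 * n) {γ : Design n p → {k : Fin p // k ≠ j} → ℝ}
    (h : ∀ X, IsNodewise lam X j (γ X)) (ht : 0 ≤ t) (htB : t ≤ B) {E P : ℝ} (hE0 : 0 ≤ E)
    (hE : ∀ X, DesignRegular S t X → empSq (lin X (popVec S j - nodeVec j (γ X))) ≤ E)
    (hsmall : B * t + √(2 * B * E) ≤ L / 2) (hP0 : 0 ≤ P)
    (hP : designLaw n S {X | ¬DesignRegular S t X} ≤ ENNReal.ofReal P) :
    ∫⁻ X, ENNReal.ofReal (empSq (lin X (thetaCol lam X j (γ X) - precCol S j))) ∂designLaw n S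
      ≤ ENNReal.ofReal ((2 * E / L ^ 2 + 4 * (B * t + √(2 * B * E)) ^ 2 / L ^ 3)
        + n ^ 6 * P + (8 + 8 * precMoment L B + 768 * B ^ 2) / n ^ 2) := by
  have hL := hC.pos
  have hB := hC.one_le
  have hn1 : (1 : ℝ) ≤ n := by exact_mod_cast (by omega : 1 ≤ n)
  have hPM := precMoment_nonneg L B
  set α := 2 * E / L ^ 2 + 4 * (B * t + √(2 * B * E)) ^ 2 / L ^ 3 with hα
  have hα0 : 0 ≤ α := by positivity
  set Ψ : Design n p → ℝ := fun X =>
    2 * (1 / tauSq lam X j (γ X)) + 2 * empSq (lin X (precCol S j)) with hΨ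
  have h1 := lintegral_le_of_le_on (designLaw n S)
    (f := fun X => empSq (lin X (thetaCol lam X j (γ X) - precCol S j))) (Ψ := Ψ)
    (G := {X | DesignRegular S t X}) (a := α) (s := n ^ 6) (by positivity)
    (fun X hX => (hC.thetaCol_error hX ht htB hlam.le (h X) (hE X hX) hsmall).2)
    (fun X => by
      rw [lin_sub]
      refine (empSq_sub_le _ _).trans ?_
      have := empSq_thetaCol_le (X := X) (γ := γ X) hlam.le
      simp only [hΨ]; linarith)
  refine h1.trans ?_
  have h2 : ∫⁻ X, ENNReal.ofReal (Ψ X ^ 2) ∂designLaw n S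
      ≤ ENNReal.ofReal ((8 + 8 * precMoment L B + 768 * B ^ 2) * n ^ 4) := by
    have hpt : ∀ X, ENNReal.ofReal (Ψ X ^ 2) ≤ (ENNReal.ofReal 8 + ENNReal.ofReal 8 *
        ENNReal.ofReal (empSq (lin X (precCol S j)) ^ 2)) +
        ENNReal.ofReal 8 * ENNReal.ofReal ((1 / tauSq lam X j (γ X)) ^ 4) := by
      intro X
      rw [← ENNReal.ofReal_mul (by norm_num), ← ENNReal.ofReal_mul (by norm_num),
        ← ENNReal.ofReal_add (by norm_num) (by positivity),
        ← ENNReal.ofReal_add (by positivity) (by positivity)]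
      apply ENNReal.ofReal_le_ofReal
      simp only [hΨ]
      set F := 1 / tauSq lam X j (γ X)
      set Q := empSq (lin X (precCol S j))
      nlinarith [sq_nonneg (F - Q), sq_nonneg (F ^ 2 - 1)]
    refine (lintegral_mono hpt).trans ?_
    rw [lintegral_add_left (by fun_prop), lintegral_add_left measurable_const,
      lintegral_const_mul _ (by fun_prop), lintegral_const_mul' _ _ (by simp)]
    calc _ ≤ (ENNReal.ofReal 8 + ENNReal.ofReal 8 * ENNReal.ofReal (96 * B ^ 2)) +
          ENNReal.ofReal 8 * ENNReal.ofReal (precMoment L B * n ^ 4) := by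
          gcongr
          · simp
          · exact lintegral_empSq_precCol_sq_le hC (by omega) j
          · exact lintegral_one_div_tauSq_pow_le hC hn hp hlam hlam2 h
      _ ≤ _ := by
          rw [← ENNReal.ofReal_mul (by norm_num), ← ENNReal.ofReal_mul (by norm_num),
            ← ENNReal.ofReal_add (by norm_num) (by positivity),
            ← ENNReal.ofReal_add (by positivity) (by positivity)]
          apply ENNReal.ofReal_le_ofReal
          have : (1 : ℝ) ≤ n ^ 4 := one_le_pow₀ hn1
          nlinarith [sq_nonneg B]
  calc _ ≤ ENNReal.ofReal α + ENNReal.ofReal (n ^ 6) * ENNReal.ofReal P + ENNReal.ofReal (1 / n ^ 6)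
        * ENNReal.ofReal ((8 + 8 * precMoment L B + 768 * B ^ 2) * n ^ 4) := by
        gcongr
        exact hP
    _ = _ := by
        rw [← ENNReal.ofReal_mul (by positivity), ← ENNReal.ofReal_mul (by positivity),
          ← ENNReal.ofReal_add hα0 (by positivity),
          ← ENNReal.ofReal_add (by positivity) (by positivity)]
        congr 2
        field_simp

/-- The square of the bound of `bias_sq_le_crude`, with the crude bounds for the Lasso inserted.
Here `F`, `W`, `b1` and `N` stand for `1 / τ̂²`, `‖ε‖ₙ²`, `‖β‖₁` and the sample size, while `a` and
`e` are the `ℓ₁`-error and the prediction error of the Lasso. -/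
theorem crude_bound_sq_le {F a e W b1 lam N C : ℝ} (hlam : 0 < lam) (hlam1 : lam ≤ 1)
    (hlam2 : 1 / lam ^ 2 ≤ 2 * N) (hb1 : 0 ≤ b1) (hb : b1 ^ 2 ≤ C ^ 2 * N)
    (hW : 0 ≤ W) (ha0 : 0 ≤ a) (he0 : 0 ≤ e) (ha : a ≤ W / (2 * lam) + 2 * b1)
    (he : e ≤ 4 * W + 4 * lam * b1) :
    (2 * a ^ 2 + 2 * (F * e)) ^ 2
      ≤ (16 * N ^ 2 + 8192) * W ^ 4 + 9216 * C ^ 4 * N ^ 2 + 4 * F ^ 4 := by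
  have hpow : ∀ x y : ℝ, 0 ≤ x → 0 ≤ y → (x + y) ^ 4 ≤ 8 * (x ^ 4 + y ^ 4) := by
    intro x y hx hy
    have := add_pow_le hx hy 4
    norm_num at this
    exact this
  have hb4 : b1 ^ 4 ≤ C ^ 4 * N ^ 2 := by
    calc b1 ^ 4 = (b1 ^ 2) ^ 2 := by ring
      _ ≤ (C ^ 2 * N) ^ 2 := by gcongr
      _ = _ := by ring
  have h1 : a ^ 4 ≤ 2 * N ^ 2 * W ^ 4 + 128 * b1 ^ 4 := by
    calc a ^ 4 ≤ (W / (2 * lam) + 2 * b1) ^ 4 := by gcongr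
      _ ≤ 8 * ((W / (2 * lam)) ^ 4 + (2 * b1) ^ 4) := hpow _ _ (by positivity) (by positivity)
      _ = (1 / lam ^ 2) ^ 2 * W ^ 4 / 2 + 128 * b1 ^ 4 := by field_simp; ring
      _ ≤ (2 * N) ^ 2 * W ^ 4 / 2 + 128 * b1 ^ 4 := by gcongr
      _ = _ := by ring
  have h2 : e ^ 4 ≤ 2048 * (W ^ 4 + b1 ^ 4) := by
    have : lam * b1 ≤ b1 := by nlinarith
    calc e ^ 4 ≤ (4 * W + 4 * b1) ^ 4 := by gcongr; linarith
      _ ≤ 8 * ((4 * W) ^ 4 + (4 * b1) ^ 4) := hpow _ _ (by positivity) (by positivity)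
      _ = _ := by ring
  have h3 : (2 * a ^ 2 + 2 * (F * e)) ^ 2 ≤ 8 * a ^ 4 + 4 * F ^ 4 + 4 * e ^ 4 := by
    nlinarith [sq_nonneg (a ^ 2 - F * e), sq_nonneg (F ^ 2 - e ^ 2)]
  nlinarith

/-- The bias term of the `j`-th coordinate of the de-sparsified Lasso `b̂`: the `j`-th entry of
`(I - Θ̂ᵀ Xᵀ X / n) (β̂ - β)`. -/
def biasTerm {j : Fin p} (lamN : ℝ) (γ : Design n p → {k : Fin p // k ≠ j} → ℝ)
    (b : Data n p → Coef p) (β : Coef p) (z : Design n p × (Fin n → ℝ)) : ℝ :=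
  (b (observe β z) j - β j) - empInner (lin z.1 (thetaCol lamN z.1 j (γ z.1)))
    (lin z.1 ((b (observe β z)).ofLp - β.ofLp))

theorem measurable_biasTerm {j : Fin p} {lamN : ℝ} {γ : Design n p → {k : Fin p // k ≠ j} → ℝ}
    {b : Data n p → Coef p} (hγ : Measurable γ) (hb : Measurable b) (β : Coef p) :
    Measurable (biasTerm lamN γ b β) := by
  have h1 : Measurable fun z : Design n p × (Fin n → ℝ) => b (observe β z) :=
    hb.comp (measurable_observe β)
  have h2 : Measurable fun z : Design n p × (Fin n → ℝ) => (b (observe β z)).ofLp :=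
    (by fun_prop : Measurable fun x : Coef p => x.ofLp).comp h1
  have h3 : Measurable fun z : Design n p × (Fin n → ℝ) =>
      lin z.1 (thetaCol lamN z.1 j (γ z.1)) :=
    Measurable.lin measurable_fst (Measurable.thetaCol measurable_fst (hγ.comp measurable_fst))
  exact (((measurable_pi_apply j).comp h2).sub_const _).sub
    (Measurable.empInner h3 (Measurable.lin measurable_fst (h2.sub_const _)))

theorem measurable_lin_thetaCol_sub {j : Fin p} {lamN : ℝ}
    {γ : Design n p → {k : Fin p // k ≠ j} → ℝ} (hγ : Measurable γ) (v : Fin p → ℝ) :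
    Measurable fun X : Design n p => lin X (thetaCol lamN X j (γ X) - v) :=
  Measurable.lin measurable_id ((Measurable.thetaCol measurable_id hγ).sub_const _)

/-- Mean square of the bias term of the de-sparsified Lasso. -/
theorem lintegral_bias_sq_le (hC : CovBounds S L B) (hn : 16 ≤ n)
    (hp : p ≤ Real.exp (3 * n / 32)) {j : Fin p} {lamN : ℝ} (hlamN : 0 < lamN)
    (hlamN2 : 1 / lamN ^ 2 ≤ 2 * n) {γ : Design n p → {k : Fin p // k ≠ j} → ℝ}
    (hγm : Measurable γ) (h : ∀ X, IsNodewise lamN X j (γ X)) {lam : ℝ} (hlam : 0 < lam)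
    (hlam1 : lam ≤ 1) (hlam2 : 1 / lam ^ 2 ≤ 2 * n) {b : Data n p → Coef p}
    (hb : ∀ D, IsLasso lam D (b D)) {β : Coef p} {C : ℝ} (hβ : (∑ k, |β k|) ^ 2 ≤ C ^ 2 * n)
    {G Λ P : ℝ} (hΛ : lamN ≤ Λ)
    (hτ : ∀ X, DesignRegular S t X → L / 2 ≤ tauSq lamN X j (γ X))
    (hG : ∀ z : Design n p × (Fin n → ℝ), DesignRegular S t z.1 → NoiseRegular t z.1 z.2 →
      ∑ k, |b (observe β z) k - β k| ≤ G)
    (hP0 : 0 ≤ P)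
    (hP : baseLaw n S {z | ¬(DesignRegular S t z.1 ∧ NoiseRegular t z.1 z.2)} ≤ ENNReal.ofReal P) :
    ∫⁻ z, ENNReal.ofReal (biasTerm lamN γ b β z ^ 2) ∂baseLaw n S
      ≤ ENNReal.ofReal ((2 / L * Λ * G) ^ 2
        + n ^ 6 * P + (160000000 + 9216 * C ^ 4 + 4 * precMoment L B) / n ^ 2) := by
  have hL := hC.pos
  have hn1 : (1 : ℝ) ≤ n := by exact_mod_cast (by omega : 1 ≤ n)
  have hPM := precMoment_nonneg L B
  set δ : Design n p × (Fin n → ℝ) → Fin p → ℝ := fun z => (b (observe β z)).ofLp - β.ofLp with hδ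
  set Ψ : Design n p × (Fin n → ℝ) → ℝ := fun z => 2 * (∑ k, |δ z k|) ^ 2 +
    2 * (1 / tauSq lamN z.1 j (γ z.1) * empSq (lin z.1 (δ z))) with hΨ
  have h1 := lintegral_le_of_le_on (baseLaw n S)
    (f := fun z => (δ z j - empInner (lin z.1 (thetaCol lamN z.1 j (γ z.1))) (lin z.1 (δ z))) ^ 2)
    (Ψ := Ψ) (G := {z | DesignRegular S t z.1 ∧ NoiseRegular t z.1 z.2})
    (a := (2 / L * Λ * G) ^ 2) (s := n ^ 6) (by positivity)
    (fun z hz => by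
      have h2 := abs_bias_le hlamN.le (h z.1) hL (hτ z.1 hz.1) (δ z)
      rw [← sq_abs]
      gcongr
      refine h2.trans ?_
      have h3 : ∑ k, |δ z k| ≤ G := hG z hz.1 hz.2
      have hΛ0 : 0 ≤ Λ := hlamN.le.trans hΛ
      gcongr)
    (fun z => bias_sq_le_crude hlamN.le (δ z))
  refine h1.trans ?_
  have h2 : ∫⁻ z, ENNReal.ofReal (Ψ z ^ 2) ∂baseLaw n S
      ≤ ENNReal.ofReal ((160000000 + 9216 * C ^ 4 + 4 * precMoment L B) * n ^ 4) := by
    have hpt : ∀ z : Design n p × (Fin n → ℝ), ENNReal.ofReal (Ψ z ^ 2) ≤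
        (ENNReal.ofReal (16 * n ^ 2 + 8192) * ENNReal.ofReal (empSq z.2 ^ 4)
          + ENNReal.ofReal (9216 * C ^ 4 * n ^ 2))
        + ENNReal.ofReal 4 * ENNReal.ofReal ((1 / tauSq lamN z.1 j (γ z.1)) ^ 4) := by
      intro z
      rw [← ENNReal.ofReal_mul (by positivity), ← ENNReal.ofReal_mul (by norm_num),
        ← ENNReal.ofReal_add (by positivity) (by positivity),
        ← ENNReal.ofReal_add (by positivity) (by positivity)]
      apply ENNReal.ofReal_le_ofReal
      exact crude_bound_sq_le hlam hlam1 hlam2 (by positivity) hβ (empSq_nonneg _) (by positivity)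
        (empSq_nonneg _) (lasso_l1_crude hlam (hb (observe β z)))
        (lasso_prediction_crude hlam (hb (observe β z)))
    refine (lintegral_mono hpt).trans ?_
    have hm1 : Measurable fun e : Fin n → ℝ => ENNReal.ofReal (empSq e ^ 4) := by fun_prop
    have hm2 : Measurable fun X : Design n p =>
        ENNReal.ofReal ((1 / tauSq lamN X j (γ X)) ^ 4) := by
      have : Measurable fun X : Design n p => tauSq lamN X j (γ X) := by fun_prop
      fun_prop
    rw [lintegral_add_left (by fun_prop), lintegral_add_left (by fun_prop),
      lintegral_const_mul _ (by fun_prop), lintegral_const_mul' _ _ (by simp)]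
    have e1 : ∫⁻ z : Design n p × (Fin n → ℝ), ENNReal.ofReal (empSq z.2 ^ 4) ∂baseLaw n S
        = ∫⁻ e, ENNReal.ofReal (empSq e ^ 4) ∂noiseLaw n :=
      measurePreserving_snd.lintegral_comp hm1
    have e2 : ∫⁻ z : Design n p × (Fin n → ℝ),
        ENNReal.ofReal ((1 / tauSq lamN z.1 j (γ z.1)) ^ 4) ∂baseLaw n S
        = ∫⁻ X, ENNReal.ofReal ((1 / tauSq lamN X j (γ X)) ^ 4) ∂designLaw n S :=
      measurePreserving_fst.lintegral_comp hm2
    rw [e1, e2]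
    calc _ ≤ (ENNReal.ofReal (16 * n ^ 2 + 8192) * ENNReal.ofReal 18432
          + ENNReal.ofReal (9216 * C ^ 4 * n ^ 2))
          + ENNReal.ofReal 4 * ENNReal.ofReal (precMoment L B * n ^ 4) := by
          gcongr
          · exact lintegral_empSq_noise_pow_le (by omega)
          · simp
          · exact lintegral_one_div_tauSq_pow_le hC hn hp hlamN hlamN2 h
      _ ≤ _ := by
          rw [← ENNReal.ofReal_mul (by positivity), ← ENNReal.ofReal_mul (by norm_num),
            ← ENNReal.ofReal_add (by positivity) (by positivity),
            ← ENNReal.ofReal_add (by positivity) (by positivity)]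
          apply ENNReal.ofReal_le_ofReal
          have h4 : (n : ℝ) ^ 2 ≤ n ^ 4 := pow_le_pow_right₀ hn1 (by norm_num)
          have h5 : (1 : ℝ) ≤ n ^ 4 := one_le_pow₀ hn1
          have h6 : C ^ 4 * n ^ 2 ≤ C ^ 4 * n ^ 4 := by gcongr
          nlinarith
  calc _ ≤ ENNReal.ofReal ((2 / L * Λ * G) ^ 2) + ENNReal.ofReal (n ^ 6) * ENNReal.ofReal P
        + ENNReal.ofReal (1 / n ^ 6)
        * ENNReal.ofReal ((160000000 + 9216 * C ^ 4 + 4 * precMoment L B) * n ^ 4) := by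
        gcongr
        exact hP
    _ = _ := by
        rw [← ENNReal.ofReal_mul (by positivity), ← ENNReal.ofReal_mul (by positivity),
          ← ENNReal.ofReal_add (by positivity) (by positivity),
          ← ENNReal.ofReal_add (by positivity) (by positivity)]
        congr 2
        field_simp

/-- The difference between the de-sparsified Lasso estimation error and its linearization
`ξᵀ S⁻¹ Xᵀ ε / n`. -/
def remainder (S : Matrix (Fin p) (Fin p) ℝ) (ξ lamN : Fin p → ℝ)
    (γ : Design n p → ∀ j : Fin p, {k : Fin p // k ≠ j} → ℝ) (b : Data n p → Coef p) (β : Coef p)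
    (z : Design n p × (Fin n → ℝ)) : ℝ :=
  ξ ⬝ᵥ desparsified (thetaHat lamN z.1 (γ z.1)) (observe β z) (b (observe β z))
    - ∑ j, ξ j * β j - empInner (lin z.1 (S⁻¹ *ᵥ ξ)) z.2

theorem thetaHat_col (lamN : Fin p → ℝ) (X : Design n p)
    (γ : ∀ j : Fin p, {k : Fin p // k ≠ j} → ℝ) (j : Fin p) :
    (fun k => thetaHat lamN X γ k j) = thetaCol (lamN j) X j (γ j) := by
  ext k
  simp only [thetaHat, Matrix.of_apply, thetaCol, nodeVec, Pi.smul_apply, smul_eq_mul]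
  ring

theorem desparsified_eq (lamN : Fin p → ℝ) (D : Data n p)
    (γ : ∀ j : Fin p, {k : Fin p // k ≠ j} → ℝ) (b : Coef p) (j : Fin p) :
    desparsified (thetaHat lamN D.1 γ) D b j
      = b j + empInner (D.2 - lin D.1 b.ofLp) (lin D.1 (thetaCol (lamN j) D.1 j (γ j))) := by
  rw [desparsified, empInner_lin]
  congr 1
  rw [Matrix.mulVec, dotProduct, Finset.sum_div]
  refine Finset.sum_congr rfl fun k _ => ?_
  rw [← thetaHat_col, Matrix.transpose_apply, mul_div_assoc]
  congr 2
  refine Finset.sum_congr rfl fun i _ => ?_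
  simp [col, fit_eq_lin, mul_comm]

theorem empInner_lin_inv_mulVec (X : Design n p) (ξ : Fin p → ℝ) (e : Fin n → ℝ) :
    empInner (lin X (S⁻¹ *ᵥ ξ)) e = ∑ j, ξ j * empInner (lin X (precCol S j)) e := by
  have h1 : lin X (S⁻¹ *ᵥ ξ) = fun i => ∑ j, ξ j * lin X (precCol S j) i := by
    ext i
    simp only [lin, Matrix.mulVec, dotProduct, precCol, Finset.mul_sum]
    rw [Finset.sum_comm]
    exact Finset.sum_congr rfl fun j _ => Finset.sum_congr rfl fun k _ => by ring
  simp only [empInner, h1]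
  simp only [Finset.sum_mul, ← mul_div_assoc, Finset.mul_sum]
  rw [Finset.sum_comm, Finset.sum_div]
  exact Finset.sum_congr rfl fun j _ => by
    congr 1
    exact Finset.sum_congr rfl fun i _ => by ring

/-- The remainder consists of the bias, coming from the error of `β̂`, and of a noise term coming
from the error of `Θ̂`. -/
theorem remainder_eq (ξ lamN : Fin p → ℝ)
    (γ : Design n p → ∀ j : Fin p, {k : Fin p // k ≠ j} → ℝ) (b : Data n p → Coef p) (β : Coef p)
    (z : Design n p × (Fin n → ℝ)) :
    remainder S ξ lamN γ b β z = ∑ j, ξ j * (biasTerm (lamN j) (fun X => γ X j) b β z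
      + empInner (lin z.1 (thetaCol (lamN j) z.1 j (γ z.1 j) - precCol S j)) z.2) := by
  rw [remainder, empInner_lin_inv_mulVec, dotProduct, ← Finset.sum_sub_distrib,
    ← Finset.sum_sub_distrib]
  refine Finset.sum_congr rfl fun j _ => ?_
  have h1 := desparsified_eq lamN (observe β z) (γ z.1) (b (observe β z)) j
  have h2 : (observe β z).2 - lin (observe β z).1 (b (observe β z)).ofLp
      = z.2 - lin z.1 ((b (observe β z)).ofLp - β.ofLp) := by
    rw [lin_sub]; ext i; simp [observe, fit_eq_lin]; ring
  rw [h2] at h1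
  change desparsified (thetaHat lamN z.1 (γ z.1)) (observe β z) (b (observe β z)) j = _ at h1
  rw [h1, empInner_sub_left, lin_sub z.1 (thetaCol _ _ _ _), empInner_sub_left,
    empInner_comm z.2, empInner_comm (lin z.1 (_ - _))]
  simp only [observe, biasTerm]
  ring

theorem sum_mul_sq_le {ι : Type*} (s : Finset ι) (ξ x : ι → ℝ) :
    (∑ j ∈ s, ξ j * x j) ^ 2 ≤ (∑ j ∈ s, |ξ j|) * ∑ j ∈ s, |ξ j| * x j ^ 2 := by
  refine Finset.sum_sq_le_sum_mul_sum_of_sq_le_mul s (fun j _ => abs_nonneg _)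
    (fun j _ => by positivity) fun j _ => ?_
  rw [mul_pow, ← sq_abs (ξ j)]
  exact le_of_eq (by ring)

/-- The Cauchy–Schwarz inequality with weights `|ξ_j|` reduces the mean square of the remainder to
bounds for single coordinates. The noise term gains a factor `1 / n` since the noise is independent
of the design. -/
theorem lintegral_remainder_sq_le {ξ lamN : Fin p → ℝ}
    {γ : Design n p → ∀ j : Fin p, {k : Fin p // k ≠ j} → ℝ} {b : Data n p → Coef p} {β : Coef p}
    (hγ : Measurable γ) (hb : Measurable b) {a1 a2 A : ℝ} (ha1 : 0 ≤ a1) (ha2 : 0 ≤ a2)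
    (hA : ∑ j, |ξ j| ≤ A)
    (h1 : ∀ j, ∫⁻ X, ENNReal.ofReal
      (empSq (lin X (thetaCol (lamN j) X j (γ X j) - precCol S j))) ∂designLaw n S
        ≤ ENNReal.ofReal a1)
    (h2 : ∀ j, ∫⁻ z, ENNReal.ofReal
      (biasTerm (lamN j) (fun X => γ X j) b β z ^ 2) ∂baseLaw n S ≤ ENNReal.ofReal a2) :
    ∫⁻ z, ENNReal.ofReal (remainder S ξ lamN γ b β z ^ 2) ∂baseLaw n S
      ≤ ENNReal.ofReal (2 * A ^ 2 * (a1 / n + a2)) := by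
  have hA0 : 0 ≤ A := le_trans (by positivity) hA
  set Δ : Fin p → Design n p × (Fin n → ℝ) → ℝ := fun j =>
    biasTerm (lamN j) (fun X => γ X j) b β with hΔ
  set N : Fin p → Design n p × (Fin n → ℝ) → ℝ := fun j z =>
    empInner (lin z.1 (thetaCol (lamN j) z.1 j (γ z.1 j) - precCol S j)) z.2 with hN
  have hγj : ∀ j, Measurable fun X => γ X j := fun j => (measurable_pi_apply j).comp hγ
  have hθ2 : ∀ j, Measurable fun X : Design n p =>
      lin X (thetaCol (lamN j) X j (γ X j) - precCol S j) := fun j =>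
    measurable_lin_thetaCol_sub (hγj j) _
  have hNm : ∀ j, Measurable fun z => ENNReal.ofReal (N j z ^ 2) := fun j =>
    ((Measurable.empInner ((hθ2 j).comp measurable_fst)
      measurable_snd).pow_const 2).ennreal_ofReal
  have hΔm : ∀ j, Measurable fun z => ENNReal.ofReal (Δ j z ^ 2) := fun j =>
    ((measurable_biasTerm (hγj j) hb β).pow_const 2).ennreal_ofReal
  have hsm : ∀ j, Measurable fun z =>
      ENNReal.ofReal (Δ j z ^ 2) + ENNReal.ofReal (N j z ^ 2) := fun j => (hΔm j).fun_add (hNm j)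
  have hpt : ∀ z, ENNReal.ofReal (remainder S ξ lamN γ b β z ^ 2) ≤
      ∑ j, ENNReal.ofReal (2 * A * |ξ j|) *
        (ENNReal.ofReal (Δ j z ^ 2) + ENNReal.ofReal (N j z ^ 2)) := by
    intro z
    have e : ∑ j, ENNReal.ofReal (2 * A * |ξ j|) *
        (ENNReal.ofReal (Δ j z ^ 2) + ENNReal.ofReal (N j z ^ 2))
        = ENNReal.ofReal (∑ j, 2 * A * |ξ j| * (Δ j z ^ 2 + N j z ^ 2)) := by
      rw [ENNReal.ofReal_sum_of_nonneg (fun _ _ => by positivity)]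
      refine Finset.sum_congr rfl fun j _ => ?_
      rw [← ENNReal.ofReal_add (by positivity) (by positivity),
        ← ENNReal.ofReal_mul (by positivity)]
    rw [e]
    apply ENNReal.ofReal_le_ofReal
    rw [remainder_eq]
    refine (sum_mul_sq_le Finset.univ ξ fun j => Δ j z + N j z).trans ?_
    calc (∑ j, |ξ j|) * ∑ j, |ξ j| * (Δ j z + N j z) ^ 2
        ≤ A * ∑ j, |ξ j| * (2 * (Δ j z ^ 2 + N j z ^ 2)) := by
          gcongr with j
          exact add_sq_le
      _ = _ := by
          rw [Finset.mul_sum]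
          exact Finset.sum_congr rfl fun j _ => by ring
  refine (lintegral_mono hpt).trans ?_
  rw [lintegral_finsetSum _ (fun j _ => (hsm j).const_mul _)]
  have hj : ∀ j, ∫⁻ z, ENNReal.ofReal (2 * A * |ξ j|) *
      (ENNReal.ofReal (Δ j z ^ 2) + ENNReal.ofReal (N j z ^ 2)) ∂baseLaw n S
      ≤ ENNReal.ofReal (2 * A * |ξ j| * (a2 + 1 / n * a1)) := by
    intro j
    rw [lintegral_const_mul _ (hsm j), lintegral_add_left (hΔm j),
      ENNReal.ofReal_mul (p := 2 * A * |ξ j|) (q := a2 + 1 / n * a1) (by positivity),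
      ENNReal.ofReal_add ha2 (by positivity),
      ENNReal.ofReal_mul (p := 1 / (n : ℝ)) (by positivity)]
    gcongr
    · exact h2 j
    · rw [lintegral_empInner_noise_sq (hθ2 j)]
      gcongr
      exact h1 j
  refine (Finset.sum_le_sum fun j _ => hj j).trans ?_
  rw [← ENNReal.ofReal_sum_of_nonneg (fun _ _ => by positivity)]
  apply ENNReal.ofReal_le_ofReal
  rw [← Finset.sum_mul, ← Finset.mul_sum]
  calc 2 * A * (∑ j, |ξ j|) * (a2 + 1 / n * a1) ≤ 2 * A * A * (a2 + 1 / n * a1) := by gcongr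
    _ = _ := by ring

end Remainder

/-! ### Choice of the concentration level -/

section Level

variable {n p : ℕ} {S : Matrix (Fin p) (Fin p) ℝ} {L B t : ℝ}

/-- The probability that entrywise concentration at level `t` fails. -/
theorem baseLaw_not_regular_le (hC : CovBounds S L B) (hn : 0 < n) (hp : 1 ≤ p) (ht : 0 < t)
    (ht1 : t ≤ 1) :
    baseLaw n S {z | ¬(DesignRegular S t z.1 ∧ NoiseRegular t z.1 z.2)}
      ≤ ENNReal.ofReal (10 * p ^ 2 * Real.exp (-(n * t ^ 2 / (32 * B ^ 2)))) := by
  have h1 := designLaw_not_regular_le (n := n) hC hn ht (ht1.trans hC.one_le)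
  have h2 := baseLaw_not_noiseRegular_le (n := n) hC hn ht ht1
  have h3 : baseLaw n S {z | ¬DesignRegular S t z.1}
      ≤ designLaw n S {X | ¬DesignRegular S t X} := by
    have e : {z : Design n p × (Fin n → ℝ) | ¬DesignRegular S t z.1}
        = {X | ¬DesignRegular S t X} ×ˢ Set.univ := by ext; simp
    rw [e, Measure.prod_prod]; simp
  have hsub : {z : Design n p × (Fin n → ℝ) | ¬(DesignRegular S t z.1 ∧ NoiseRegular t z.1 z.2)} ⊆
      {z | ¬DesignRegular S t z.1} ∪ {z | ¬NoiseRegular t z.1 z.2} := by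
    intro z hz
    simp only [Set.mem_ofPred_eq, Set.mem_union] at hz ⊢
    tauto
  refine (measure_mono hsub).trans ((measure_union_le _ _).trans
    ((add_le_add (h3.trans h1) h2).trans ?_))
  rw [← ENNReal.ofReal_add (by positivity) (by positivity)]
  apply ENNReal.ofReal_le_ofReal
  have hp1 : (1 : ℝ) ≤ p := by exact_mod_cast hp
  have : 2 * (p : ℝ) ≤ 2 * p ^ 2 := by nlinarith
  have he := Real.exp_pos (-(n * t ^ 2 / (32 * B ^ 2)))
  nlinarith

/-- What is needed of a concentration level `t`: the exceptional event is negligible, and off this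
event the nodewise Lasso has prediction error at most `E` and the Lasso has `ℓ₁`-error at most `G`,
for all tuning parameters between `lo` and `hi`. -/
structure GoodLevel (n : ℕ) (S : Matrix (Fin p) (Fin p) ℝ) (d lo hi t E G : ℝ) : Prop where
  pos : 0 < t
  le_one : t ≤ 1
  prob : baseLaw n S {z | ¬(DesignRegular S t z.1 ∧ NoiseRegular t z.1 z.2)}
    ≤ ENNReal.ofReal (10 / n ^ 8)
  nodewise : ∀ X : Design n p, DesignRegular S t X → ∀ (j : Fin p) γ (lam : ℝ), lo ≤ lam →
    lam ≤ hi → IsNodewise lam X j γ → empSq (lin X (popVec S j - nodeVec j γ)) ≤ E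
  lasso : ∀ z : Design n p × (Fin n → ℝ), DesignRegular S t z.1 → NoiseRegular t z.1 z.2 →
    ∀ (β b : Coef p) (lam : ℝ), (sparsity (fun k => β k) : ℝ) ≤ d → lo ≤ lam → lam ≤ hi →
    IsLasso lam (observe β z) b → ∑ k, |b k - β k| ≤ G

/-- In low dimension, `p ≤ u ^ 4 = n ^ (1 / 4)`, the sample covariance matrix is well conditioned
and the size of the noise relative to the penalty plays no role. -/
theorem CovBounds.goodLevel_of_lowdim (hC : CovBounds S L B) {d lo hi κ u : ℝ} (hn : 0 < n)
    (hp : 1 ≤ p) (hu : 0 < u) (hu1 : 1 ≤ u) (hun : u ^ 16 = n) (hpu : p ≤ u ^ 4) (hlo : 0 < lo)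
    (hκ : 0 ≤ κ) (hhi : hi ≤ κ / u ^ 6) (huL : 1 / u ^ 2 ≤ L / 2)
    (hexp : u ^ 136 * Real.exp (-(u ^ 4 / (32 * B ^ 2))) ≤ 1) :
    GoodLevel n S d lo hi (1 / u ^ 6) (8 * (B + κ) ^ 2 / (L * u ^ 8))
      (4 * (1 + κ) / (L * u ^ 2)) := by
  have hL := hC.pos
  have hB := hC.one_le
  have ht : 0 ≤ 1 / u ^ 6 := by positivity
  have hpt : p * (1 / u ^ 6) ≤ L / 2 := by
    refine le_trans ?_ huL
    calc (p : ℝ) * (1 / u ^ 6) ≤ u ^ 4 * (1 / u ^ 6) := by gcongr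
      _ = 1 / u ^ 2 := by field_simp
  have hle1 : 1 / u ^ 6 ≤ 1 := by
    rw [div_le_one (by positivity)]; exact one_le_pow₀ hu1
  refine ⟨by positivity, hle1, ?_, ?_, ?_⟩
  · refine (baseLaw_not_regular_le hC hn hp (by positivity) hle1).trans ?_
    apply ENNReal.ofReal_le_ofReal
    have e : n * (1 / u ^ 6) ^ 2 / (32 * B ^ 2) = u ^ 4 / (32 * B ^ 2) := by
      rw [← hun]; field_simp
    rw [e, ← hun, le_div_iff₀ (by positivity)]
    calc 10 * (p : ℝ) ^ 2 * Real.exp (-(u ^ 4 / (32 * B ^ 2))) * (u ^ 16) ^ 8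
        ≤ 10 * (u ^ 4) ^ 2 * Real.exp (-(u ^ 4 / (32 * B ^ 2))) * (u ^ 16) ^ 8 := by gcongr
      _ = 10 * (u ^ 136 * Real.exp (-(u ^ 4 / (32 * B ^ 2)))) := by ring
      _ ≤ 10 * 1 := by gcongr
      _ = 10 := by norm_num
  · intro X hX j γ lam h1 h2 h3
    have hlam : 0 ≤ lam := hlo.le.trans h1
    refine (hC.nodewise_prediction_le_of_lowdim hX ht h3 hlam hpt).trans ?_
    have hlam2 : lam ≤ κ / u ^ 6 := h2.trans hhi
    calc 8 * p * (B * (1 / u ^ 6) + lam) ^ 2 / L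
        ≤ 8 * u ^ 4 * (B * (1 / u ^ 6) + κ / u ^ 6) ^ 2 / L := by gcongr
      _ = _ := by field_simp
  · intro z hz1 hz2 β b lam _ h1 h2 h3
    have hlam : 0 < lam := hlo.trans_le h1
    refine (hC.lasso_l1_le_of_lowdim hz1 hz2 ht h3 hlam hpt).trans ?_
    have hlam2 : lam ≤ κ / u ^ 6 := h2.trans hhi
    calc 4 * p * (1 / u ^ 6 + lam) / L ≤ 4 * u ^ 4 * (1 / u ^ 6 + κ / u ^ 6) / L := by gcongr
      _ = _ := by field_simp

/-- In high dimension, `n ≤ p ^ 4`, the penalty dominates the noise with probability polynomially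
close to one. The level `33 B r` is at most half the penalty, and as `33² / 32 ≥ 34` the
exceptional event has probability at most `10 p ^ (2 - 34) ≤ 10 / n ^ 8`. -/
theorem CovBounds.goodLevel_of_highdim (hC : CovBounds S L B) {d hi r : ℝ} (hn : 0 < n)
    (hp : 1 ≤ p) (hpn : (n : ℝ) ≤ p ^ 4) (hr : 0 < r) (hrp : n * r ^ 2 = Real.log p)
    (hr1 : 33 * B * r ≤ 1) (hd : ∀ j, (sparsity (precCol S j) : ℝ) ≤ d)
    (hdr : 16 * d * (33 * B * r) ≤ L / 2) :
    GoodLevel n S d (66 * B ^ 2 * r) hi (33 * B * r) (4 * hi * (B ^ 2 * √d)) (96 * d * hi / L) := by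
  have hL := hC.pos
  have hB := hC.one_le
  have ht : 0 ≤ 33 * B * r := by positivity
  have hp0 : (0 : ℝ) < p := by exact_mod_cast hp
  have hn0 : (0 : ℝ) < n := by exact_mod_cast hn
  refine ⟨by positivity, hr1, ?_, ?_, ?_⟩
  · refine (baseLaw_not_regular_le hC hn hp (by positivity) hr1).trans ?_
    apply ENNReal.ofReal_le_ofReal
    have e : n * (33 * B * r) ^ 2 / (32 * B ^ 2) = 1089 / 32 * Real.log p := by
      rw [← hrp]; field_simp; norm_num
    have hlog : 0 ≤ Real.log p := Real.log_nonneg (by exact_mod_cast hp)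
    have h1 : Real.exp (-(1089 / 32 * Real.log p)) ≤ ((p : ℝ) ^ 34)⁻¹ := by
      rw [← Real.exp_log (pow_pos hp0 34), ← Real.exp_neg, Real.log_pow]
      apply Real.exp_le_exp.2
      push_cast
      linarith
    rw [e]
    calc 10 * (p : ℝ) ^ 2 * Real.exp (-(1089 / 32 * Real.log p))
        ≤ 10 * p ^ 2 * ((p : ℝ) ^ 34)⁻¹ := by gcongr
      _ = 10 / ((p : ℝ) ^ 4) ^ 8 := by field_simp
      _ ≤ 10 / (n : ℝ) ^ 8 := by gcongr
  · intro X hX j γ lam h1 h2 h3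
    have hBr : 0 < r * B ^ 2 := by positivity
    have hlam : B * (33 * B * r) ≤ lam := le_trans (by nlinarith) h1
    refine (hC.nodewise_prediction_le_of_dominated hX ht h3 hlam (hd j)).trans ?_
    gcongr
  · intro z hz1 hz2 β b lam hβ h1 h2 h3
    have hlam : 0 < lam := lt_of_lt_of_le (by positivity) h1
    have hBB : B * r ≤ B ^ 2 * r := by gcongr; nlinarith
    refine (hC.lasso_l1_le_of_dominated hz1 hz2 ht h3 hlam (by linarith) hβ hdr).trans ?_
    have hd0 : 0 ≤ d := (Nat.cast_nonneg _).trans hβ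
    gcongr

/-- Bound for the remainder at a fixed sample size. -/
theorem GoodLevel.lintegral_remainder_sq_le (hC : CovBounds S L B) {d lo hi E G : ℝ}
    (hlev : GoodLevel n S d lo hi t E G) (hn : 16 ≤ n) (hp : p ≤ Real.exp (3 * n / 32))
    (hlo : 0 < lo) (hlo2 : 1 / lo ^ 2 ≤ 2 * n) (hhi : hi ≤ 1) {T Ē g : ℝ} (htT : t ≤ T)
    (hEE : E ≤ Ē) (hE0 : 0 ≤ E) (hsmall : B * T + √(2 * B * Ē) ≤ L / 2) (hG0 : 0 ≤ G)
    (hg : √n * (2 / L * hi * G) ≤ g)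
    {ξ lamN : Fin p → ℝ} {γ : Design n p → ∀ j : Fin p, {k : Fin p // k ≠ j} → ℝ}
    {b : Data n p → Coef p} {β : Coef p} {lam A C : ℝ} (hγm : Measurable γ) (hbm : Measurable b)
    (hA : ∑ j, |ξ j| ≤ A) (hlamN : ∀ j, lo ≤ lamN j ∧ lamN j ≤ hi) (hlam : lo ≤ lam ∧ lam ≤ hi)
    (hγ : ∀ X j, IsNodewise (lamN j) X j (γ X j)) (hb : ∀ D, IsLasso lam D (b D))
    (hβ : (sparsity (fun k => β k) : ℝ) ≤ d) (hβC : (∑ k, |β k|) ^ 2 ≤ C ^ 2 * n) :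
    ∫⁻ z, ENNReal.ofReal (remainder S ξ lamN γ b β z ^ 2) ∂baseLaw n S
      ≤ ENNReal.ofReal (2 * A ^ 2 * ((2 * Ē / L ^ 2 + 4 * (B * T + √(2 * B * Ē)) ^ 2 / L ^ 3)
        + g ^ 2 + (20 + (8 + 8 * precMoment L B + 768 * B ^ 2)
          + (160000000 + 9216 * C ^ 4 + 4 * precMoment L B)) / n) / n) := by
  have hL := hC.pos
  have hB := hC.one_le
  have hn1 : (1 : ℝ) ≤ n := by exact_mod_cast (by omega : 1 ≤ n)
  have hPM := precMoment_nonneg L B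
  have ht := hlev.pos
  have hη : B * t + √(2 * B * E) ≤ B * T + √(2 * B * Ē) := by gcongr
  have hsm : B * t + √(2 * B * E) ≤ L / 2 := hη.trans hsmall
  have hhi0 : 0 < hi := hlo.trans_le (hlam.1.trans hlam.2)
  have hpos : ∀ j, 0 < lamN j := fun j => hlo.trans_le (hlamN j).1
  have hsq : ∀ l, lo ≤ l → 1 / l ^ 2 ≤ 2 * n := fun l hl => le_trans (by gcongr) hlo2
  have hP1 : designLaw n S {X | ¬DesignRegular S t X} ≤ ENNReal.ofReal (10 / n ^ 8) := by
    refine le_trans ?_ hlev.prob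
    have e : {z : Design n p × (Fin n → ℝ) | ¬DesignRegular S t z.1}
        = {X | ¬DesignRegular S t X} ×ˢ Set.univ := by ext; simp
    have h1 : designLaw n S {X | ¬DesignRegular S t X}
        = baseLaw n S {z | ¬DesignRegular S t z.1} := by rw [e, Measure.prod_prod]; simp
    rw [h1]
    refine measure_mono fun z hz => ?_
    simp only [Set.mem_ofPred_eq] at hz ⊢
    tauto
  have hτ : ∀ j X, DesignRegular S t X → L / 2 ≤ tauSq (lamN j) X j (γ X j) := fun j X hX =>
    (hC.thetaCol_error hX ht.le (hlev.le_one.trans hB) (hpos j).le (hγ X j)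
      (hlev.nodewise X hX j _ _ (hlamN j).1 (hlamN j).2 (hγ X j)) hsm).1
  have hγj : ∀ j, Measurable fun X => γ X j := fun j => (measurable_pi_apply j).comp hγm
  refine (HDLinear.lintegral_remainder_sq_le hγm hbm
    (a1 := (2 * Ē / L ^ 2 + 4 * (B * T + √(2 * B * Ē)) ^ 2 / L ^ 3)
        + n ^ 6 * (10 / n ^ 8) + (8 + 8 * precMoment L B + 768 * B ^ 2) / n ^ 2)
    (a2 := (g / √n) ^ 2 + n ^ 6 * (10 / n ^ 8)
      + (160000000 + 9216 * C ^ 4 + 4 * precMoment L B) / n ^ 2)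
    ?_ (by positivity) hA (fun j => ?_) (fun j => ?_)).trans (ENNReal.ofReal_le_ofReal ?_)
  · have : 0 ≤ Ē := hE0.trans hEE
    positivity
  · refine (lintegral_thetaCol_error_le hC hn hp (hpos j) (hsq _ (hlamN j).1)
      (fun X => hγ X j) ht.le (hlev.le_one.trans hB) hE0
      (fun X hX => hlev.nodewise X hX j _ _ (hlamN j).1 (hlamN j).2 (hγ X j)) hsm
      (by positivity) hP1).trans (ENNReal.ofReal_le_ofReal ?_)
    have : 0 ≤ B * t + √(2 * B * E) := by positivity
    gcongr
  · refine (lintegral_bias_sq_le hC hn hp (hpos j) (hsq _ (hlamN j).1) (hγj j)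
      (fun X => hγ X j) (hlo.trans_le hlam.1) (hlam.2.trans hhi) (hsq _ hlam.1) hb hβC
      (Λ := hi) (G := G) (hlamN j).2 (hτ j)
      (fun z h1 h2 => hlev.lasso z h1 h2 β _ lam hβ hlam.1 hlam.2 (hb _))
      (by positivity) hlev.prob).trans (ENNReal.ofReal_le_ofReal ?_)
    have hsn : 0 < √(n : ℝ) := Real.sqrt_pos.2 (by linarith)
    have : 2 / L * hi * G ≤ g / √n := by
      rw [le_div_iff₀ hsn]; linarith
    gcongr
  · have e2 : (g / √n) ^ 2 = g ^ 2 / n := by rw [div_pow, Real.sq_sqrt (by positivity)]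
    rw [e2, mul_div_assoc (2 * A ^ 2)]
    gcongr
    set α := 2 * Ē / L ^ 2 + 4 * (B * T + √(2 * B * Ē)) ^ 2 / L ^ 3
    set K1 := 8 + 8 * precMoment L B + 768 * B ^ 2
    set K2 := 160000000 + 9216 * C ^ 4 + 4 * precMoment L B
    have hK1 : 0 ≤ K1 := by positivity
    have hn6 : (n : ℝ) ^ 6 * (10 / n ^ 8) = 10 / n ^ 2 := by field_simp
    rw [hn6]
    have h1 : (10 + K1) / (n : ℝ) ^ 2 ≤ (10 + K1) / n := by
      gcongr
      nlinarith
    calc (α + 10 / (n : ℝ) ^ 2 + K1 / n ^ 2) / n + (g ^ 2 / n + 10 / n ^ 2 + K2 / n ^ 2)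
        = (α + (10 + K1) / n ^ 2 + g ^ 2 + (10 + K2) / n) / n := by field_simp; ring
      _ ≤ (α + (10 + K1) / n + g ^ 2 + (10 + K2) / n) / n := by gcongr
      _ = _ := by field_simp; ring

end Level

/-! ### The remainder is asymptotically negligible -/

section Rate

variable {n p : ℕ} {S : Matrix (Fin p) (Fin p) ℝ} {L B : ℝ}

/-- As the diagonal of the precision matrix is positive, the sparsity bound `d` is at least `1`.
Hence `d log p = o(√n)` forces `log p = o(√n)`. -/
theorem one_le_sparsity_precCol (hS : S.PosDef) (j : Fin p) : 1 ≤ sparsity (precCol S j) := by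
  have h : (precCol S j) j ≠ 0 := (precision_diag_pos hS j).ne'
  exact (Set.ncard_pos (Set.toFinite _)).2 ⟨j, h⟩

/-- Bound for the prediction error of the nodewise Lasso, in terms of `x = d log p / √n` and
`y = n ^ (-1 / 16)`. -/
def nodeRate (L B κ x y : ℝ) : ℝ := 8 * (B + κ) ^ 2 / L * y ^ 8 + 4 * κ * B ^ 2 * √x

/-- Bound for the concentration level, as the sum of the levels in low and in high dimension. -/
def levelRate (B x y : ℝ) : ℝ := y ^ 6 + 33 * B * √x

/-- Bound for the error of `τ̂²` on the event of concentration. -/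
def tauRate (L B κ x y : ℝ) : ℝ := B * levelRate B x y + √(2 * B * nodeRate L B κ x y)

/-- Bound for `√n` times the bias off the exceptional event. -/
def biasRate (L κ x y : ℝ) : ℝ := 2 / L * (8 * κ * (1 + κ) / L * y + 96 * κ ^ 2 * x / L)

/-- Bound for `n` times the mean square of the remainder. -/
def remainderRate (L B κ A C x y : ℝ) : ℝ :=
  2 * A ^ 2 * ((2 * nodeRate L B κ x y / L ^ 2 + 4 * tauRate L B κ x y ^ 2 / L ^ 3)
    + biasRate L κ x y ^ 2 + (20 + (8 + 8 * precMoment L B + 768 * B ^ 2)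
      + (160000000 + 9216 * C ^ 4 + 4 * precMoment L B)) * y ^ 16)

section Tendsto

variable {x y : ℕ → ℝ} (κ : ℝ)

theorem tendsto_nodeRate (L B : ℝ) (hx : Tendsto x atTop (𝓝 0)) (hy : Tendsto y atTop (𝓝 0)) :
    Tendsto (fun n => nodeRate L B κ (x n) (y n)) atTop (𝓝 0) := by
  have h := ((hy.pow 8).const_mul (8 * (B + κ) ^ 2 / L)).add (hx.sqrt.const_mul (4 * κ * B ^ 2))
  simpa [nodeRate] using h

theorem tendsto_tauRate (L B : ℝ) (hx : Tendsto x atTop (𝓝 0)) (hy : Tendsto y atTop (𝓝 0)) :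
    Tendsto (fun n => tauRate L B κ (x n) (y n)) atTop (𝓝 0) := by
  have h := (((hy.pow 6).add (hx.sqrt.const_mul (33 * B))).const_mul B).add
    ((tendsto_nodeRate κ L B hx hy).const_mul (2 * B)).sqrt
  simpa [tauRate, levelRate] using h

theorem tendsto_remainderRate (L B A C : ℝ) (hx : Tendsto x atTop (𝓝 0))
    (hy : Tendsto y atTop (𝓝 0)) :
    Tendsto (fun n => remainderRate L B κ A C (x n) (y n)) atTop (𝓝 0) := by
  have hb : Tendsto (fun n => biasRate L κ (x n) (y n)) atTop (𝓝 0) := by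
    have h := ((hy.const_mul (8 * κ * (1 + κ) / L)).add
      ((hx.const_mul (96 * κ ^ 2)).div_const L)).const_mul (2 / L)
    simpa [biasRate] using h
  have h := ((((((tendsto_nodeRate κ L B hx hy).const_mul 2).div_const (L ^ 2)).add
    ((((tendsto_tauRate κ L B hx hy).pow 2).const_mul 4).div_const (L ^ 3))).add (hb.pow 2)).add
      ((hy.pow 16).const_mul (20 + (8 + 8 * precMoment L B + 768 * B ^ 2)
        + (160000000 + 9216 * C ^ 4 + 4 * precMoment L B)))).const_mul (2 * A ^ 2)
  simpa [remainderRate] using h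

end Tendsto

/-- The sample size is large enough for the bounds on the remainder to apply; here
`x = d log p / √n` and `u = n ^ (1 / 16)`. -/
structure LargeSample (L B κ x u : ℝ) : Prop where
  one_le : 2 ≤ u
  inv_sq_le : 1 / u ^ 2 ≤ L / 2
  exp_le : u ^ 136 * Real.exp (-(u ^ 4 / (32 * B ^ 2))) ≤ 1
  x_le : x ≤ 3 / 32
  x_le' : 1056 * B * x ≤ L / 2
  sqrt_le : κ * √x ≤ 1
  sqrt_le' : 33 * B * √x ≤ 1
  tau_le : tauRate L B κ x (1 / u) ≤ L / 2

theorem eventually_largeSample {x u : ℕ → ℝ} (hL : 0 < L) (hB : 1 ≤ B) (κ : ℝ)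
    (hx : Tendsto x atTop (𝓝 0)) (hu : Tendsto u atTop atTop) :
    ∀ᶠ n in atTop, LargeSample L B κ (x n) (u n) := by
  have hy : Tendsto (fun n => 1 / u n) atTop (𝓝 0) := by
    simpa [Pi.inv_def] using hu.inv_tendsto_atTop
  have h0 : Tendsto (fun n => 1 / u n ^ 2) atTop (𝓝 0) := by simpa using hy.pow 2
  have h1 : Tendsto (fun n => 1056 * B * x n) atTop (𝓝 0) := by simpa using hx.const_mul (1056 * B)
  have h2 : Tendsto (fun n => κ * √(x n)) atTop (𝓝 0) := by simpa using hx.sqrt.const_mul κ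
  have h3 : Tendsto (fun n => 33 * B * √(x n)) atTop (𝓝 0) := by
    simpa using hx.sqrt.const_mul (33 * B)
  have h4 := tendsto_tauRate κ L B hx hy
  have h5 : Tendsto (fun n => u n ^ 136 * Real.exp (-(u n ^ 4 / (32 * B ^ 2)))) atTop (𝓝 0) := by
    have hc : 0 < 1 / (32 * B ^ 2) := by positivity
    have h6 : Tendsto (fun v : ℝ => v ^ 34 * Real.exp (-(1 / (32 * B ^ 2)) * v)) atTop (𝓝 0) := by
      have := tendsto_rpow_mul_exp_neg_mul_atTop_nhds_zero 34 (1 / (32 * B ^ 2)) hc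
      refine this.congr' ?_
      filter_upwards [eventually_gt_atTop 0] with v hv
      norm_cast
    have h7 : Tendsto (fun n => u n ^ 4) atTop atTop :=
      (tendsto_pow_atTop (by norm_num)).comp hu
    refine (h6.comp h7).congr fun n => ?_
    simp only [Function.comp]
    rw [← pow_mul]
    congr 2
    ring
  filter_upwards [hu.eventually_ge_atTop 2, h0.eventually_le_const (by positivity : 0 < L / 2),
    h5.eventually_le_const one_pos, hx.eventually_le_const (by norm_num : (0 : ℝ) < 3 / 32),
    h1.eventually_le_const (by positivity : 0 < L / 2), h2.eventually_le_const one_pos,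
    h3.eventually_le_const one_pos, h4.eventually_le_const (by positivity : 0 < L / 2)]
    with n a1 a2 a3 a4 a5 a6 a7 a8
  exact ⟨a1, a2, a3, a4, a5, a6, a7, a8⟩

set_option maxHeartbeats 1000000 in
/-- Bound for the remainder at a fixed sample size, with tuning parameters of order
`√(log p / n)`. -/
theorem CovBounds.lintegral_remainder_sq_le (hC : CovBounds S L B) (hp : 2 ≤ p) {d κ x u : ℝ}
    (hκ : 0 ≤ κ) (hun : u ^ 16 = n) (hx : x = d * Real.log p / √n) (hlarge : LargeSample L B κ x u)
    (hd : ∀ j, (sparsity (precCol S j) : ℝ) ≤ d)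
    {ξ lamN : Fin p → ℝ} {γ : Design n p → ∀ j : Fin p, {k : Fin p // k ≠ j} → ℝ}
    {b : Data n p → Coef p} {β : Coef p} {lam A C : ℝ} (hγm : Measurable γ) (hbm : Measurable b)
    (hA : ∑ j, |ξ j| ≤ A)
    (hlamN : ∀ j, 66 * B ^ 2 * √(Real.log p / n) ≤ lamN j ∧ lamN j ≤ κ * √(Real.log p / n))
    (hlam : 66 * B ^ 2 * √(Real.log p / n) ≤ lam ∧ lam ≤ κ * √(Real.log p / n))
    (hγ : ∀ X j, IsNodewise (lamN j) X j (γ X j)) (hb : ∀ D, IsLasso lam D (b D))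
    (hβ : β ∈ paramSet p d C) :
    ∫⁻ z, ENNReal.ofReal (remainder S ξ lamN γ b β z ^ 2) ∂baseLaw n S
      ≤ ENNReal.ofReal (remainderRate L B κ A C x (1 / u) / n) := by
  obtain ⟨hu2, huL, hexp, hx1, hx2, hx3, hx4, hτ⟩ := hlarge
  have hL := hC.pos
  have hB := hC.one_le
  have hu0 : 0 < u := by linarith
  have hn0 : (0 : ℝ) < n := by rw [← hun]; positivity
  have hn16 : 16 ≤ n := by
    have : (16 : ℝ) ≤ n := by
      rw [← hun]
      calc (16 : ℝ) ≤ 2 ^ 16 := by norm_num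
        _ ≤ u ^ 16 := by gcongr
    exact_mod_cast this
  have hs : 0 < √(n : ℝ) := Real.sqrt_pos.2 hn0
  have hs2 : √(n : ℝ) ^ 2 = n := Real.sq_sqrt hn0.le
  have hs1 : 1 ≤ √(n : ℝ) := Real.one_le_sqrt.2 (by exact_mod_cast (by omega : 1 ≤ n))
  have hsu : √(n : ℝ) = u ^ 8 := by
    rw [Real.sqrt_eq_iff_mul_self_eq hn0.le (by positivity), ← hun]; ring
  have hp0 : (0 : ℝ) < p := by positivity
  set ℓ := Real.log p with hℓ
  have hℓ2 : 1 / 2 ≤ ℓ := by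
    have h1 := Real.log_two_gt_d9
    have h2 : Real.log 2 ≤ ℓ := Real.log_le_log (by norm_num) (by exact_mod_cast hp)
    linarith
  have hd1 : 1 ≤ d := by
    have h := one_le_sparsity_precCol hC.posDef (⟨0, by omega⟩ : Fin p)
    exact le_trans (by exact_mod_cast h) (hd _)
  set r := √(ℓ / n) with hr
  have hr0 : 0 < r := Real.sqrt_pos.2 (by positivity)
  have hr2 : r ^ 2 = ℓ / n := Real.sq_sqrt (by positivity)
  have hxs : d * ℓ = x * √n := by rw [hx]; field_simp
  have hx0 : 0 < x := by rw [hx]; positivity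
  have hsx : √x ^ 2 = x := Real.sq_sqrt hx0.le
  have hsn : √(n : ℝ) ≤ n := by
    calc √(n : ℝ) ≤ √n * √n := le_mul_of_one_le_left hs.le hs1
      _ = n := by rw [← pow_two, hs2]
  have hxsn : x * √n ≤ x * n := by gcongr
  have hdℓ : d * (1 / 2) ≤ d * ℓ := by gcongr
  have hdn : d ≤ 2 * x * √n := by linarith
  have hxn : x * n ≤ 3 / 32 * n := by gcongr
  have hdn' : d ≤ n := by linarith
  have hℓn : ℓ ≤ x * √n := by
    rw [← hxs]
    exact le_mul_of_one_le_left (by linarith) hd1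
  -- `r ^ 2 = log p / n ≤ x / √n`
  have hrx : r ≤ √x := by
    apply Real.sqrt_le_sqrt
    rw [div_le_iff₀ hn0]
    exact hℓn.trans hxsn
  have hrd : r * √d ≤ √x := by
    rw [hr, ← Real.sqrt_mul (by positivity)]
    apply Real.sqrt_le_sqrt
    rw [div_mul_eq_mul_div, div_le_iff₀ hn0, mul_comm ℓ, hxs]
    exact hxsn
  have hdr : d * r ≤ 2 * x := by
    refine abs_le_of_sq_le_sq' ?_ (by positivity) |>.2
    rw [mul_pow, hr2, mul_div_assoc', div_le_iff₀ hn0]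
    calc d ^ 2 * ℓ = d * (d * ℓ) := by ring
      _ = d * (x * √n) := by rw [hxs]
      _ ≤ 2 * x * √n * (x * √n) := by gcongr
      _ = 2 * x ^ 2 * √n ^ 2 := by ring
      _ = 2 * x ^ 2 * n := by rw [hs2]
      _ ≤ 4 * x ^ 2 * n := by gcongr; norm_num
      _ = (2 * x) ^ 2 * n := by ring
  have hnode : 0 ≤ nodeRate L B κ x (1 / u) := by unfold nodeRate; positivity
  have hpexp : (p : ℝ) ≤ Real.exp (3 * n / 32) := by
    rw [← Real.exp_log hp0]
    apply Real.exp_le_exp.2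
    linarith
  have hlo2 : 1 / (66 * B ^ 2 * r) ^ 2 ≤ 2 * (n : ℝ) := by
    rw [div_le_iff₀ (by positivity), mul_pow, hr2]
    have : 1 ≤ B ^ 4 := one_le_pow₀ hB
    calc (1 : ℝ) ≤ 2 * (66 ^ 2 * 1 * (1 / 2)) := by norm_num
      _ ≤ 2 * (66 ^ 2 * B ^ 4 * ℓ) := by gcongr
      _ = 2 * n * ((66 * B ^ 2) ^ 2 * (ℓ / n)) := by field_simp
  have hhi1 : κ * r ≤ 1 := le_trans (by gcongr) hx3
  have hβC : (∑ k, |β k|) ^ 2 ≤ C ^ 2 * n := by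
    refine (sum_abs_sq_le_sparsity _).trans ?_
    have h1 : ∑ k, β k ^ 2 = ‖β‖ ^ 2 := by
      rw [EuclideanSpace.norm_sq_eq]; simp
    have h2 : ‖β‖ ^ 2 ≤ C ^ 2 := by gcongr; exact hβ.2
    rw [h1, mul_comm]
    have h3 : (sparsity β.ofLp : ℝ) ≤ n := hβ.1.trans hdn'
    gcongr
  have hfin : ∀ t E G : ℝ, GoodLevel n S d (66 * B ^ 2 * r) (κ * r) t E G →
      t ≤ levelRate B x (1 / u) → E ≤ nodeRate L B κ x (1 / u) → 0 ≤ E → 0 ≤ G →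
      √n * (2 / L * (κ * r) * G) ≤ biasRate L κ x (1 / u) →
      ∫⁻ z, ENNReal.ofReal (remainder S ξ lamN γ b β z ^ 2) ∂baseLaw n S
        ≤ ENNReal.ofReal (remainderRate L B κ A C x (1 / u) / n) := by
    intro t E G hlev ht hE hE0 hG0 hg
    refine (hlev.lintegral_remainder_sq_le hC hn16 hpexp (by positivity) hlo2 hhi1 ht hE hE0 hτ
      hG0 hg hγm hbm hA hlamN hlam hγ hb hβ.1 hβC).trans (le_of_eq ?_)
    congr 1
    have e : (1 / u) ^ 16 = 1 / n := by rw [_root_.one_div_pow, hun]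
    rw [remainderRate, e, mul_one_div]
    rfl
  -- in low dimension `log p` is of smaller order than any power of `n`;
  -- in high dimension the bounds involve `d log p / √n` only
  rcases le_total (p : ℝ) (u ^ 4) with hcase | hcase
  · have hℓu : ℓ ≤ 4 * u := by
      have h1 : ℓ ≤ Real.log (u ^ 4) := Real.log_le_log hp0 hcase
      rw [Real.log_pow] at h1
      have h2 := Real.log_le_sub_one_of_pos hu0
      push_cast at h1
      linarith
    have hsℓ : √ℓ ≤ 2 * u := by
      rw [Real.sqrt_le_left (by positivity)]
      nlinarith
    have hr8 : r = √ℓ / u ^ 8 := by rw [hr, Real.sqrt_div (by positivity), hsu]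
    have hsℓ' : √ℓ ≤ u ^ 2 := hsℓ.trans (by nlinarith)
    have hr6 : r ≤ 1 / u ^ 6 := by
      rw [hr8, div_le_div_iff₀ (by positivity) (by positivity)]
      calc √ℓ * u ^ 6 ≤ u ^ 2 * u ^ 6 := by gcongr
        _ = 1 * u ^ 8 := by ring
    refine hfin _ _ _ (hC.goodLevel_of_lowdim (κ := κ) (by omega) (by omega) hu0
      (by linarith) hun hcase
      (by positivity) hκ ?_ huL hexp) ?_ ?_ (by positivity) (by positivity) ?_
    · rw [div_eq_mul_one_div]; gcongr
    · rw [levelRate, _root_.one_div_pow]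
      have : 0 ≤ 33 * B * √x := by positivity
      linarith
    · rw [nodeRate, _root_.one_div_pow]
      have h1 : 0 ≤ 4 * κ * B ^ 2 * √x := by positivity
      have h2 : 8 * (B + κ) ^ 2 / (L * u ^ 8) = 8 * (B + κ) ^ 2 / L * (1 / u ^ 8) := by field_simp
      linarith
    · rw [biasRate]
      have h1 : 0 ≤ 2 / L * (96 * κ ^ 2 * x / L) := by positivity
      have h2 : √(n : ℝ) * (2 / L * (κ * r) * (4 * (1 + κ) / (L * u ^ 2)))
          = 2 / L * (4 * κ * (1 + κ) / L * (√ℓ / u ^ 2)) := by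
        rw [hr8, hsu]; field_simp
      have h3 : √ℓ / u ^ 2 ≤ 2 * (1 / u) := by
        rw [mul_one_div, div_le_div_iff₀ (by positivity) hu0]
        calc √ℓ * u ≤ 2 * u * u := by gcongr
          _ = 2 * u ^ 2 := by ring
      rw [h2, mul_add (2 / L)]
      calc 2 / L * (4 * κ * (1 + κ) / L * (√ℓ / u ^ 2))
          ≤ 2 / L * (4 * κ * (1 + κ) / L * (2 * (1 / u))) := by gcongr
        _ = 2 / L * (8 * κ * (1 + κ) / L * (1 / u)) := by ring
        _ ≤ _ := by linarith
  · have hpn : (n : ℝ) ≤ p ^ 4 := by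
      rw [← hun]
      calc u ^ 16 = (u ^ 4) ^ 4 := by ring
        _ ≤ _ := by gcongr
    have hnr : n * r ^ 2 = ℓ := by rw [hr2]; field_simp
    have hr1 : 33 * B * r ≤ 1 := le_trans (by gcongr) hx4
    refine hfin _ _ _ (hC.goodLevel_of_highdim (hi := κ * r) (by omega) (by omega) hpn hr0 hnr
      hr1 hd ?_) ?_ ?_
      (by positivity) (by positivity) ?_
    · calc 16 * d * (33 * B * r) = 528 * B * (d * r) := by ring
        _ ≤ 528 * B * (2 * x) := by gcongr
        _ = 1056 * B * x := by ring
        _ ≤ _ := hx2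
    · rw [levelRate]
      have : 0 ≤ (1 / u) ^ 6 := by positivity
      have : 33 * B * r ≤ 33 * B * √x := by gcongr
      linarith
    · rw [nodeRate]
      have h1 : 0 ≤ 8 * (B + κ) ^ 2 / L * (1 / u) ^ 8 := by positivity
      calc 4 * (κ * r) * (B ^ 2 * √d) = 4 * κ * B ^ 2 * (r * √d) := by ring
        _ ≤ 4 * κ * B ^ 2 * √x := by gcongr
        _ ≤ _ := by linarith
    · rw [biasRate]
      have h1 : 0 ≤ 2 / L * (8 * κ * (1 + κ) / L * (1 / u)) := by positivity
      have h2 : √(n : ℝ) * (2 / L * (κ * r) * (96 * d * (κ * r) / L))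
          = 2 / L * (96 * κ ^ 2 * x / L) := by
        have : √(n : ℝ) * (d * r ^ 2) = x := by
          rw [hr2, hx]
          nth_rewrite 2 [← hs2]
          field_simp
        rw [← this]; ring
      rw [h2, mul_add (2 / L)]
      linarith

end Rate

/-! ### Mean and variance of a linearized estimator -/

section Moments

variable {Ω : Type*} [MeasurableSpace Ω] {μ : Measure Ω}

theorem covariance_sq_le [IsProbabilityMeasure μ] {f g : Ω → ℝ} (hf : MemLp f 2 μ)
    (hg : MemLp g 2 μ) : cov[f, g; μ] ^ 2 ≤ Var[f; μ] * Var[g; μ] := by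
  have h : ∀ t : ℝ, 0 ≤ Var[f; μ] * (t * t) + 2 * cov[f, g; μ] * t + Var[g; μ] := by
    intro t
    have h1 := variance_fun_add (hf.const_mul t) hg
    rw [variance_const_mul, covariance_const_mul_left] at h1
    have h2 := variance_nonneg (fun ω => t * f ω + g ω) μ
    linarith
  have := discrim_le_zero h
  rw [discrim] at this
  linarith

theorem memLp_two_of_lintegral_sq_le {f : Ω → ℝ} (hf : Measurable f) {q : ℝ}
    (h : ∫⁻ ω, ENNReal.ofReal (f ω ^ 2) ∂μ ≤ ENNReal.ofReal q) : MemLp f 2 μ := by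
  rw [memLp_two_iff_integrable_sq hf.aestronglyMeasurable]
  refine ⟨(hf.pow_const 2).aestronglyMeasurable, ?_⟩
  rw [hasFiniteIntegral_iff_ofReal (ae_of_all _ fun ω => sq_nonneg _)]
  exact h.trans_lt ENNReal.ofReal_lt_top

theorem integral_sq_le_of_lintegral {f : Ω → ℝ} {q : ℝ} (hq : 0 ≤ q) (hf : Measurable f)
    (h : ∫⁻ ω, ENNReal.ofReal (f ω ^ 2) ∂μ ≤ ENNReal.ofReal q) : ∫ ω, f ω ^ 2 ∂μ ≤ q := by
  rw [integral_eq_lintegral_of_nonneg_ae (ae_of_all _ fun ω => sq_nonneg _)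
    (hf.pow_const 2).aestronglyMeasurable]
  exact ENNReal.toReal_le_of_le_ofReal hq h

/-- Mean and variance of `c + N + R`, where `N` is centred with variance `s` and `R` is small in
mean square. -/
theorem mean_variance_of_linearization [IsProbabilityMeasure μ] {T N R : Ω → ℝ} {c s q : ℝ}
    (hT : ∀ ω, T ω = c + (N ω + R ω)) (hN : Measurable N) (hR : Measurable R) (hs : 0 ≤ s)
    (hq : 0 ≤ q) (hN0 : ∫ ω, N ω ∂μ = 0)
    (hN2 : ∫⁻ ω, ENNReal.ofReal (N ω ^ 2) ∂μ = ENNReal.ofReal s)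
    (hR2 : ∫⁻ ω, ENNReal.ofReal (R ω ^ 2) ∂μ ≤ ENNReal.ofReal q) :
    MemLp T 2 μ ∧ |∫ ω, T ω ∂μ - c| ≤ √q ∧ |Var[T; μ] - s| ≤ q + 2 * √(s * q) := by
  have hNL := memLp_two_of_lintegral_sq_le hN hN2.le
  have hRL := memLp_two_of_lintegral_sq_le hR hR2
  have hsum : MemLp (fun ω => N ω + R ω) 2 μ := hNL.add hRL
  have hT' : T = fun ω => c + (N ω + R ω) := funext hT
  have hTL : MemLp T 2 μ := by rw [hT']; exact (memLp_const c).add hsum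
  have hNvar : Var[N; μ] = s := by
    rw [variance_of_integral_eq_zero hN.aemeasurable hN0, integral_eq_lintegral_of_nonneg_ae
      (ae_of_all _ fun ω => sq_nonneg _) (hN.pow_const 2).aestronglyMeasurable, hN2,
      ENNReal.toReal_ofReal hs]
  have hR2' := integral_sq_le_of_lintegral hq hR hR2
  have hRvar : Var[R; μ] ≤ q := (variance_le_expectation_sq hRL.aestronglyMeasurable).trans hR2'
  have hRvar0 := variance_nonneg R μ
  refine ⟨hTL, ?_, ?_⟩
  · have h1 : ∫ ω, T ω ∂μ = c + ∫ ω, R ω ∂μ := by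
      rw [hT', integral_add (integrable_const c) (hsum.integrable one_le_two),
        integral_add (hNL.integrable one_le_two) (hRL.integrable one_le_two), hN0]
      simp
    rw [h1, add_sub_cancel_left]
    apply Real.abs_le_sqrt
    have h2 := variance_eq_sub hRL
    have h3 : (∫ ω, (R ^ 2) ω ∂μ) ≤ q := hR2'
    linarith
  · rw [hT', variance_const_add hsum.aestronglyMeasurable, variance_fun_add hNL hRL, hNvar]
    have h1 := covariance_sq_le hNL hRL
    rw [hNvar] at h1
    have h2 : |cov[N, R; μ]| ≤ √(s * q) := Real.abs_le_sqrt (h1.trans (by gcongr))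
    have h3 : s + 2 * cov[N, R; μ] + Var[R; μ] - s = Var[R; μ] + 2 * cov[N, R; μ] := by ring
    rw [h3]
    refine (abs_add_le _ _).trans ?_
    rw [abs_of_nonneg hRvar0, abs_mul, abs_two]
    linarith

end Moments

section Linearization

variable {n p : ℕ} {S : Matrix (Fin p) (Fin p) ℝ}

theorem lintegral_rowFunctional_sq (hS : S.PosSemidef) (v : Fin p → ℝ) :
    ∫⁻ x, ENNReal.ofReal ((∑ k, x k * v k) ^ 2) ∂multivariateGaussian (0 : Coef p) S
      = ENNReal.ofReal (v ⬝ᵥ S *ᵥ v) := by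
  have h0 : 0 ≤ v ⬝ᵥ S *ᵥ v := by simpa using hS.dotProduct_mulVec_nonneg v
  have h1 : ∫⁻ z, ENNReal.ofReal (z ^ 2) ∂gaussianReal 0 (v ⬝ᵥ S *ᵥ v).toNNReal
      = ENNReal.ofReal (v ⬝ᵥ S *ᵥ v) := by
    have hL := memLp_id_gaussianReal (μ := 0) (v := (v ⬝ᵥ S *ᵥ v).toNNReal) 2
    have h2 := variance_of_integral_eq_zero (X := id) hL.aestronglyMeasurable.aemeasurable
      (by simp)
    rw [variance_id_gaussianReal, Real.coe_toNNReal _ h0] at h2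
    have h3 := ofReal_integral_eq_lintegral_ofReal hL.integrable_sq
      (ae_of_all _ fun z => sq_nonneg _)
    rw [← h2] at h3
    exact h3.symm
  rw [← h1, ← map_rowFunctional hS v, lintegral_map (by fun_prop) (by fun_prop)]

theorem lintegral_empSq_lin (hS : S.PosSemidef) (hn : 0 < n) (v : Fin p → ℝ) :
    ∫⁻ X, ENNReal.ofReal (empSq (lin X v)) ∂designLaw n S = ENNReal.ofReal (v ⬝ᵥ S *ᵥ v) := by
  have hn0 : (0 : ℝ) < n := by exact_mod_cast hn
  have h1 : ∀ X : Design n p, ENNReal.ofReal (empSq (lin X v))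
      = ENNReal.ofReal (1 / n) * ∑ i, ENNReal.ofReal ((∑ k, X i k * v k) ^ 2) := by
    intro X
    rw [← ENNReal.ofReal_sum_of_nonneg (fun i _ => sq_nonneg _),
      ← ENNReal.ofReal_mul (by positivity), empSq_lin_eq]
    congr 1; ring
  have h2 : ∀ i, ∫⁻ X, ENNReal.ofReal ((∑ k, X i k * v k) ^ 2) ∂designLaw n S
      = ENNReal.ofReal (v ⬝ᵥ S *ᵥ v) := by
    intro i
    rw [← lintegral_rowFunctional_sq hS]
    exact (measurePreserving_eval (fun _ : Fin n => multivariateGaussian (0 : Coef p) S)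
      i).lintegral_comp (f := fun x => ENNReal.ofReal ((∑ k, x k * v k) ^ 2)) (by fun_prop)
  simp_rw [h1]
  rw [lintegral_const_mul _ (by fun_prop), lintegral_finsetSum _ (fun i _ => by fun_prop)]
  simp_rw [h2]
  rw [Finset.sum_const, Finset.card_univ, Fintype.card_fin, nsmul_eq_mul, ← mul_assoc,
    ← ENNReal.ofReal_natCast n, ← ENNReal.ofReal_mul (by positivity),
    one_div_mul_cancel hn0.ne', ENNReal.ofReal_one, one_mul]

/-- The linear part of the de-sparsified Lasso has variance `ξᵀ S⁻¹ ξ / n`. -/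
theorem lintegral_linear_part_sq (hS : S.PosDef) (hn : 0 < n) (ξ : Fin p → ℝ) :
    ∫⁻ z, ENNReal.ofReal (empInner (lin z.1 (S⁻¹ *ᵥ ξ)) z.2 ^ 2) ∂baseLaw n S
      = ENNReal.ofReal (ξ ⬝ᵥ S⁻¹ *ᵥ ξ / n) := by
  rw [lintegral_empInner_noise_sq (a := fun X => lin X (S⁻¹ *ᵥ ξ)) (by fun_prop),
    lintegral_empSq_lin hS.posSemidef hn, inv_mulVec_quadratic hS,
    ← ENNReal.ofReal_mul (by positivity)]
  congr 1; ring

theorem integral_linear_part (hS : S.PosDef) (hn : 0 < n) (ξ : Fin p → ℝ) :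
    ∫ z, empInner (lin z.1 (S⁻¹ *ᵥ ξ)) z.2 ∂baseLaw n S = 0 := by
  have hL : MemLp (fun z : Design n p × (Fin n → ℝ) => empInner (lin z.1 (S⁻¹ *ᵥ ξ)) z.2) 2
      (baseLaw n S) :=
    memLp_two_of_lintegral_sq_le (by fun_prop) (lintegral_linear_part_sq hS hn ξ).le
  rw [integral_prod _ (hL.integrable one_le_two)]
  have : ∀ X : Design n p, ∫ e, empInner (lin X (S⁻¹ *ᵥ ξ)) e ∂noiseLaw n = 0 := by
    intro X
    simp only [empInner]
    rw [integral_div, integral_noise_lin, zero_div]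
  simp [this]

theorem measurable_desparsified {lamN : Fin p → ℝ}
    {γ : Design n p → ∀ j : Fin p, {k : Fin p // k ≠ j} → ℝ} {b : Data n p → Coef p}
    (hγ : Measurable γ) (hb : Measurable b) (ξ : Fin p → ℝ) :
    Measurable fun D : Data n p =>
      ξ ⬝ᵥ desparsified (thetaHat lamN D.1 (γ D.1)) D (b D) := by
  have hb' : Measurable fun D : Data n p => (b D).ofLp :=
    (by fun_prop : Measurable fun x : Coef p => x.ofLp).comp hb
  have hγ' : ∀ j, Measurable fun D : Data n p => γ D.1 j := fun j =>
    (measurable_pi_apply j).comp (hγ.comp measurable_fst)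
  simp only [dotProduct, desparsified_eq]
  refine Finset.measurable_fun_sum _ fun j _ => Measurable.const_mul (Measurable.fun_add ?_ ?_) _
  · exact (measurable_pi_apply j).comp hb'
  · exact Measurable.empInner (measurable_snd.sub (Measurable.lin measurable_fst hb'))
      (Measurable.lin measurable_fst (Measurable.thetaCol measurable_fst (hγ' j)))

theorem integral_law {T : Data n p → ℝ} (hT : Measurable T) (β : Coef p) :
    ∫ D, T D ∂law S β = ∫ z, T (observe β z) ∂baseLaw n S := by
  rw [law_eq_map, integral_map (measurable_observe β).aemeasurable hT.aestronglyMeasurable]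

theorem variance_law {T : Data n p → ℝ} (hT : Measurable T) (β : Coef p) :
    Var[T; law S β] = Var[fun z => T (observe β z); baseLaw n S] := by
  rw [law_eq_map, variance_map hT.aemeasurable (measurable_observe β).aemeasurable]
  rfl

theorem memLp_law {T : Data n p → ℝ} (hT : Measurable T) (β : Coef p) :
    MemLp T 2 (law S β) ↔ MemLp (fun z => T (observe β z)) 2 (baseLaw n S) := by
  rw [law_eq_map, memLp_map_measure_iff hT.aestronglyMeasurable
    (measurable_observe β).aemeasurable]
  rfl

/-- Mean and variance of the de-sparsified Lasso, given the size of the remainder. -/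
theorem desparsified_mean_variance (hS : S.PosDef) (hn : 0 < n) {ξ lamN : Fin p → ℝ}
    {γ : Design n p → ∀ j : Fin p, {k : Fin p // k ≠ j} → ℝ} {b : Data n p → Coef p} {β : Coef p}
    (hγ : Measurable γ) (hb : Measurable b) {T : Data n p → ℝ}
    (hT : ∀ D, T D = ξ ⬝ᵥ desparsified (thetaHat lamN D.1 (γ D.1)) D (b D)) {q : ℝ} (hq : 0 ≤ q)
    (hR : ∫⁻ z, ENNReal.ofReal (remainder S ξ lamN γ b β z ^ 2) ∂baseLaw n S ≤ ENNReal.ofReal q) :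
    MemLp T 2 (law S β) ∧ |∫ D, T D ∂law S β - ∑ j, ξ j * β j| ≤ √q ∧
      |Var[T; law S β] - ξ ⬝ᵥ S⁻¹ *ᵥ ξ / n| ≤ q + 2 * √(ξ ⬝ᵥ S⁻¹ *ᵥ ξ / n * q) := by
  have hTm : Measurable T := by
    rw [funext hT]; exact measurable_desparsified hγ hb ξ
  have hRm : Measurable (remainder (n := n) S ξ lamN γ b β) := by
    unfold remainder
    have h1 : Measurable fun z : Design n p × (Fin n → ℝ) => empInner (lin z.1 (S⁻¹ *ᵥ ξ)) z.2 := by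
      fun_prop
    exact (((measurable_desparsified (lamN := lamN) hγ hb ξ).comp (measurable_observe β)).sub_const
      _).sub h1
  rw [memLp_law hTm, integral_law hTm, variance_law hTm]
  have hsplit : ∀ z : Design n p × (Fin n → ℝ), T (observe β z) = ∑ j, ξ j * β j
      + (empInner (lin z.1 (S⁻¹ *ᵥ ξ)) z.2 + remainder S ξ lamN γ b β z) := by
    intro z
    have h1 := hT (observe β z)
    have h2 : (observe β z).1 = z.1 := rfl
    rw [h2] at h1
    rw [h1, remainder]
    ring
  have hNm : Measurable fun z : Design n p × (Fin n → ℝ) =>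
      empInner (lin z.1 (S⁻¹ *ᵥ ξ)) z.2 := by fun_prop
  have hv : 0 ≤ ξ ⬝ᵥ S⁻¹ *ᵥ ξ / n := div_nonneg (inv_quadratic_nonneg hS ξ) (Nat.cast_nonneg n)
  exact mean_variance_of_linearization hsplit hNm hRm hv hq
    (integral_linear_part hS hn ξ) (lintegral_linear_part_sq hS hn ξ) hR

end Linearization

/-! ### The Hammersley–Chapman–Robbins bound -/

section LowerBound

variable {n p : ℕ} {S : Matrix (Fin p) (Fin p) ℝ}

/-- The density of the law of the observations with regression vector `β + h` with respect to the
one with regression vector `β`, as a function of the design and the noise. -/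
def likelihoodRatio (h : Fin p → ℝ) (z : Design n p × (Fin n → ℝ)) : ℝ :=
  Real.exp (∑ i, lin z.1 h i * z.2 i - (∑ i, lin z.1 h i ^ 2) / 2)

theorem measurable_likelihoodRatio (h : Fin p → ℝ) :
    Measurable (likelihoodRatio (n := n) h) := by
  have h1 : Measurable fun z : Design n p × (Fin n → ℝ) => lin z.1 h := by fun_prop
  have h2 : ∀ i, Measurable fun z : Design n p × (Fin n → ℝ) => lin z.1 h i := fun i =>
    (measurable_pi_apply i).comp h1
  unfold likelihoodRatio
  fun_prop

/-- Girsanov-type formula: conditionally on the design, adding `X h` to the noise is a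
Cameron-Martin shift. -/
theorem baseLaw_map_shift (h : Fin p → ℝ) :
    (baseLaw n S).map (fun z => (z.1, fun i => lin z.1 h i + z.2 i))
      = (baseLaw n S).withDensity fun z => ENNReal.ofReal (likelihoodRatio h z) := by
  have hm : Measurable fun z : Design n p × (Fin n → ℝ) =>
      (z.1, fun i => lin z.1 h i + z.2 i) := by
    have h1 : Measurable fun z : Design n p × (Fin n → ℝ) => lin z.1 h := by fun_prop
    have h2 : ∀ i, Measurable fun z : Design n p × (Fin n → ℝ) => lin z.1 h i := fun i =>
      (measurable_pi_apply i).comp h1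
    fun_prop
  have hlr := (measurable_likelihoodRatio (n := n) h).ennreal_ofReal
  ext s hs
  rw [Measure.map_apply hm hs, withDensity_apply _ hs, ← lintegral_indicator hs,
    lintegral_prod _ (hlr.indicator hs).aemeasurable, Measure.prod_apply (hm hs)]
  refine lintegral_congr fun X => ?_
  have hsX : MeasurableSet (Prod.mk X ⁻¹' s) := measurable_prodMk_left hs
  have h1 : noiseLaw n (Prod.mk X ⁻¹' ((fun z : Design n p × (Fin n → ℝ) =>
      (z.1, fun i => lin z.1 h i + z.2 i)) ⁻¹' s))
      = (noiseLaw n).map (fun e i => lin X h i + e i) (Prod.mk X ⁻¹' s) := by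
    rw [Measure.map_apply (by fun_prop) hsX]
    rfl
  rw [h1, noiseLaw_map_add, withDensity_apply _ hsX, ← lintegral_indicator hsX]
  rfl

/-- The law at `β + h` expressed through the likelihood ratio with respect to the law at `β`. -/
theorem law_add_eq (β : Coef p) (h : Fin p → ℝ) :
    law (n := n) S (β + WithLp.toLp 2 h)
      = ((baseLaw n S).withDensity fun z => ENNReal.ofReal (likelihoodRatio h z)).map
        (observe β) := by
  have hm : Measurable fun z : Design n p × (Fin n → ℝ) =>
      (z.1, fun i => lin z.1 h i + z.2 i) := by
    have h1 : Measurable fun z : Design n p × (Fin n → ℝ) => lin z.1 h := by fun_prop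
    have h2 : ∀ i, Measurable fun z : Design n p × (Fin n → ℝ) => lin z.1 h i := fun i =>
      (measurable_pi_apply i).comp h1
    fun_prop
  rw [law_eq_map, ← baseLaw_map_shift, Measure.map_map (measurable_observe β) hm]
  congr 1
  ext z : 1
  simp only [observe, Function.comp, fit_eq_lin, Prod.mk.injEq, true_and]
  ext i
  have : (β + WithLp.toLp 2 h).ofLp = β.ofLp + h := rfl
  rw [this, lin_add, Pi.add_apply]
  ring

theorem integral_law_add {T : Data n p → ℝ} (hT : Measurable T) (β : Coef p) (h : Fin p → ℝ) :
    ∫ D, T D ∂law S (β + WithLp.toLp 2 h)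
      = ∫ z, T (observe β z) * likelihoodRatio h z ∂baseLaw n S := by
  rw [law_add_eq, integral_map (measurable_observe β).aemeasurable hT.aestronglyMeasurable,
    integral_withDensity_eq_integral_toReal_smul (measurable_likelihoodRatio h).ennreal_ofReal
      (ae_of_all _ fun _ => ENNReal.ofReal_lt_top)]
  refine integral_congr_ae (ae_of_all _ fun z => ?_)
  simp only [smul_eq_mul]
  rw [ENNReal.toReal_ofReal (by unfold likelihoodRatio; positivity), mul_comm]

/-- Second moment of the likelihood ratio in the direction `h`, with `s = hᵀ S h` twice the
Kullback–Leibler divergence per observation. -/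
theorem lintegral_likelihoodRatio_sq_le (hS : S.PosSemidef) (h : Fin p → ℝ) {s : ℝ}
    (hs : h ⬝ᵥ S *ᵥ h = s) (hs1 : s ≤ 1 / 4) :
    ∫⁻ z, ENNReal.ofReal (likelihoodRatio h z ^ 2) ∂baseLaw n S
      ≤ ENNReal.ofReal (Real.exp (n * (s + 2 * s ^ 2))) := by
  have hs0 : 0 ≤ s := by rw [← hs]; simpa using hS.dotProduct_mulVec_nonneg h
  rw [lintegral_prod _ ((measurable_likelihoodRatio h).pow_const 2).ennreal_ofReal.aemeasurable]
  have h1 : ∀ X : Design n p,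
      ∫⁻ e, ENNReal.ofReal (likelihoodRatio h (X, e) ^ 2) ∂noiseLaw n
        = ENNReal.ofReal (Real.exp (1 * ∑ i, (∑ k, X i k * h k) ^ 2)) := by
    intro X
    have h2 : ∀ e : Fin n → ℝ, ENNReal.ofReal (likelihoodRatio h (X, e) ^ 2)
        = ENNReal.ofReal (Real.exp (-∑ i, lin X h i ^ 2))
          * ENNReal.ofReal (Real.exp (∑ i, (2 * lin X h i) * e i)) := by
      intro e
      rw [← ENNReal.ofReal_mul (by positivity), ← Real.exp_add, likelihoodRatio, ← Real.exp_nat_mul]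
      congr 2
      simp only [mul_assoc, ← Finset.mul_sum]
      push_cast
      ring
    simp_rw [h2]
    rw [lintegral_const_mul _ (by fun_prop), lintegral_exp_noise,
      ← ENNReal.ofReal_mul (by positivity), ← Real.exp_add]
    congr 2
    simp only [mul_pow, ← Finset.mul_sum, lin]
    ring
  simp_rw [h1]
  refine (lintegral_exp_sum_sq_le (measurable_rowFunctional h) (map_rowFunctional hS h)
    (t := 1) ?_).trans (le_of_eq ?_)
  · rw [hs, Real.coe_toNNReal _ hs0, one_mul, abs_of_nonneg hs0]
    exact hs1
  · rw [hs, Real.coe_toNNReal _ hs0, one_mul]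

/-- The Hammersley–Chapman–Robbins bound for the variance of an estimator, in the direction `h`. -/
theorem sq_integral_sub_le (hS : S.PosSemidef) {T : Data n p → ℝ} (hT : Measurable T) (β : Coef p)
    (hTL : MemLp T 2 (law S β)) (h : Fin p → ℝ) {s : ℝ} (hs : h ⬝ᵥ S *ᵥ h = s)
    (hs1 : s ≤ 1 / 4) :
    ((∫ D, T D ∂law S (β + WithLp.toLp 2 h)) - ∫ D, T D ∂law S β) ^ 2
      ≤ Var[T; law S β] * (Real.exp (n * (s + 2 * s ^ 2)) - 1) := by
  have hg := (memLp_law hT β).1 hTL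
  have hlm := measurable_likelihoodRatio (n := n) h
  have hl2 := lintegral_likelihoodRatio_sq_le (n := n) hS h hs hs1
  have hl := memLp_two_of_lintegral_sq_le hlm hl2
  -- the likelihood ratio integrates to one: take `T = 1`
  have h1 : ∫ z, likelihoodRatio h z ∂baseLaw n S = 1 := by
    have h2 := integral_law_add (S := S) (T := fun _ : Data n p => (1 : ℝ)) measurable_const β h
    have : IsProbabilityMeasure (law (n := n) S (β + WithLp.toLp 2 h)) := by
      rw [law_eq_map]
      exact Measure.isProbabilityMeasure_map (measurable_observe _).aemeasurable
    simpa using h2.symm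
  have hvar : Var[likelihoodRatio h; baseLaw n S] ≤ Real.exp (n * (s + 2 * s ^ 2)) - 1 := by
    have h2 := integral_sq_le_of_lintegral (Real.exp_pos _).le hlm hl2
    have h3 := variance_eq_sub hl
    have h4 : ∫ z, (likelihoodRatio h ^ 2) z ∂baseLaw n S
      ≤ Real.exp (n * (s + 2 * s ^ 2)) := h2
    rw [h1] at h3
    linarith
  have hcov : cov[fun z => T (observe β z), likelihoodRatio h; baseLaw n S]
      = (∫ D, T D ∂law S (β + WithLp.toLp 2 h)) - ∫ D, T D ∂law S β := by
    rw [covariance_eq_sub hg hl, h1, integral_law_add hT, integral_law hT, mul_one]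
    rfl
  rw [← hcov, variance_law hT]
  exact (covariance_sq_le hg hl).trans (by gcongr; exact variance_nonneg _ _)

end LowerBound

/-! ### Asymptotics -/

section Asymptotics

variable {p : ℕ → ℕ} {S : ∀ n, Matrix (Fin (p n)) (Fin (p n)) ℝ} {L B : ℝ}

/-- `n` times the mean square of the remainder tends to zero, uniformly over the parameter set. -/
theorem exists_remainder_rate (hC : ∀ n, CovBounds (S n) L B) (hp : ∀ n, 2 ≤ p n) {d : ℕ → ℝ}
    (C : ℝ) (hd : d =o[atTop] fun n : ℕ => √(n : ℝ) / Real.log (p n))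
    (hdS : ∀ n (j : Fin (p n)), (sparsity (precCol (S n) j) : ℝ) ≤ d n)
    {ξ : ∀ n, Fin (p n) → ℝ} {A : ℝ} (hA : ∀ᶠ n in atTop, ∑ j, |ξ n j| ≤ A) {κ : ℝ} (hκ : 0 ≤ κ)
    {lam : ℕ → ℝ} {lamN : ∀ n, Fin (p n) → ℝ}
    (hlam : ∀ n : ℕ, 1 ≤ n → 66 * B ^ 2 * √(Real.log (p n) / n) ≤ lam n ∧
      lam n ≤ κ * √(Real.log (p n) / n))
    (hlamN : ∀ n : ℕ, 1 ≤ n → ∀ j, 66 * B ^ 2 * √(Real.log (p n) / n) ≤ lamN n j ∧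
      lamN n j ≤ κ * √(Real.log (p n) / n))
    {b : ∀ n, Data n (p n) → Coef (p n)}
    {γ : ∀ n, Design n (p n) → ∀ j : Fin (p n), {k : Fin (p n) // k ≠ j} → ℝ}
    (hbm : ∀ n, Measurable (b n)) (hγm : ∀ n, Measurable (γ n))
    (hb : ∀ n : ℕ, 1 ≤ n → ∀ D, IsLasso (lam n) D (b n D))
    (hγ : ∀ n : ℕ, 1 ≤ n → ∀ X j, IsNodewise (lamN n j) X j (γ n X j)) :
    ∃ ρ : ℕ → ℝ, (∀ n, 0 ≤ ρ n) ∧ Tendsto ρ atTop (𝓝 0) ∧ ∀ᶠ n in atTop,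
      ∀ β ∈ paramSet (p n) (d n) C,
        ∫⁻ z, ENNReal.ofReal (remainder (S n) (ξ n) (lamN n) (γ n) (b n) β z ^ 2) ∂baseLaw n (S n)
          ≤ ENNReal.ofReal (ρ n / n) := by
  set x : ℕ → ℝ := fun n => d n * Real.log (p n) / √n with hx
  set u : ℕ → ℝ := fun n => (n : ℝ) ^ ((1 : ℝ) / 16) with hu
  have hx0 : Tendsto x atTop (𝓝 0) := by
    refine hd.tendsto_div_nhds_zero.congr fun n => ?_
    simp only [hx]
    rw [div_div_eq_mul_div]
  have hu0 : Tendsto u atTop atTop :=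
    (tendsto_rpow_atTop (by norm_num)).comp tendsto_natCast_atTop_atTop
  have hun : ∀ n, u n ^ 16 = n := fun n => by
    simp only [hu]
    rw [← Real.rpow_natCast, ← Real.rpow_mul (Nat.cast_nonneg n)]
    norm_num
  have hy0 : Tendsto (fun n => 1 / u n) atTop (𝓝 0) := by
    simpa [Pi.inv_def] using hu0.inv_tendsto_atTop
  refine ⟨fun n => |remainderRate L B κ A C (x n) (1 / u n)|, fun n => abs_nonneg _, ?_, ?_⟩
  · simpa using (tendsto_remainderRate κ L B A C hx0 hy0).abs
  · filter_upwards [eventually_largeSample (hC 0).pos (hC 0).one_le κ hx0 hu0, hA,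
      eventually_ge_atTop 1] with n hlarge hAn hn β hβ
    refine ((hC n).lintegral_remainder_sq_le (hp n) hκ (hun n) rfl hlarge (hdS n) (hγm n) (hbm n)
      hAn (hlamN n hn) (hlam n hn) (hγ n hn) (hb n hn) hβ).trans (ENNReal.ofReal_le_ofReal ?_)
    gcongr
    exact le_abs_self _

/-- The rate at which the de-sparsified Lasso is asymptotically unbiased, when `n` times the mean
square of its remainder is `ρ n`. -/
def unbiasedRate (ρ : ℕ → ℝ) (n : ℕ) : ℝ := (n + 1) / √(ρ n + 1 / (n + 1))

theorem unbiasedRate_pos {ρ : ℕ → ℝ} (hρ : ∀ n, 0 ≤ ρ n) (n : ℕ) : 0 < unbiasedRate ρ n := by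
  have := hρ n
  unfold unbiasedRate
  positivity

theorem tendsto_add_one_div {ρ : ℕ → ℝ} (hρ0 : Tendsto ρ atTop (𝓝 0)) :
    Tendsto (fun n : ℕ => √(ρ n + 1 / ((n : ℝ) + 1))) atTop (𝓝 0) := by
  simpa using (hρ0.add tendsto_one_div_add_atTop_nhds_zero_nat).sqrt

theorem isLittleO_unbiasedRate {ρ : ℕ → ℝ} (hρ : ∀ n, 0 ≤ ρ n) (hρ0 : Tendsto ρ atTop (𝓝 0)) :
    (fun n : ℕ => (n : ℝ)) =o[atTop] unbiasedRate ρ := by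
  rw [isLittleO_iff_tendsto fun n h => absurd h (unbiasedRate_pos hρ n).ne']
  refine squeeze_zero (fun n => ?_) (fun n => ?_) (tendsto_add_one_div hρ0)
  · exact div_nonneg (Nat.cast_nonneg n) (unbiasedRate_pos hρ n).le
  · have := hρ n
    rw [unbiasedRate, div_div_eq_mul_div]
    rw [div_le_iff₀ (by positivity), mul_comm]
    gcongr
    linarith

theorem tendsto_unbiasedRate_mul {ρ : ℕ → ℝ} (hρ : ∀ n, 0 ≤ ρ n)
    (hρ0 : Tendsto ρ atTop (𝓝 0)) :
    Tendsto (fun n : ℕ => √(unbiasedRate ρ n) * √(ρ n / n)) atTop (𝓝 0) := by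
  have h0 : Tendsto (fun n : ℕ => √(2 * √(ρ n + 1 / ((n : ℝ) + 1)))) atTop (𝓝 0) := by
    simpa using ((tendsto_add_one_div hρ0).const_mul 2).sqrt
  refine squeeze_zero' (Eventually.of_forall fun n => by positivity) ?_ h0
  filter_upwards [eventually_ge_atTop 1] with n hn
  rw [← Real.sqrt_mul (unbiasedRate_pos hρ n).le]
  apply Real.sqrt_le_sqrt
  have h1 := hρ n
  have hn1 : (1 : ℝ) ≤ n := by exact_mod_cast hn
  have h2 : 0 < ρ n + 1 / ((n : ℝ) + 1) := by positivity
  have h3 : √(ρ n + 1 / ((n : ℝ) + 1)) * √(ρ n + 1 / ((n : ℝ) + 1)) = ρ n + 1 / ((n : ℝ) + 1) :=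
    Real.mul_self_sqrt h2.le
  have h4 : 0 < √(ρ n + 1 / ((n : ℝ) + 1)) := Real.sqrt_pos.2 h2
  rw [unbiasedRate, div_mul_div_comm, div_le_iff₀ (by positivity)]
  calc ((n : ℝ) + 1) * ρ n ≤ (2 * n) * (ρ n + 1 / ((n : ℝ) + 1)) := by
        have : 0 ≤ 1 / ((n : ℝ) + 1) := by positivity
        gcongr
        · linarith
        · linarith
    _ = 2 * n * (√(ρ n + 1 / ((n : ℝ) + 1)) * √(ρ n + 1 / ((n : ℝ) + 1))) := by rw [h3]
    _ = _ := by ring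

/-- The asymptotic variance stays bounded. -/
theorem CovBounds.inv_quadratic_le_sq {p : ℕ} {S : Matrix (Fin p) (Fin p) ℝ}
    (hC : CovBounds S L B) {ξ : Fin p → ℝ} {A : ℝ} (hA : ∑ j, |ξ j| ≤ A) :
    ξ ⬝ᵥ S⁻¹ *ᵥ ξ ≤ A ^ 2 / L := by
  have hL := hC.pos
  refine (inv_quadratic_le hC.posDef hC.pos hC.eigenvalues ξ).trans ?_
  gcongr
  exact (sum_sq_le_sum_abs_sq _ _).trans (by gcongr)

/-- The variance bound for linearized estimators gives `V = (v + o(1)) / n`, when `n` times the mean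
square of the remainder is `ρ n → 0`. -/
theorem exists_variance_expansion {V v ρ : ℕ → ℝ} {K : ℝ} (hρ : ∀ n, 0 ≤ ρ n)
    (hρ0 : Tendsto ρ atTop (𝓝 0)) (hv : ∀ᶠ n in atTop, 0 ≤ v n ∧ v n ≤ K)
    (hV : ∀ᶠ n : ℕ in atTop, |V n - v n / n| ≤ ρ n / n + 2 * √(v n / n * (ρ n / n))) :
    ∃ r : ℕ → ℝ, Tendsto r atTop (𝓝 0) ∧ ∀ᶠ n : ℕ in atTop, V n = (v n + r n) / n := by
  refine ⟨fun n => n * V n - v n, ?_, ?_⟩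
  · have h0 : Tendsto (fun n => ρ n + 2 * √(K * ρ n)) atTop (𝓝 0) := by
      simpa using hρ0.add ((hρ0.const_mul K).sqrt.const_mul 2)
    refine squeeze_zero_norm' ?_ h0
    filter_upwards [hv, hV, eventually_ge_atTop 1] with n h1 h2 hn
    have hn0 : (0 : ℝ) < n := by exact_mod_cast hn
    have hr := hρ n
    have e1 : (n : ℝ) * V n - v n = n * (V n - v n / n) := by field_simp
    have e2 : √(v n / n * (ρ n / n)) = √(v n * ρ n) / n := by
      rw [div_mul_div_comm, Real.sqrt_div (mul_nonneg h1.1 hr), Real.sqrt_mul_self hn0.le]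
    rw [Real.norm_eq_abs, e1, abs_mul, abs_of_pos hn0]
    rw [e2] at h2
    calc (n : ℝ) * |V n - v n / n| ≤ n * (ρ n / n + 2 * (√(v n * ρ n) / n)) := by gcongr
      _ = ρ n + 2 * √(v n * ρ n) := by field_simp
      _ ≤ ρ n + 2 * √(K * ρ n) := by gcongr; exact h1.2
  · filter_upwards [eventually_ge_atTop 1] with n hn
    have hn0 : (0 : ℝ) < n := by exact_mod_cast hn
    field_simp
    ring

/-- Strong asymptotic unbiasedness of an estimator with small bias and bounded `n`-fold variance. -/
theorem stronglyAsympUnbiased_of_bias_le {d : ℕ → ℝ} {C : ℝ} {g : ∀ n, Coef (p n) → ℝ}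
    {β₀ : ∀ n, Coef (p n)} (hβ₀ : ∀ n, β₀ n ∈ paramSet (p n) (d n) C) {T : ∀ n, Data n (p n) → ℝ}
    (hT : ∀ n, Measurable (T n)) {v ρ : ℕ → ℝ} {K : ℝ} (hρ : ∀ n, 0 ≤ ρ n)
    (hρ0 : Tendsto ρ atTop (𝓝 0)) (hv : ∀ᶠ n in atTop, 0 ≤ v n ∧ v n ≤ K)
    (h : ∀ᶠ n : ℕ in atTop, ∀ β ∈ paramSet (p n) (d n) C, MemLp (T n) 2 (law (S n) β) ∧
      |∫ D, T n D ∂law (S n) β - g n β| ≤ √(ρ n / n) ∧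
      |Var[T n; law (S n) β] - v n / n| ≤ ρ n / n + 2 * √(v n / n * (ρ n / n))) (c : ℝ) :
    StronglyAsympUnbiased S d C g β₀ c (unbiasedRate ρ) T where
  measurable := hT
  rate_pos := unbiasedRate_pos hρ
  rate := isLittleO_unbiasedRate hρ hρ0
  memLp := h.mono fun n hn => (hn _ (hβ₀ n)).1
  variance := by
    obtain ⟨r, hr, hV⟩ := exists_variance_expansion
      (V := fun n => Var[T n; law (S n) (β₀ n)]) hρ hρ0 hv
      (h.mono fun n hn => (hn _ (hβ₀ n)).2.2)
    refine IsBigO.of_bound (K + 1) ?_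
    filter_upwards [hV, hv, hr.eventually_le_const one_pos, eventually_ge_atTop 1]
      with n h1 h2 h3 hn
    have hn0 : (0 : ℝ) < n := by exact_mod_cast hn
    rw [Real.norm_eq_abs, Real.norm_eq_abs, abs_of_nonneg (variance_nonneg _ _),
      abs_of_nonneg (by positivity), h1, mul_one_div]
    gcongr
    exact h2.2
  unbiased := by
    intro β hβ
    constructor
    · filter_upwards [h] with n hn
      have : IsProbabilityMeasure (law (n := n) (S n) (β n)) := by
        rw [law_eq_map]
        exact Measure.isProbabilityMeasure_map (measurable_observe _).aemeasurable
      exact (hn _ (hβ n).1).1.integrable one_le_two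
    · refine squeeze_zero_norm' ?_ (tendsto_unbiasedRate_mul hρ hρ0)
      filter_upwards [h] with n hn
      rw [Real.norm_eq_abs, abs_mul, abs_of_nonneg (Real.sqrt_nonneg _)]
      gcongr
      exact (hn _ (hβ n).1).2.1

/-- The Hammersley–Chapman–Robbins bound in the limit of small perturbations: `s = 1 / m` is small
compared to `1 / n`, and `v` is the limiting information bound. -/
theorem le_mul_variance {n : ℕ} (hn : 1 ≤ n) {m v δ V : ℝ} (hm : 0 < m) (hV : 0 ≤ V)
    (hsmall : n / m * (1 + 2 / m) ≤ 1)
    (h : ((√v + δ) / √m) ^ 2 ≤ V * (Real.exp (n * (1 / m + 2 * (1 / m) ^ 2)) - 1)) :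
    (√v + δ) ^ 2 ≤ n * V * ((1 + 2 / m) * (1 + n / m * (1 + 2 / m))) := by
  have hn0 : (0 : ℝ) < n := by exact_mod_cast hn
  have e1 : n * (1 / m + 2 * (1 / m) ^ 2) = n / m * (1 + 2 / m) := by field_simp
  rw [e1] at h
  set y := n / m * (1 + 2 / m) with hy
  have hy0 : 0 ≤ y := by positivity
  have h1 := (abs_le.1 (Real.abs_exp_sub_one_sub_id_le (x := y) (by rwa [abs_of_nonneg hy0]))).2
  have h2 : ((√v + δ) / √m) ^ 2 ≤ V * (y * (1 + y)) :=
    h.trans (by gcongr; linarith)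
  rw [div_pow, Real.sq_sqrt hm.le, div_le_iff₀ hm] at h2
  calc (√v + δ) ^ 2 ≤ V * (y * (1 + y)) * m := h2
    _ = n * V * ((1 + 2 / m) * (1 + y)) := by rw [hy]; field_simp

/-- The lower bound for the variance of strongly asymptotically unbiased estimators of `ξᵀ β`. -/
theorem exists_variance_lower_bound (hS : ∀ n, (S n).PosDef) {d : ℕ → ℝ} {C : ℝ}
    {β₀ : ∀ n, Coef (p n)} (hβ₀ : ∀ n, β₀ n ∈ paramSet (p n) (d n) C) {ξ : ∀ n, Fin (p n) → ℝ}
    {K : ℝ} (hK : ∀ᶠ n in atTop, ξ n ⬝ᵥ (S n)⁻¹ *ᵥ ξ n ≤ K) {c : ℝ} {m : ℕ → ℝ}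
    {T : ∀ n, Data n (p n) → ℝ} (hc : 0 < c)
    (hT : StronglyAsympUnbiased S d C (fun n β => ∑ j, ξ n j * β j) β₀ c m T)
    (hdir : ∀ᶠ n in atTop,
      β₀ n + (1 / √((ξ n ⬝ᵥ (S n)⁻¹ *ᵥ ξ n) * m n)) • WithLp.toLp 2 ((S n)⁻¹ *ᵥ ξ n) ∈
        nbhd (d n) C (β₀ n) (c / √(m n))) :
    ∃ r : ℕ → ℝ, Tendsto r atTop (𝓝 0) ∧ ∀ᶠ n in atTop,
      (ξ n ⬝ᵥ (S n)⁻¹ *ᵥ ξ n + r n) / n ≤ Var[T n; law (S n) (β₀ n)] := by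
  classical
  set v : ℕ → ℝ := fun n => ξ n ⬝ᵥ (S n)⁻¹ *ᵥ ξ n with hv
  have hv0 : ∀ n, 0 ≤ v n := fun n => inv_quadratic_nonneg (hS n) (ξ n)
  set V : ℕ → ℝ := fun n => Var[T n; law (S n) (β₀ n)] with hVdef
  have hV0 : ∀ n, 0 ≤ V n := fun n => variance_nonneg _ _
  set h : ∀ n, Fin (p n) → ℝ := fun n => (1 / √(v n * m n)) • (S n)⁻¹ *ᵥ ξ n with hh
  have hmp := hT.rate_pos
  have hself : ∀ n, β₀ n ∈ nbhd (d n) C (β₀ n) (c / √(m n)) := fun n =>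
    ⟨hβ₀ n, by simpa using div_nonneg hc.le (Real.sqrt_nonneg _)⟩
  -- the perturbed sequence has to stay in the neighbourhood for every `n`
  set β₁ : ∀ n, Coef (p n) := fun n =>
    if β₀ n + WithLp.toLp 2 (h n) ∈ nbhd (d n) C (β₀ n) (c / √(m n)) then
      β₀ n + WithLp.toLp 2 (h n) else β₀ n with hβ₁
  have hβ₁mem : ∀ n, β₁ n ∈ nbhd (d n) C (β₀ n) (c / √(m n)) := by
    intro n
    simp only [hβ₁]
    split_ifs with hif
    · exact hif
    · exact hself n
  have hβ₁eq : ∀ᶠ n in atTop, β₁ n = β₀ n + WithLp.toLp 2 (h n) :=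
    hdir.mono fun n hn => if_pos hn
  obtain ⟨-, h1⟩ := hT.unbiased β₁ hβ₁mem
  obtain ⟨-, h2⟩ := hT.unbiased β₀ hself
  set δ : ℕ → ℝ := fun n =>
    √(m n) * ((∫ D, T n D ∂law (S n) (β₁ n)) - ∑ j, ξ n j * β₁ n j)
      - √(m n) * ((∫ D, T n D ∂law (S n) (β₀ n)) - ∑ j, ξ n j * β₀ n j) with hδ
  have hδ0 : Tendsto δ atTop (𝓝 0) := by simpa using h1.sub h2
  have hnm : Tendsto (fun n : ℕ => (n : ℝ) / m n) atTop (𝓝 0) := hT.rate.tendsto_div_nhds_zero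
  have hm1 : Tendsto (fun n : ℕ => 1 / m n) atTop (𝓝 0) := by
    refine squeeze_zero' (Eventually.of_forall fun n => (one_div_pos.2 (hmp n)).le) ?_ hnm
    filter_upwards [eventually_ge_atTop 1] with n hn
    have := hmp n
    gcongr
    exact_mod_cast hn
  have hm2 : Tendsto (fun n : ℕ => 1 + 2 / m n) atTop (𝓝 1) := by
    have := (hm1.const_mul 2).const_add 1
    simpa [div_eq_mul_inv] using this
  have hy : Tendsto (fun n : ℕ => (n : ℝ) / m n * (1 + 2 / m n)) atTop (𝓝 0) := by
    simpa using hnm.mul hm2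
  set k : ℕ → ℝ := fun n => (1 + 2 / m n) * (1 + n / m n * (1 + 2 / m n)) with hk
  have hk1 : Tendsto k atTop (𝓝 1) := by
    simpa using hm2.mul (hy.const_add 1)
  have hkpos : ∀ n, 0 < k n := fun n => by
    have := hmp n
    simp only [hk]
    positivity
  have hmain : ∀ᶠ n : ℕ in atTop, v n ≠ 0 → (√(v n) + δ n) ^ 2 ≤ n * V n * k n := by
    filter_upwards [hβ₁eq, hT.memLp, hy.eventually_le_const one_pos,
      hm1.eventually_le_const (by norm_num : (0 : ℝ) < 1 / 4), eventually_ge_atTop 1]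
      with n e1 hL hy1 hm4 hn hvn
    have hm := hmp n
    have hvp : 0 < v n := lt_of_le_of_ne (hv0 n) (Ne.symm hvn)
    have hsm : √(v n * m n) ^ 2 = v n * m n := Real.sq_sqrt (by positivity)
    have hs0 : 0 < √(v n * m n) := Real.sqrt_pos.2 (by positivity)
    have hquad : h n ⬝ᵥ S n *ᵥ h n = 1 / m n := by
      simp only [hh]
      rw [Matrix.mulVec_smul, dotProduct_smul, smul_dotProduct, inv_mulVec_quadratic (hS n)]
      change 1 / √(v n * m n) * (1 / √(v n * m n) * v n) = 1 / m n
      field_simp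
      rw [hsm]
    have hlin : ∑ j, ξ n j * β₁ n j = ∑ j, ξ n j * β₀ n j + √(v n) / √(m n) := by
      have h3 : ∑ j, ξ n j * h n j = √(v n) / √(m n) := by
        have h4 : ∑ j, ξ n j * h n j = 1 / √(v n * m n) * v n := by
          simp only [hh, Pi.smul_apply, smul_eq_mul]
          simp only [hv, dotProduct, Finset.mul_sum]
          exact Finset.sum_congr rfl fun j _ => by ring
        have h5 : √(v n) * √(v n) = v n := Real.mul_self_sqrt hvp.le
        rw [h4, Real.sqrt_mul hvp.le]
        have := Real.sqrt_pos.2 hvp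
        have := Real.sqrt_pos.2 hm
        field_simp
        linarith
      rw [← h3, ← Finset.sum_add_distrib]
      refine Finset.sum_congr rfl fun j _ => ?_
      rw [e1, ← mul_add]
      rfl
    have hdiff : (∫ D, T n D ∂law (S n) (β₁ n)) - ∫ D, T n D ∂law (S n) (β₀ n)
        = (√(v n) + δ n) / √(m n) := by
      have := Real.sqrt_pos.2 hm
      rw [eq_div_iff this.ne']
      simp only [hδ]
      rw [hlin]
      field_simp
      ring
    have hHCR := sq_integral_sub_le (hS n).posSemidef (hT.measurable n) (β₀ n) hL (h n) hquad hm4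
    rw [← e1, hdiff] at hHCR
    exact le_mul_variance hn hm (hV0 n) hy1 hHCR
  refine ⟨fun n => min 0 (n * V n - v n), ?_, ?_⟩
  · have h0 : Tendsto (fun n => 2 * √K * |δ n| + K * |k n - 1|) atTop (𝓝 0) := by
      have ha := hδ0.abs.const_mul (2 * √K)
      have hb := (hk1.sub_const 1).abs.const_mul K
      simpa using ha.add hb
    have h0' : Tendsto (fun n => (2 * √K * |δ n| + K * |k n - 1|) / k n) atTop (𝓝 0) := by
      have := h0.div hk1 one_ne_zero
      rw [div_one] at this
      exact this
    refine squeeze_zero_norm' ?_ h0'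
    filter_upwards [hmain, hK] with n hn hKn
    have hKn' : v n ≤ K := hKn
    have hK0 : 0 ≤ K := (hv0 n).trans hKn'
    have hkp := hkpos n
    have hnV : 0 ≤ n * V n := mul_nonneg (Nat.cast_nonneg n) (hV0 n)
    have hrhs : 0 ≤ (2 * √K * |δ n| + K * |k n - 1|) / k n := by positivity
    rw [Real.norm_eq_abs, abs_of_nonpos (min_le_left _ _), neg_le, le_min_iff]
    refine ⟨by linarith, ?_⟩
    by_cases hvn : v n = 0
    · rw [hvn]; linarith
    · have h3 := hn hvn
      -- `k v - (√v + δ)² ≤ (k - 1) v - 2 √v δ`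
      have h4 : (√(v n) + δ n) ^ 2 = v n + 2 * √(v n) * δ n + δ n ^ 2 := by
        rw [add_sq, Real.sq_sqrt (hv0 n)]
      have h5 : -(√(v n) * δ n) ≤ √K * |δ n| := by
        rw [← mul_neg]
        calc √(v n) * -δ n ≤ √(v n) * |δ n| := by gcongr; exact neg_le_abs _
          _ ≤ √K * |δ n| := by gcongr
      have h6 : v n * (k n - 1) ≤ K * |k n - 1| := by
        calc v n * (k n - 1) ≤ v n * |k n - 1| :=
              mul_le_mul_of_nonneg_left (le_abs_self _) (hv0 n)
          _ ≤ K * |k n - 1| := by gcongr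
      have h7 : v n - n * V n ≤ (2 * √K * |δ n| + K * |k n - 1|) / k n := by
        rw [le_div_iff₀ hkp]
        nlinarith [sq_nonneg (δ n)]
      linarith
  · filter_upwards [eventually_ge_atTop 1] with n hn
    have hn0 : (0 : ℝ) < n := by exact_mod_cast hn
    rw [div_le_iff₀ hn0]
    have := min_le_right 0 (n * V n - v n)
    change v n + min 0 (n * V n - v n) ≤ V n * n
    linarith

end Asymptotics

end HDLinear

end

open HDLinear in
theorem theorem7p3 (L M : ℝ) (hL : 0 < L) (hM : 0 < M) :
    -- threshold for the constant in the tuning parameters, depending on `L` and `M` only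
    ∃ κ₀ : ℝ, 0 < κ₀ ∧
    ∀ (p : ℕ → ℕ) (_ : ∀ n, 2 ≤ p n)
      -- the covariance matrices of the rows of the design
      (S : ∀ n, Matrix (Fin (p n)) (Fin (p n)) ℝ) (hS : ∀ n, (S n).PosDef)
      (_ : ∀ n i, L ≤ (hS n).isHermitian.eigenvalues i)
      (_ : ∀ n i j, |S n i j| ≤ M)
      -- the parameter set and the true parameter
      (d : ℕ → ℝ) (C : ℝ) (_ : 0 < C)
      (_ : d =o[atTop] fun n : ℕ => √(n : ℝ) / Real.log (p n))
      (_ : ∀ n (j : Fin (p n)), (sparsity (fun k => (S n)⁻¹ k j) : ℝ) ≤ d n)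
      (β₀ : ∀ n, Coef (p n)) (_ : ∀ n, β₀ n ∈ paramSet (p n) (d n) C)
      -- the functional of interest
      (ξ : ∀ n, Fin (p n) → ℝ)
      (_ : (fun n => ∑ j, |ξ n j|) =O[atTop] fun _ : ℕ => (1 : ℝ))
      -- the tuning parameters
      (κ₁ : ℝ) (lam : ℕ → ℝ) (lamNode : ∀ n, Fin (p n) → ℝ)
      (_ : ∀ n : ℕ, 1 ≤ n → κ₀ * √(Real.log (p n) / n) ≤ lam n ∧
        lam n ≤ κ₁ * √(Real.log (p n) / n))
      (_ : ∀ n : ℕ, 1 ≤ n → ∀ j, κ₀ * √(Real.log (p n) / n) ≤ lamNode n j ∧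
        lamNode n j ≤ κ₁ * √(Real.log (p n) / n))
      -- the Lasso and the nodewise Lasso (any measurable choice of the minimizers)
      (betaHat : ∀ n, Data n (p n) → Coef (p n))
      (gammaHat : ∀ n, Design n (p n) → ∀ j : Fin (p n), {k : Fin (p n) // k ≠ j} → ℝ)
      (_ : ∀ n, Measurable (betaHat n)) (_ : ∀ n, Measurable (gammaHat n))
      (_ : ∀ n : ℕ, 1 ≤ n → ∀ D, IsLasso (lam n) D (betaHat n D))
      (_ : ∀ n : ℕ, 1 ≤ n → ∀ X j, IsNodewise (lamNode n j) X j (gammaHat n X j))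
      -- the de-sparsified Lasso estimator `ξᵀ b̂`
      (bXi : ∀ n, Data n (p n) → ℝ)
      (_ : ∀ n D, bXi n D =
        ξ n ⬝ᵥ desparsified (thetaHat (lamNode n) D.1 (gammaHat n D.1)) D (betaHat n D)),
      -- `ξᵀ b̂` is strongly asymptotically unbiased
      (∃ m : ℕ → ℝ, ∀ c : ℝ, 0 < c →
        StronglyAsympUnbiased S d C (fun n β => ∑ j, ξ n j * β j) β₀ c m bXi) ∧
      -- the variance of `ξᵀ b̂`
      (∃ r : ℕ → ℝ, Tendsto r atTop (𝓝 0) ∧ ∀ᶠ n in atTop,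
        Var[bXi n; law (S n) (β₀ n)] = (ξ n ⬝ᵥ (S n)⁻¹ *ᵥ ξ n + r n) / n) ∧
      -- the lower bound for all strongly asymptotically unbiased estimators, when the worst
      -- sub-direction stays in the model
      (∀ (c : ℝ) (m : ℕ → ℝ) (T : ∀ n, Data n (p n) → ℝ), 0 < c →
        StronglyAsympUnbiased S d C (fun n β => ∑ j, ξ n j * β j) β₀ c m T →
        (∀ᶠ n in atTop,
          β₀ n + (1 / √((ξ n ⬝ᵥ (S n)⁻¹ *ᵥ ξ n) * m n)) • WithLp.toLp 2 ((S n)⁻¹ *ᵥ ξ n) ∈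
            nbhd (d n) C (β₀ n) (c / √(m n))) →
        ∃ r : ℕ → ℝ, Tendsto r atTop (𝓝 0) ∧ ∀ᶠ n in atTop,
          (ξ n ⬝ᵥ (S n)⁻¹ *ᵥ ξ n + r n) / n ≤ Var[T n; law (S n) (β₀ n)]) := by
  set B : ℝ := max (max M 1) (1 / L) with hB
  have hMB : M ≤ B := (le_max_left M 1).trans (le_max_left _ _)
  have h1B : 1 ≤ B := (le_max_right M 1).trans (le_max_left _ _)
  have hLB : 1 / L ≤ B := le_max_right _ _
  refine ⟨66 * B ^ 2, by positivity, ?_⟩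
  intro p hp S hS hSL hSM d C _ hd hdS β₀ hβ₀ ξ hξ κ₁ lam lamNode hlam hlamN betaHat gammaHat hbm
    hγm hb hγ bXi hbXi
  have hC : ∀ n, CovBounds (S n) L B := fun n =>
    { posDef := hS n
      pos := hL
      eigenvalues := hSL n
      diag_le := fun j => (le_abs_self _).trans ((hSM n j j).trans hMB)
      one_le := h1B
      inv_le := hLB }
  have hκ : 0 ≤ κ₁ := by
    have h := hlam 1 le_rfl
    have hlog : 0 < Real.log (p 1) := Real.log_pos (by exact_mod_cast hp 1)
    have hr : 0 < √(Real.log (p 1) / (1 : ℕ)) := Real.sqrt_pos.2 (by positivity)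
    have h2 : 66 * B ^ 2 ≤ κ₁ := le_of_mul_le_mul_right (h.1.trans h.2) hr
    exact le_trans (by positivity) h2
  obtain ⟨A, hA⟩ := hξ.bound
  have hA' : ∀ᶠ n in atTop, ∑ j, |ξ n j| ≤ A := hA.mono fun n hn => by
    simpa using (le_abs_self _).trans hn
  have hv : ∀ᶠ n in atTop, 0 ≤ ξ n ⬝ᵥ (S n)⁻¹ *ᵥ ξ n ∧ ξ n ⬝ᵥ (S n)⁻¹ *ᵥ ξ n ≤ A ^ 2 / L :=
    hA'.mono fun n hn => ⟨inv_quadratic_nonneg (hS n) _, (hC n).inv_quadratic_le_sq hn⟩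
  obtain ⟨ρ, hρ, hρ0, hrem⟩ := exists_remainder_rate hC hp C hd hdS hA' hκ hlam hlamN hbm hγm hb hγ
  have hmeas : ∀ n, Measurable (bXi n) := fun n => by
    rw [funext (hbXi n)]
    exact measurable_desparsified (hγm n) (hbm n) (ξ n)
  have hmv : ∀ᶠ n : ℕ in atTop, ∀ β ∈ paramSet (p n) (d n) C, MemLp (bXi n) 2 (law (S n) β) ∧
      |∫ D, bXi n D ∂law (S n) β - ∑ j, ξ n j * β j| ≤ √(ρ n / n) ∧
      |Var[bXi n; law (S n) β] - ξ n ⬝ᵥ (S n)⁻¹ *ᵥ ξ n / n|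
        ≤ ρ n / n + 2 * √(ξ n ⬝ᵥ (S n)⁻¹ *ᵥ ξ n / n * (ρ n / n)) := by
    filter_upwards [hrem, eventually_ge_atTop 1] with n hn hn1 β hβ
    exact desparsified_mean_variance (hS n) hn1 (hγm n) (hbm n) (hbXi n)
      (div_nonneg (hρ n) (Nat.cast_nonneg n)) (hn β hβ)
  refine ⟨⟨unbiasedRate ρ, fun c _ => stronglyAsympUnbiased_of_bias_le hβ₀ hmeas hρ hρ0 hv hmv c⟩,
    exists_variance_expansion hρ hρ0 hv (hmv.mono fun n hn => (hn _ (hβ₀ n)).2.2), ?_⟩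
  intro c m T hc hT hdir
  exact exists_variance_lower_bound hS hβ₀ (hv.mono fun n hn => hn.2) hc hT hdir
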